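/- Consider Burgers' equation $\partial_t u+\partial_x(u^2)=0$. For an interval $I$, let $\mathrm{TotVar}_I\, g$ be the total variation of the Lebesgue class of $g$, i.e. the least pointwise variation on $I$ among functions equal to $g$ a.e. on $I$; $BV(I)$ is the set of $g\in L^1(I)$ with $\mathrm{TotVar}_I\, g<\infty$. For $f\in C^2(\mathbb R)$, a function $u\in L^\infty(]0,T[\times\mathbb R)$ is an entropy admissible solution of $\partial_t u+\partial_x f(u)=0$, $u(0,\cdot)=u_0$, if $$\int_0^T\!\!\int_{\mathbb R}\partial_t\varphi\,|u-c|+\partial_x\varphi\,\mathrm{sign}(u-c)[f(u)-f(c)]\,dx\,dt+\int_{\mathbb R}\varphi(0,x)|u_0(x)-c|\,dx\ge 0$$ for all $c\in\mathbb R$ and all $0\le\varphi\in C^\infty_c(]-\infty,T[\times\mathbb R)$. The traces $u(\cdot,x^\pm)$ are the essential limits in $L^1(]0,T[)$ of $u(\cdot,y)$ as $y\to x^\pm$. There are $0<T<\infty$ and $u_0\in BV(\mathbb R)$ such that the Cauchy problem for Burgers' equation with datum $u_0$ has a unique (up to null sets) entropy admissible solution $u$ on $]0,T[\times\mathbb R$,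 and a representative of $u$ has the following properties. 1. There is $\gamma\in C^1(]0,T[)$ which is a shock curve of $u$: at each point $(t,\gamma(t))$ the function $u$ has limits $u_-(t)$ and $u_+(t)$ from the regions $\{x<\gamma\}$ and $\{x>\gamma\}$, respectively, the Rankine–Hugoniot condition $u_-^2-u_+^2=\gamma'(u_--u_+)$ holds, and so does the strict Lax condition $2u_+<\gamma'<2u_-$. The curve crosses the axis $x=0$ (passing from one side to the other) at infinitely many times $t\in\,]0,T[$. 2. $u(\cdot,0)=u(\cdot,0^-)=u(\cdot,0^+)$ a.e. on $]0,T[$, and $\mathrm{TotVar}_{]0,T[}\,u(\cdot,0)=+\infty$. 3. There are $\alpha<0<\beta$ with $\alpha<\gamma<\beta$ on $]0,T[$, and boundary data $\bar u,\underline u\in BV(]0,T[)$, such that the restriction of $u$ to $]0,T[\times]\alpha,\beta[$ is an entropy admissible solution (in the sense of Bardos–Le Roux–Nédélec) of the initial-boundary value problem with $u(0,\cdot)=u_0\in BV(]\alpha,\beta[)$, $u(\cdot,\alpha)=\bar u$, $u(\cdot,\beta)=\underline u$. That is, with $f(u)=u^2$, there are $u_\alpha,u_\beta\in L^\infty(]0,T[)$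 such that, for $h=f$ and for $h(v)=\mathrm{sign}(v-c)[f(v)-f(c)]$, $c\in\mathbb R$, $h(u)(\cdot,y)$ converges essentially in $L^1(]0,T[)$ to $h(u_\alpha)$ as $y\to\alpha^+$ and to $h(u_\beta)$ as $y\to\beta^-$, and $$\int_0^T\!\!\int_\alpha^\beta\partial_t\varphi|u-c|+\partial_x\varphi\,\mathrm{sign}(u-c)[f(u)-f(c)]\,dx\,dt+\int_\alpha^\beta\varphi(0,\cdot)|u_0-c|\,dx+\int_0^T\varphi(\cdot,\alpha)\,\mathrm{sign}(\bar u-c)[f(u_\alpha)-f(c)]\,dt-\int_0^T\varphi(\cdot,\beta)\,\mathrm{sign}(\underline u-c)[f(u_\beta)-f(c)]\,dt\ge0$$ for all $c\in\mathbb R$ and $0\le\varphi\in C^\infty_c(]-\infty,T[\times\mathbb R)$. Consequently, for each choice of sign $\pm$, both of the following assertions are false: (a) there is a function $C$ such that $\mathrm{TotVar}_{]0,T[}\,u(\cdot,x^\pm)\le C(\mathrm{TotVar}\,u_0,\ \max_{[\operatorname{ess\,inf}u_0,\operatorname{ess\,sup}u_0]}|f'|)$ for all convex or concave $f\in C^2(\mathbb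 R)$, all $u_0\in BV(\mathbb R)$, all $T>0$, all entropy admissible solutions $u$ on $]0,T[\times\mathbb R$ and all $x\in\mathbb R$ at which the trace exists; (b) $\mathrm{TotVar}_{]0,T[}\,u(\cdot,x^\pm)\le\mathrm{TotVar}\,u_0$ for all convex (not necessarily monotone) $f\in C^2(\mathbb R)$, all $u_0\in BV(\mathbb R)$, all $T>0$, all entropy admissible solutions $u$ on $]0,T[\times\mathbb R$ and all $x\in\mathbb R$ at which the trace exists. -/

import Mathlib

open MeasureTheory Set Filter Topology
open scoped ENNReal

noncomputable section

/-- The total variation on the interval `s` of the Lebesgue class of `g`: the least pointwise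
variation among all functions that agree with `g` almost everywhere on `s`. -/
def essTotVar (g : ℝ → ℝ) (s : Set ℝ) : ℝ≥0∞ :=
  ⨅ (h : ℝ → ℝ) (_ : h =ᵐ[volume.restrict s] g), eVariationOn h s

/-- `g ∈ BV(s)` for an open interval `s`: integrable with finite total variation. -/
def MemBV (g : ℝ → ℝ) (s : Set ℝ) : Prop :=
  IntegrableOn g s ∧ essTotVar g s < ⊤

/-- The flux of Burgers' equation `∂ₜ u + ∂ₓ (u²) = 0`. -/
def burgers (u : ℝ) : ℝ := u ^ 2

/-- The Kruzhkov entropy flux `sign (u - c) (f u - f c)`. -/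
def kruzhkovFlux (f : ℝ → ℝ) (c u : ℝ) : ℝ := Real.sign (u - c) * (f u - f c)

/-- Nonnegative smooth functions of `(t, x)` with compact support in `]-∞, T[ × ℝ`. -/
structure IsTestFunction (T : ℝ) (φ : ℝ × ℝ → ℝ) : Prop where
  smooth : ContDiff ℝ (⊤ : ℕ∞) φ
  compact : HasCompactSupport φ
  support : tsupport φ ⊆ Iio T ×ˢ univ
  nonneg : ∀ p, 0 ≤ φ p

/-- The interior part of the Kruzhkov inequality on `]0, T[ × J`. Points of the plane are `(t, x)`;
`fderiv ℝ φ p (1, 0)` is `∂ₜ φ` and `fderiv ℝ φ p (0, 1)` is `∂ₓ φ`. -/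
def kruzhkovIntegral (f : ℝ → ℝ) (T : ℝ) (J : Set ℝ) (u φ : ℝ × ℝ → ℝ) (c : ℝ) : ℝ :=
  ∫ p in Ioo 0 T ×ˢ J,
    (fderiv ℝ φ p (1, 0) * |u p - c| + fderiv ℝ φ p (0, 1) * kruzhkovFlux f c (u p))

/-- `u ∈ L^∞(]0, T[ × ℝ)` is an entropy admissible solution of the Cauchy problem
`∂ₜ u + ∂ₓ (f u) = 0`, `u(0, ·) = u₀`. -/
structure IsEntropySolution (f : ℝ → ℝ) (T : ℝ) (u₀ : ℝ → ℝ) (u : ℝ × ℝ → ℝ) : Prop where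
  bounded : MemLp u ⊤ (volume.restrict (Ioo 0 T ×ˢ univ))
  entropy : ∀ c φ, IsTestFunction T φ →
    0 ≤ kruzhkovIntegral f T univ u φ c + ∫ x, φ (0, x) * |u₀ x - c|

/-- `w(·, y) → g` in `L¹(]0, T[)` as `y` tends to its limit along `l`, in the sense of
essential limits. -/
def EssTendstoL1 (w : ℝ × ℝ → ℝ) (T : ℝ) (l : Filter ℝ) (g : ℝ → ℝ) : Prop :=
  Tendsto (fun y => ∫⁻ t in Ioo 0 T, ‖w (t, y) - g t‖ₑ) (l ⊓ ae volume) (𝓝 0)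

/-- `g ∈ L¹(]0, T[)` is the left trace `u(·, x⁻)`. -/
def IsLeftTrace (u : ℝ × ℝ → ℝ) (T x : ℝ) (g : ℝ → ℝ) : Prop :=
  IntegrableOn g (Ioo 0 T) ∧ EssTendstoL1 u T (𝓝[<] x) g

/-- `g ∈ L¹(]0, T[)` is the right trace `u(·, x⁺)`. -/
def IsRightTrace (u : ℝ × ℝ → ℝ) (T x : ℝ) (g : ℝ → ℝ) : Prop :=
  IntegrableOn g (Ioo 0 T) ∧ EssTendstoL1 u T (𝓝[>] x) g

/-- `u ∈ L^∞(]0, T[ × ]α, β[)` is an entropy admissible solution of the initial-boundary value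
problem `∂ₜ u + ∂ₓ (f u) = 0`, `u(0, ·) = u₀`, `u(·, α) = ul`, `u(·, β) = ur`, in the sense of
Bardos, Le Roux and Nédélec. The functions `uα`, `uβ` provide the strong traces of `f u` and of the
Kruzhkov entropy fluxes at the two boundaries. -/
structure IsEntropySolutionIBVP (f : ℝ → ℝ) (T α β : ℝ) (u₀ ul ur : ℝ → ℝ)
    (u : ℝ × ℝ → ℝ) : Prop where
  bounded : MemLp u ⊤ (volume.restrict (Ioo 0 T ×ˢ Ioo α β))
  entropy : ∃ uα uβ : ℝ → ℝ,
    MemLp uα ⊤ (volume.restrict (Ioo 0 T)) ∧ MemLp uβ ⊤ (volume.restrict (Ioo 0 T)) ∧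
    EssTendstoL1 (fun p => f (u p)) T (𝓝[>] α) (fun t => f (uα t)) ∧
    EssTendstoL1 (fun p => f (u p)) T (𝓝[<] β) (fun t => f (uβ t)) ∧
    (∀ c, EssTendstoL1 (fun p => kruzhkovFlux f c (u p)) T (𝓝[>] α)
      (fun t => kruzhkovFlux f c (uα t))) ∧
    (∀ c, EssTendstoL1 (fun p => kruzhkovFlux f c (u p)) T (𝓝[<] β)
      (fun t => kruzhkovFlux f c (uβ t))) ∧
    ∀ c φ, IsTestFunction T φ →
      0 ≤ kruzhkovIntegral f T (Ioo α β) u φ c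
        + (∫ x in Ioo α β, φ (0, x) * |u₀ x - c|)
        + (∫ t in Ioo 0 T, φ (t, α) * (Real.sign (ul t - c) * (f (uα t) - f c)))
        - ∫ t in Ioo 0 T, φ (t, β) * (Real.sign (ur t - c) * (f (uβ t) - f c))

/-- `x = γ(t)`, `0 < t < T`, is a `C¹` shock curve of `u`: at every point of the curve `u` has the
limits `um` and `up` from the regions to the left and to the right of the curve, and these satisfy
the Rankine-Hugoniot and the (strict) Lax conditions. -/
structure IsShockCurve (f : ℝ → ℝ) (T : ℝ) (u : ℝ × ℝ → ℝ) (γ um up : ℝ → ℝ) : Prop where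
  contDiff : ContDiffOn ℝ 1 γ (Ioo 0 T)
  left_limit : ∀ t ∈ Ioo 0 T,
    Tendsto u (𝓝[{p | p.1 ∈ Ioo 0 T ∧ p.2 < γ p.1}] (t, γ t)) (𝓝 (um t))
  right_limit : ∀ t ∈ Ioo 0 T,
    Tendsto u (𝓝[{p | p.1 ∈ Ioo 0 T ∧ γ p.1 < p.2}] (t, γ t)) (𝓝 (up t))
  rankine_hugoniot : ∀ t ∈ Ioo 0 T, f (um t) - f (up t) = deriv γ t * (um t - up t)
  lax : ∀ t ∈ Ioo 0 T, deriv f (up t) < deriv γ t ∧ deriv γ t < deriv f (um t)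

/-- At time `t` the curve `x = γ(t)` passes from one side of the axis `x = 0` to the other. -/
def CrossesZeroAt (γ : ℝ → ℝ) (t : ℝ) : Prop :=
  γ t = 0 ∧
    ((∀ᶠ s in 𝓝[<] t, γ s < 0) ∧ (∀ᶠ s in 𝓝[>] t, 0 < γ s) ∨
      (∀ᶠ s in 𝓝[<] t, 0 < γ s) ∧ (∀ᶠ s in 𝓝[>] t, γ s < 0))

/-- The maximum of `|f'|` over `[ess inf u₀, ess sup u₀]`. -/
def derivBound (f u₀ : ℝ → ℝ) : ℝ :=
  sSup ((fun v => |deriv f v|) '' Icc (essInf u₀ volume) (essSup u₀ volume))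

/-- The assertion that, for all convex or concave `C²` fluxes and all `BV` data, the total variation
in time of the traces of the entropy admissible solution at every `x` is bounded by a constant that
depends only on `TotVar u₀` and on `‖f'‖_∞`. The parameter `IsTrace` is the left or the right trace. -/
def TraceVariationControlled
    (IsTrace : (ℝ × ℝ → ℝ) → ℝ → ℝ → (ℝ → ℝ) → Prop) : Prop :=
  ∃ C : ℝ → ℝ → ℝ, ∀ f : ℝ → ℝ, ContDiff ℝ 2 f →
    (ConvexOn ℝ univ f ∨ ConcaveOn ℝ univ f) →
    ∀ u₀ : ℝ → ℝ, MemBV u₀ univ → ∀ T : ℝ, 0 < T →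
    ∀ u, IsEntropySolution f T u₀ u → ∀ (x : ℝ) (g : ℝ → ℝ), IsTrace u T x g →
      essTotVar g (Ioo 0 T) ≤ ENNReal.ofReal (C (essTotVar u₀ univ).toReal (derivBound f u₀))

/-- The assertion that, for all convex `C²` fluxes (monotone or not) and all `BV` data, the total
variation in time of the traces of the entropy admissible solution at every `x` is bounded by
`TotVar u₀`. The parameter `IsTrace` is the left or the right trace. -/
def TraceVariationLeInitial
    (IsTrace : (ℝ × ℝ → ℝ) → ℝ → ℝ → (ℝ → ℝ) → Prop) : Prop :=
  ∀ f : ℝ → ℝ, ContDiff ℝ 2 f → ConvexOn ℝ univ f →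
    ∀ u₀ : ℝ → ℝ, MemBV u₀ univ → ∀ T : ℝ, 0 < T →
    ∀ u, IsEntropySolution f T u₀ u → ∀ (x : ℝ) (g : ℝ → ℝ), IsTrace u T x g →
      essTotVar g (Ioo 0 T) ≤ essTotVar u₀ univ

end

/-! The shock is designed first and the data are read off from it. Let γ(t) = (1 - t)⁴ sin(π/(1 -
t))/1000, which changes sign infinitely often as t → 1, and put the state -1 on its right. For the
flux u² the Rankine–Hugoniot condition reads γ' = u₋ + u₊, so the left state along the curve has to
be 1 + γ'(t). Followed backwards along characteristics, this value starts at the foot Y(t) = γ(t) -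
2t(1 + γ'(t)). Because γ' and γ'' are small, Y decreases with slope at most -1. The value at the
foot is therefore a Lipschitz function with a small constant, and characteristics do not cross
before t = 1 (`exists_core_data`). The data have a single jump and bounded variation, while the axis
x = 0 sees a value ≥ 1/2 when γ > 0 and the value -1 when γ < 0. These are infinitely many jumps of
size at least 3/2 (`essTotVar_eq_top`).

Existence and uniqueness both come from one Kato inequality, ∂ₜ|v - u| + ∂ₓ(|v - u|(v + u)) ≤ 0,
between an arbitrary Kruzhkov solution v and the glued function u (`IsKruzhkov.compare_glue`). For
constant v it is the entropy inequality for u. For v with the same datum, tested with a truncated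
cone, it gives v = u (`IsShockPair.unique`).

No doubling of variables is needed, since u is piecewise Lipschitz. To compare v with a Lipschitz
solution w (`IsKruzhkov.compare`), the inequality with constant c is tested with ψ·b((c - w)/ε),
where b is an even bump, and integrated over c. The equation for w reduces the terms containing b'
to the moment of `abs_integral_deriv_bump_le`, which is O(ε²) against a factor 1/ε. Across the
shock, the comparisons with the two sides are joined by a thin cut-off layer. Rankine–Hugoniot and
the ordering of the states turn the layer term into `shock_inequality` up to a vanishing error.

For the strip problem, u coincides near the curve with the solution for data without a cut-off at
infinity. That solution is constant on each side of the strip, so the exterior part of its entropy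
inequality can be computed and becomes the boundary terms (`IsEntropySolution.strip_inequality`). -/

noncomputable section

/-! ### Lipschitz test functions and their mollification -/

/-- Nonnegative Lipschitz functions of `(t, x)` whose support is bounded and lies to the left of
some `T' < T`. -/
structure IsLipschitzTest (T : ℝ) (φ : ℝ × ℝ → ℝ) : Prop where
  lip : ∃ K, LipschitzWith K φ
  support : ∃ R T', T' < T ∧ ∀ p, φ p ≠ 0 → ‖p‖ ≤ R ∧ p.1 ≤ T'
  nonneg : ∀ p, 0 ≤ φ p

theorem IsLipschitzTest.hasCompactSupport {T : ℝ} {φ : ℝ × ℝ → ℝ} (h : IsLipschitzTest T φ) :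
    HasCompactSupport φ := by
  obtain ⟨R, T', -, hs⟩ := h.support
  refine HasCompactSupport.of_support_subset_isCompact (isCompact_closedBall (0 : ℝ × ℝ) R) ?_
  intro p hp
  simpa using (hs p hp).1

theorem IsTestFunction.isLipschitzTest {T : ℝ} {φ : ℝ × ℝ → ℝ} (h : IsTestFunction T φ) :
    IsLipschitzTest T φ := by
  refine ⟨?_, ?_, h.nonneg⟩
  · exact ⟨_, ((h.smooth.of_le (by simp : (1 : WithTop ℕ∞) ≤ ((⊤ : ℕ∞) : WithTop ℕ∞))).lipschitzWith_of_hasCompactSupport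
      h.compact (by simp)).choose_spec⟩
  · obtain ⟨R, hR⟩ := h.compact.isCompact.isBounded.subset_closedBall (0 : ℝ × ℝ)
    by_cases hne : (tsupport φ).Nonempty
    · obtain ⟨q, hq, hmax⟩ := h.compact.isCompact.exists_isMaxOn hne continuous_fst.continuousOn
      refine ⟨R, q.1, (h.support hq).1, fun p hp => ⟨?_, ?_⟩⟩
      · simpa using hR (subset_tsupport _ hp)
      · exact hmax (subset_tsupport _ hp)
    · refine ⟨0, T - 1, by linarith, fun p hp => (hne ⟨p, subset_tsupport _ hp⟩).elim⟩

/-- The derivative of a mollified Lipschitz function is the mollified derivative. -/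
theorem LipschitzWith.hasFDerivAt_normed_convolution {K : NNReal} {φ : ℝ × ℝ → ℝ}
    (hφ : LipschitzWith K φ) (ρ : ContDiffBump (0 : ℝ × ℝ)) (p : ℝ × ℝ) :
    HasFDerivAt (convolution (ρ.normed volume) φ (ContinuousLinearMap.lsmul ℝ ℝ) volume)
      (convolution (ρ.normed volume) (fderiv ℝ φ) (ContinuousLinearMap.lsmul ℝ ℝ) volume p) p := by
  have hρi : Integrable (ρ.normed volume) (volume : Measure (ℝ × ℝ)) := ρ.integrable_normed
  -- Differentiation under the integral: the integrands are Lipschitz with constant K times the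
  -- kernel, and Rademacher's theorem provides the derivative of φ(· - q) at p for almost every q.
  have key := hasFDerivAt_integral_of_dominated_loc_of_lip (𝕜 := ℝ) (μ := (volume : Measure (ℝ × ℝ)))
    (F := fun x q => ρ.normed volume q * φ (x - q)) (x₀ := p)
    (F' := fun q => ρ.normed volume q • fderiv ℝ φ (p - q))
    (bound := fun q => ρ.normed volume q * K) (s := univ) univ_mem ?_ ?_ ?_ ?_ ?_ ?_
  · exact key.2
  · refine Eventually.of_forall fun x => ?_
    exact (ρ.continuous_normed.mul (hφ.continuous.comp (continuous_const.sub continuous_id))).aestronglyMeasurable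
  · refine Continuous.integrable_of_hasCompactSupport
      (ρ.continuous_normed.mul (hφ.continuous.comp (continuous_const.sub continuous_id))) ?_
    exact ρ.hasCompactSupport_normed.mul_right
  · have : Measurable fun q : ℝ × ℝ => fderiv ℝ φ (p - q) :=
      (measurable_fderiv ℝ φ).comp (measurable_const.sub measurable_id)
    exact (ρ.continuous_normed.measurable.smul this).aestronglyMeasurable
  · refine Eventually.of_forall fun q => ?_
    refine LipschitzWith.lipschitzOnWith (LipschitzWith.of_dist_le_mul fun x y => ?_)
    have h0 := ρ.nonneg_normed (μ := volume) q
    rw [Real.dist_eq, ← mul_sub, abs_mul, abs_of_nonneg h0, Real.coe_nnabs,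
      abs_of_nonneg (mul_nonneg h0 K.coe_nonneg), mul_assoc]
    refine mul_le_mul_of_nonneg_left ?_ h0
    have := hφ.dist_le_mul (x - q) (y - q)
    rwa [Real.dist_eq, dist_sub_right] at this
  · exact hρi.mul_const _
  · have h1 : ∀ᵐ q ∂(volume : Measure (ℝ × ℝ)), DifferentiableAt ℝ φ q := hφ.ae_differentiableAt
    have h2 : ∀ᵐ q ∂(volume : Measure (ℝ × ℝ)), DifferentiableAt ℝ φ (p - q) :=
      (quasiMeasurePreserving_sub_left volume p).ae h1
    filter_upwards [h2] with q hq
    have h3 : HasFDerivAt (fun x => φ (x - q)) (fderiv ℝ φ (p - q)) p := by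
      have := HasFDerivAt.comp (g := φ) p hq.hasFDerivAt ((hasFDerivAt_id p).sub_const q)
      rwa [ContinuousLinearMap.comp_id] at this
    simpa using h3.const_mul (ρ.normed volume q)

/-- This allows smooth test functions to be replaced by Lipschitz ones: gradients and supports of
the mollifications are uniformly bounded, and the gradients converge at Lebesgue points, so
dominated convergence applies to the entropy inequality. -/
theorem IsLipschitzTest.exists_mollification {T : ℝ} {φ : ℝ × ℝ → ℝ} (h : IsLipschitzTest T φ) :
    ∃ (φn : ℕ → ℝ × ℝ → ℝ) (K R : ℝ), (∀ n, IsTestFunction T (φn n)) ∧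
      (∀ n p, ‖fderiv ℝ (φn n) p‖ ≤ K) ∧ (∀ n p, |φn n p| ≤ K) ∧
      (∀ n p, R < ‖p‖ → φn n p = 0) ∧
      (∀ p, Tendsto (fun n => φn n p) atTop (𝓝 (φ p))) ∧
      ∀ᵐ p, Tendsto (fun n => fderiv ℝ (φn n) p) atTop (𝓝 (fderiv ℝ φ p)) := by
  obtain ⟨K, hK⟩ := h.lip
  obtain ⟨R, T', hT', hs⟩ := h.support
  obtain ⟨C, hC⟩ := h.hasCompactSupport.exists_bound_of_continuous hK.continuous
  -- The bound (T - T')/2 keeps the enlarged support to the left of T; the bound 1 keeps it in the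
  -- ball of radius R + 1.
  set r : ℝ := min 1 ((T - T') / 2) with hr
  have hr0 : 0 < r := lt_min one_pos (by linarith)
  -- The inner radius is half the outer one: a fixed ratio is what the Lebesgue differentiation
  -- theorem for bump kernels requires.
  let ρ : ℕ → ContDiffBump (0 : ℝ × ℝ) := fun n =>
    ⟨r / (n + 1) / 2, r / (n + 1), by positivity, half_lt_self (by positivity)⟩
  have hout : ∀ n, (ρ n).rOut = r / (n + 1) := fun n => rfl
  have hout_le : ∀ n, (ρ n).rOut ≤ r := fun n => by
    rw [hout]; exact div_le_self hr0.le (by linarith [(Nat.cast_nonneg n : (0 : ℝ) ≤ n)])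
  have hlim : Tendsto (fun n => (ρ n).rOut) atTop (𝓝 0) := by
    simp only [hout]
    have := (tendsto_one_div_add_atTop_nhds_zero_nat (𝕜 := ℝ)).const_mul r
    simpa only [mul_one_div, mul_zero] using this
  let φn : ℕ → ℝ × ℝ → ℝ := fun n =>
    convolution ((ρ n).normed volume) φ (ContinuousLinearMap.lsmul ℝ ℝ) volume
  have hφn : ∀ n p, φn n p = ∫ q, (ρ n).normed volume q * φ (p - q) := fun n p => rfl
  have hnn : ∀ n p, 0 ≤ φn n p := fun n p => by
    rw [hφn]
    exact integral_nonneg fun q => mul_nonneg ((ρ n).nonneg_normed q) (h.nonneg _)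
  have hdist : ∀ n p, dist (φn n p) (φ p) ≤ K * (ρ n).rOut := fun n p => by
    refine ContDiffBump.dist_normed_convolution_le hK.continuous.aestronglyMeasurable ?_
    intro q hq
    exact (hK.dist_le_mul q p).trans (mul_le_mul_of_nonneg_left (Metric.mem_ball.1 hq).le K.2)
  have hzero : ∀ n p, φn n p ≠ 0 → ‖p‖ ≤ R + 1 ∧ p.1 ≤ T' + r := by
    intro n p hp
    have : ∃ q, (ρ n).normed volume q * φ (p - q) ≠ 0 := by
      by_contra! hcon
      exact hp (by rw [hφn]; simp [hcon])
    obtain ⟨q, hq⟩ := this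
    have hq1 : q ∈ Metric.ball (0 : ℝ × ℝ) (ρ n).rOut := by
      rw [← (ρ n).support_normed_eq (μ := volume)]
      exact left_ne_zero_of_mul hq
    have hq2 : ‖q‖ < r := by
      have := Metric.mem_ball.1 hq1
      rw [dist_zero_right] at this
      exact this.trans_le (hout_le n)
    obtain ⟨h1, h2⟩ := hs _ (right_ne_zero_of_mul hq)
    have h3 : ‖p‖ ≤ ‖p - q‖ + ‖q‖ := by simpa using norm_add_le (p - q) q
    have h4 : |q.1| ≤ ‖q‖ := norm_fst_le q
    have h5 : r ≤ 1 := min_le_left _ _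
    have h6 := le_abs_self q.1
    constructor
    · linarith
    · have : (p - q).1 = p.1 - q.1 := rfl
      linarith
  have hder : ∀ n p, HasFDerivAt (φn n)
      (convolution ((ρ n).normed volume) (fderiv ℝ φ) (ContinuousLinearMap.lsmul ℝ ℝ) volume p) p :=
    fun n p => hK.hasFDerivAt_normed_convolution (ρ n) p
  have hrT : r ≤ (T - T') / 2 := min_le_right _ _
  refine ⟨φn, max K (C + K), R + 1, ?_, ?_, ?_, ?_, ?_, ?_⟩
  · intro n
    refine ⟨?_, ?_, ?_, hnn n⟩
    · exact HasCompactSupport.contDiff_convolution_left _ (ρ n).hasCompactSupport_normed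
        (ρ n).contDiff_normed hK.continuous.locallyIntegrable
    · refine HasCompactSupport.of_support_subset_isCompact
        (isCompact_closedBall (0 : ℝ × ℝ) (R + 1)) ?_
      intro p hp
      simpa using (hzero n p hp).1
    · have hcl : IsClosed {p : ℝ × ℝ | p.1 ≤ T' + r} := isClosed_le continuous_fst continuous_const
      have : tsupport (φn n) ⊆ {p : ℝ × ℝ | p.1 ≤ T' + r} :=
        closure_minimal (fun p hp => (hzero n p hp).2) hcl
      intro p hp
      have := this hp
      change p.1 ≤ T' + r at this
      exact ⟨by simp only [mem_Iio]; linarith, mem_univ _⟩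
  · intro n p
    rw [(hder n p).fderiv, convolution_def]
    refine le_trans ?_ (le_max_left _ _)
    refine (norm_integral_le_of_norm_le ((ρ n).integrable_normed.mul_const (K : ℝ))
      (Eventually.of_forall fun q => ?_)).trans ?_
    · rw [ContinuousLinearMap.lsmul_apply, norm_smul, Real.norm_of_nonneg ((ρ n).nonneg_normed q)]
      exact mul_le_mul_of_nonneg_left (norm_fderiv_le_of_lipschitz ℝ hK) ((ρ n).nonneg_normed q)
    · rw [integral_mul_const, (ρ n).integral_normed, one_mul]
  · intro n p
    refine le_trans ?_ (le_max_right _ _)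
    have h1 := hdist n p
    have h2 := hC p
    rw [Real.dist_eq] at h1
    rw [Real.norm_eq_abs] at h2
    have h3 : (K : ℝ) * (ρ n).rOut ≤ K := by
      have : (ρ n).rOut ≤ 1 := (hout_le n).trans (min_le_left _ _)
      exact mul_le_of_le_one_right K.2 this
    have h4 := abs_sub_abs_le_abs_sub (φn n p) (φ p)
    linarith
  · intro n p hp
    by_contra hne
    exact absurd (hzero n p hne).1 (not_le.2 hp)
  · intro p
    rw [tendsto_iff_dist_tendsto_zero]
    refine squeeze_zero (fun _ => dist_nonneg) (fun n => hdist n p) ?_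
    simpa using hlim.const_mul (K : ℝ)
  · have hloc : LocallyIntegrable (fderiv ℝ φ) (volume : Measure (ℝ × ℝ)) := by
      refine (locallyIntegrable_const (K : ℝ)).mono (measurable_fderiv ℝ φ).aestronglyMeasurable ?_
      refine Eventually.of_forall fun p => ?_
      simpa using norm_fderiv_le_of_lipschitz ℝ hK
    have := ContDiffBump.ae_convolution_tendsto_right_of_locallyIntegrable (φ := ρ) (K := 2) hlim
      (Eventually.of_forall fun n => by
        show r / (n + 1) ≤ 2 * (r / (n + 1) / 2); linarith) hloc
    filter_upwards [this] with p hp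
    refine hp.congr fun n => ?_
    exact ((hder n p).fderiv).symm

theorem fderiv_eq_zero_of_norm_gt {φ : ℝ × ℝ → ℝ} {R : ℝ} (h : ∀ p, R < ‖p‖ → φ p = 0)
    {p : ℝ × ℝ} (hp : R < ‖p‖) : fderiv ℝ φ p = 0 := by
  have : φ =ᶠ[𝓝 p] fun _ => 0 := by
    filter_upwards [(isOpen_lt continuous_const continuous_norm).mem_nhds hp] with q hq
    exact h q hq
  rw [this.fderiv_eq]
  simp

/-! ### Kruzhkov inequalities with Lipschitz test functions -/

/-- The Kruzhkov entropy flux of Burgers' equation. -/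
theorem kruzhkovFlux_burgers (c v : ℝ) : kruzhkovFlux burgers c v = |v - c| * (v + c) := by
  unfold kruzhkovFlux burgers
  have : v ^ 2 - c ^ 2 = (v - c) * (v + c) := by ring
  rw [this, ← mul_assoc]
  rcases lt_trichotomy (v - c) 0 with h | h | h
  · rw [Real.sign_of_neg h, abs_of_neg h]; ring
  · simp [h]
  · rw [Real.sign_of_pos h, abs_of_pos h]; ring

theorem integrable_indicator_closedBall (R C : ℝ) (s : Set (ℝ × ℝ)) :
    Integrable ((Metric.closedBall (0 : ℝ × ℝ) R).indicator fun _ => C) (volume.restrict s) := by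
  refine Integrable.integrableOn ?_
  rw [integrable_indicator_iff Metric.isClosed_closedBall.measurableSet]
  exact integrableOn_const (measure_closedBall_lt_top.ne)

/-- Convergence of the first-order functional along an approximation of the test function. -/
theorem tendsto_integral_fderiv_of_approx {φ : ℝ × ℝ → ℝ} {φn : ℕ → ℝ × ℝ → ℝ} {K R M : ℝ}
    {A B : ℝ × ℝ → ℝ} {s : Set (ℝ × ℝ)}
    (hA : Measurable A) (hB : Measurable B) (hAM : ∀ p, |A p| ≤ M) (hBM : ∀ p, |B p| ≤ M)
    (h1 : ∀ n p, ‖fderiv ℝ (φn n) p‖ ≤ K) (h2 : ∀ n p, R < ‖p‖ → φn n p = 0)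
    (h3 : ∀ᵐ p, Tendsto (fun n => fderiv ℝ (φn n) p) atTop (𝓝 (fderiv ℝ φ p))) :
    Tendsto (fun n => ∫ p in s, (fderiv ℝ (φn n) p (1, 0) * A p + fderiv ℝ (φn n) p (0, 1) * B p))
      atTop (𝓝 (∫ p in s, (fderiv ℝ φ p (1, 0) * A p + fderiv ℝ φ p (0, 1) * B p))) := by
  refine tendsto_integral_of_dominated_convergence
    ((Metric.closedBall (0 : ℝ × ℝ) R).indicator fun _ => K * M + K * M) ?_
    (integrable_indicator_closedBall _ _ _) ?_ ?_
  · intro n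
    have m1 := measurable_fderiv_apply_const ℝ (φn n) (1, 0)
    have m2 := measurable_fderiv_apply_const ℝ (φn n) (0, 1)
    exact ((m1.mul hA).add (m2.mul hB)).aestronglyMeasurable
  · intro n
    refine Eventually.of_forall fun p => ?_
    by_cases hp : ‖p‖ ≤ R
    · rw [indicator_of_mem (by simpa using hp)]
      have hK : 0 ≤ K := (norm_nonneg _).trans (h1 n p)
      have e1 : |fderiv ℝ (φn n) p (1, 0)| ≤ K := by
        simpa using (fderiv ℝ (φn n) p).le_of_opNorm_le (h1 n p) (1, 0)
      have e2 : |fderiv ℝ (φn n) p (0, 1)| ≤ K := by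
        simpa using (fderiv ℝ (φn n) p).le_of_opNorm_le (h1 n p) (0, 1)
      refine (abs_add_le _ _).trans ?_
      rw [abs_mul, abs_mul]
      exact add_le_add (mul_le_mul e1 (hAM p) (abs_nonneg _) hK)
        (mul_le_mul e2 (hBM p) (abs_nonneg _) hK)
    · rw [fderiv_eq_zero_of_norm_gt (h2 n) (not_le.1 hp),
        indicator_of_notMem (by simpa using hp)]
      simp
  · filter_upwards [ae_restrict_of_ae h3] with p hp
    have c1 := ((ContinuousLinearMap.apply ℝ ℝ ((1 : ℝ), (0 : ℝ))).continuous.tendsto _).comp hp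
    have c2 := ((ContinuousLinearMap.apply ℝ ℝ ((0 : ℝ), (1 : ℝ))).continuous.tendsto _).comp hp
    exact (c1.mul_const _).add (c2.mul_const _)

/-- The Kruzhkov inequality with constant `c` extends to Lipschitz test functions. -/
theorem kruzhkov_of_isLipschitzTest {T M c : ℝ} {v : ℝ × ℝ → ℝ} {v₀ : ℝ → ℝ}
    (hv : Measurable v) (hvM : ∀ p, |v p| ≤ M) (hv₀ : Measurable v₀) (hv₀M : ∀ x, |v₀ x| ≤ M)
    (H : ∀ φ, IsTestFunction T φ →
      0 ≤ kruzhkovIntegral burgers T univ v φ c + ∫ x, φ (0, x) * |v₀ x - c|)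
    {φ : ℝ × ℝ → ℝ} (hφ : IsLipschitzTest T φ) :
    0 ≤ (∫ p in Ioo 0 T ×ˢ univ, (fderiv ℝ φ p (1, 0) * |v p - c| +
      fderiv ℝ φ p (0, 1) * (|v p - c| * (v p + c)))) + ∫ x, φ (0, x) * |v₀ x - c| := by
  obtain ⟨φn, K, R, t1, t2, t3, t4, t5, t6⟩ := hφ.exists_mollification
  have hb : ∀ a, |a| ≤ M → |(|a - c|)| ≤ (M + |c|) * (M + |c| + 1) ∧
      |(|a - c| * (a + c))| ≤ (M + |c|) * (M + |c| + 1) := by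
    intro a ha
    have e1 : |a - c| ≤ M + |c| := (abs_sub _ _).trans (by linarith)
    have e2 : |a + c| ≤ M + |c| := (abs_add_le _ _).trans (by linarith)
    have e0 : 0 ≤ M + |c| := (abs_nonneg _).trans e1
    rw [abs_mul, abs_abs]
    constructor
    · nlinarith
    · calc |a - c| * |a + c| ≤ (M + |c|) * (M + |c|) := mul_le_mul e1 e2 (abs_nonneg _) e0
        _ ≤ _ := by nlinarith
  have L1 := tendsto_integral_fderiv_of_approx (φ := φ) (φn := φn) (s := Ioo 0 T ×ˢ univ)
    (A := fun p => |v p - c|) (B := fun p => |v p - c| * (v p + c))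
    (by fun_prop) (by fun_prop) (fun p => (hb _ (hvM p)).1) (fun p => (hb _ (hvM p)).2) t2 t4 t6
  have L2 : Tendsto (fun n => ∫ x, φn n (0, x) * |v₀ x - c|) atTop
      (𝓝 (∫ x, φ (0, x) * |v₀ x - c|)) := by
    refine tendsto_integral_of_dominated_convergence
      ((Icc (-R) R).indicator fun _ => K * (M + |c|)) ?_ ?_ ?_ ?_
    · intro n
      have m1 : Measurable fun x : ℝ => φn n (0, x) :=
        ((t1 n).smooth.continuous.comp (by fun_prop : Continuous fun x : ℝ => ((0 : ℝ), x))).measurable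
      exact (m1.mul (by fun_prop)).aestronglyMeasurable
    · rw [integrable_indicator_iff measurableSet_Icc]
      exact integrableOn_const (by simp)
    · intro n
      refine Eventually.of_forall fun x => ?_
      by_cases hx : |x| ≤ R
      · rw [indicator_of_mem (show x ∈ Icc (-R) R from abs_le.1 hx), Real.norm_eq_abs, abs_mul, abs_abs]
        have e1 : |v₀ x - c| ≤ M + |c| := (abs_sub _ _).trans (by linarith [hv₀M x])
        exact mul_le_mul (t3 n _) e1 (abs_nonneg _) ((abs_nonneg _).trans (t3 n 0))
      · rw [indicator_of_notMem (fun h : x ∈ Icc (-R) R => hx (abs_le.2 h)), t4 n (0, x)]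
        · simp
        · rw [Prod.norm_def]; simpa using not_le.1 hx
    · exact Eventually.of_forall fun x => (t5 (0, x)).mul_const _
  refine ge_of_tendsto (L1.add L2) (Eventually.of_forall fun n => ?_)
  have := H (φn n) (t1 n)
  unfold kruzhkovIntegral at this
  simpa only [kruzhkovFlux_burgers] using this

theorem IsLipschitzTest.exists_bound {T : ℝ} {φ : ℝ × ℝ → ℝ} (h : IsLipschitzTest T φ) :
    ∃ C, ∀ p, |φ p| ≤ C := by
  obtain ⟨K, hK⟩ := h.lip
  exact h.hasCompactSupport.exists_bound_of_continuous hK.continuous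

/-- Used for cut-off factors, which need neither compact support nor smoothness: the bump b((c -
w)/ε) and the layer along the shock. -/
theorem IsLipschitzTest.mul {T : ℝ} {φ θ : ℝ × ℝ → ℝ} (h : IsLipschitzTest T φ)
    (hθ : ∃ K, LipschitzWith K θ) {C : ℝ} (hC : ∀ p, |θ p| ≤ C) (h0 : ∀ p, 0 ≤ θ p) :
    IsLipschitzTest T (fun p => φ p * θ p) := by
  obtain ⟨K, hK⟩ := h.lip
  obtain ⟨L, hL⟩ := hθ
  obtain ⟨D, hD⟩ := h.exists_bound
  obtain ⟨R, T', hT', hs⟩ := h.support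
  have hD0 : 0 ≤ D := (abs_nonneg _).trans (hD 0)
  have hC0 : 0 ≤ C := (abs_nonneg _).trans (hC 0)
  refine ⟨⟨⟨D * L + C * K, by positivity⟩, LipschitzWith.of_dist_le_mul fun p q => ?_⟩,
    ⟨R, T', hT', fun p hp => hs p (left_ne_zero_of_mul hp)⟩,
    fun p => mul_nonneg (h.nonneg p) (h0 p)⟩
  have e1 := hK.dist_le_mul p q
  have e2 := hL.dist_le_mul p q
  rw [Real.dist_eq] at *
  have : φ p * θ p - φ q * θ q = φ p * (θ p - θ q) + θ q * (φ p - φ q) := by ring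
  rw [this]
  refine (abs_add_le _ _).trans ?_
  rw [abs_mul, abs_mul]
  have e3 : |φ p| * |θ p - θ q| ≤ D * (L * dist p q) := mul_le_mul (hD p) e2 (abs_nonneg _) hD0
  have e4 : |θ q| * |φ p - φ q| ≤ C * (K * dist p q) := mul_le_mul (hC q) e1 (abs_nonneg _) hC0
  change _ ≤ (D * L + C * K) * dist p q
  linarith

theorem IsLipschitzTest.ae_differentiableAt {T : ℝ} {φ : ℝ × ℝ → ℝ} (h : IsLipschitzTest T φ) :
    ∀ᵐ p, DifferentiableAt ℝ φ p := by
  obtain ⟨K, hK⟩ := h.lip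
  exact hK.ae_differentiableAt

theorem abs_fderiv_apply_le_of_lipschitz {K : NNReal} {φ : ℝ × ℝ → ℝ} (h : LipschitzWith K φ)
    (p : ℝ × ℝ) : |fderiv ℝ φ p (1, 0)| ≤ K ∧ |fderiv ℝ φ p (0, 1)| ≤ K := by
  have hn := norm_fderiv_le_of_lipschitz ℝ h (x₀ := p)
  constructor
  · simpa using (fderiv ℝ φ p).le_of_opNorm_le hn (1, 0)
  · simpa using (fderiv ℝ φ p).le_of_opNorm_le hn (0, 1)

/-! ### Averaging over the Kruzhkov constant with an even bump -/

/-- An even `C¹` bump with integral one. -/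
theorem exists_even_bump : ∃ (b : ℝ → ℝ) (C : ℝ), ContDiff ℝ 1 b ∧ (∀ s, 0 ≤ b s) ∧
    (∫ s in (-1 : ℝ)..1, b s) = 1 ∧ (∀ s, b (-s) = b s) ∧ (∀ s, 1 ≤ |s| → b s = 0) ∧
    (∀ s, 1 ≤ |s| → deriv b s = 0) ∧ (∀ s, |b s| ≤ C) ∧ (∀ s, |deriv b s| ≤ C) := by
  let f : ContDiffBump (0 : ℝ) := ⟨1 / 2, 1, by norm_num, by norm_num⟩
  have hcd : ContDiff ℝ 1 (f.normed volume) := f.contDiff_normed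
  have hsupp : Function.support (f.normed volume) = Metric.ball (0 : ℝ) 1 := f.support_normed_eq
  have hcs : HasCompactSupport (f.normed volume) := f.hasCompactSupport_normed
  obtain ⟨C₁, h₁⟩ := hcs.exists_bound_of_continuous hcd.continuous
  obtain ⟨C₂, h₂⟩ := hcs.deriv.exists_bound_of_continuous (hcd.continuous_deriv le_rfl)
  have hz : ∀ s : ℝ, 1 ≤ |s| → f.normed volume s = 0 := by
    intro s hs
    by_contra hne
    have : s ∈ Metric.ball (0 : ℝ) 1 := hsupp ▸ hne
    rw [Metric.mem_ball, dist_zero_right, Real.norm_eq_abs] at this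
    linarith
  refine ⟨f.normed volume, max C₁ C₂, hcd, f.nonneg_normed, ?_, f.normed_neg, hz, ?_,
    fun s => (h₁ s).trans (le_max_left _ _), fun s => (h₂ s).trans (le_max_right _ _)⟩
  · rw [intervalIntegral.integral_eq_integral_of_support_subset, f.integral_normed]
    rw [hsupp]
    intro s hs
    rw [Metric.mem_ball, dist_zero_right, Real.norm_eq_abs, abs_lt] at hs
    exact ⟨hs.1, hs.2.le⟩
  · intro s hs
    have : IsLocalMin (f.normed volume) s :=
      Eventually.of_forall fun t => by rw [hz s hs]; exact f.nonneg_normed t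
    exact this.deriv_eq_zero

theorem deriv_neg_of_even {b : ℝ → ℝ} (h : ∀ s, b (-s) = b s) (s : ℝ) :
    deriv b (-s) = - deriv b s := by
  have : (fun x => b (-x)) = b := funext h
  have h2 := deriv_comp_neg b s
  rw [this] at h2
  linarith

theorem intervalIntegral_eq_zero_of_odd {f : ℝ → ℝ} (h : ∀ s ∈ Icc (-1 : ℝ) 1, f (-s) = -f s) :
    ∫ s in (-1 : ℝ)..1, f s = 0 := by
  have h1 : ∫ s in (-1 : ℝ)..1, f (-s) = ∫ s in (-1 : ℝ)..1, f s := by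
    rw [intervalIntegral.integral_comp_neg]; simp
  have h2 : ∫ s in (-1 : ℝ)..1, f (-s) = ∫ s in (-1 : ℝ)..1, -f s := by
    refine intervalIntegral.integral_congr fun s hs => ?_
    rw [uIcc_of_le (by norm_num)] at hs
    exact h s hs
  rw [intervalIntegral.integral_neg] at h2
  linarith

/-- Smearing the moment `|d - s| (d + s)` against the derivative of an even bump of width `ε`
gives only `O(ε²)`. -/
theorem abs_integral_deriv_bump_le {b : ℝ → ℝ} {C : ℝ} (hb : ∀ s, b (-s) = b s)
    (hC : ∀ s, |deriv b s| ≤ C) {ε : ℝ} (hε : 0 < ε) (d : ℝ) :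
    |∫ s in (-1 : ℝ)..1, deriv b s * (|d - ε * s| * (d + ε * s))| ≤ 8 * C * ε ^ 2 := by
  have hC0 : 0 ≤ C := (abs_nonneg _).trans (hC 0)
  by_cases hd : |d| < ε
  -- For |d| < ε size is enough, as both factors are at most 2ε. For |d| ≥ ε neither d - εs nor d +
  -- εs changes sign, the moment is ±(d² - ε²s²), and this even function integrates to zero against
  -- the odd derivative of the bump.
  · have := intervalIntegral.norm_integral_le_of_norm_le_const (a := -1) (b := (1 : ℝ))
      (f := fun s => deriv b s * (|d - ε * s| * (d + ε * s))) (C := C * (4 * ε ^ 2)) ?_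
    · rw [Real.norm_eq_abs] at this
      refine this.trans (le_of_eq ?_)
      rw [show |(1 : ℝ) - -1| = 2 by norm_num]; ring
    · intro s hs
      rw [uIoc_of_le (by norm_num)] at hs
      have hs1 : |ε * s| ≤ ε := by
        rw [abs_mul, abs_of_pos hε]
        exact mul_le_of_le_one_right hε.le (abs_le.2 ⟨hs.1.le, hs.2⟩)
      have e1 : |d - ε * s| ≤ 2 * ε := (abs_sub _ _).trans (by linarith)
      have e2 : |d + ε * s| ≤ 2 * ε := (abs_add_le _ _).trans (by linarith)
      rw [Real.norm_eq_abs, abs_mul, abs_mul, abs_abs]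
      refine mul_le_mul (hC s) ?_ (by positivity) hC0
      calc |d - ε * s| * |d + ε * s| ≤ (2 * ε) * (2 * ε) :=
            mul_le_mul e1 e2 (abs_nonneg _) (by positivity)
        _ = 4 * ε ^ 2 := by ring
  · have hz : ∫ s in (-1 : ℝ)..1, deriv b s * (|d - ε * s| * (d + ε * s)) = 0 := by
      refine intervalIntegral_eq_zero_of_odd fun s hs => ?_
      have hs1 : |ε * s| ≤ |d| := by
        rw [abs_mul, abs_of_pos hε]
        exact (mul_le_of_le_one_right hε.le (abs_le.2 ⟨hs.1, hs.2⟩)).trans (not_lt.1 hd)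
      rw [deriv_neg_of_even hb]
      have hs2 := abs_le.1 hs1
      rcases le_total 0 d with h0 | h0
      · rw [abs_of_nonneg h0] at hs2
        rw [abs_of_nonneg (by linarith : 0 ≤ d - ε * s),
          abs_of_nonneg (by linarith : 0 ≤ d - ε * -s)]
        ring
      · rw [abs_of_nonpos h0] at hs2
        rw [abs_of_nonpos (by linarith : d - ε * s ≤ 0),
          abs_of_nonpos (by linarith : d - ε * -s ≤ 0)]
        ring
    rw [hz, abs_zero]; positivity

/-- Averages over a bump of width `ε` differ little from the value at the centre. -/
theorem abs_integral_bump_sub_le {b X : ℝ → ℝ} {C L : ℝ} (hbc : Continuous b) (hX : Continuous X)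
    (hb1 : (∫ s in (-1 : ℝ)..1, b s) = 1) (hC : ∀ s, |b s| ≤ C)
    (hL : ∀ s, |s| ≤ 1 → |X s - X 0| ≤ L) :
    |(∫ s in (-1 : ℝ)..1, b s * X s) - X 0| ≤ 2 * (C * L) := by
  have hC0 : 0 ≤ C := (abs_nonneg _).trans (hC 0)
  have e : (∫ s in (-1 : ℝ)..1, b s * X s) - X 0 = ∫ s in (-1 : ℝ)..1, b s * (X s - X 0) := by
    have i1 : IntervalIntegrable (fun s => b s * X s) volume (-1) 1 :=
      (hbc.mul hX).intervalIntegrable _ _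
    have i2 : IntervalIntegrable (fun s => b s * X 0) volume (-1) 1 :=
      (hbc.mul continuous_const).intervalIntegrable _ _
    simp only [mul_sub]
    rw [intervalIntegral.integral_sub i1 i2, intervalIntegral.integral_mul_const, hb1, one_mul]
  rw [e]
  have := intervalIntegral.norm_integral_le_of_norm_le_const (a := -1) (b := (1 : ℝ))
    (f := fun s => b s * (X s - X 0)) (C := C * L) ?_
  · rw [Real.norm_eq_abs] at this
    refine this.trans (le_of_eq ?_)
    rw [show |(1 : ℝ) - -1| = 2 by norm_num]; ring
  · intro s hs
    rw [uIoc_of_le (by norm_num)] at hs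
    rw [Real.norm_eq_abs, abs_mul]
    exact mul_le_mul (hC s) (hL s (abs_le.2 ⟨hs.1.le, hs.2⟩)) (abs_nonneg _) hC0

/-- Fubini, followed by the substitution `c = w p + ε s`. -/
theorem integral_swap_rescale {α : Type*} [MeasurableSpace α] {μ : Measure α} [SFinite μ]
    {G : ℝ → α → ℝ} (hG : Measurable (Function.uncurry G)) {A : Set α} (hA : MeasurableSet A)
    (hμA : μ A < ⊤) {C N : ℝ} (hGC : ∀ c p, |G c p| ≤ C)
    (hGA : ∀ c p, p ∉ A → G c p = 0) (hGN : ∀ c p, N < |c| → G c p = 0)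
    (w : α → ℝ) {ε : ℝ} (hε : 0 < ε) :
    Integrable (fun c => ∫ p, G c p ∂μ) ∧
    Integrable (fun p => ∫ s : ℝ, G (w p + ε * s) p) μ ∧
    ∫ c, (∫ p, G c p ∂μ) = ε * ∫ p, (∫ s : ℝ, G (w p + ε * s) p) ∂μ := by
  have hint : Integrable (Function.uncurry G) (volume.prod μ) := by
    have hi : Integrable ((Icc (-N) N ×ˢ A).indicator fun _ => C) (volume.prod μ) := by
      rw [integrable_indicator_iff (measurableSet_Icc.prod hA)]
      refine integrableOn_const ?_ (by simp)
      rw [Measure.prod_prod]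
      exact (ENNReal.mul_lt_top (by simp) hμA).ne
    refine hi.mono' hG.aestronglyMeasurable (Eventually.of_forall fun ⟨c, p⟩ => ?_)
    by_cases h : (c, p) ∈ Icc (-N) N ×ˢ A
    · rw [indicator_of_mem h]; exact hGC c p
    · rw [indicator_of_notMem h]
      have : G c p = 0 := by
        by_cases hp : p ∈ A
        · refine hGN c p (not_le.1 fun hc => h ⟨abs_le.1 hc, hp⟩)
        · exact hGA c p hp
      simp [this]
  have hsub : ∀ p, ∫ c, G c p = ε * ∫ s : ℝ, G (w p + ε * s) p := by
    intro p
    have h1 := Measure.integral_comp_mul_left (fun c => G (w p + c) p) ε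
    rw [h1, integral_add_left_eq_self (fun c => G c p) (w p), smul_eq_mul, abs_of_pos
      (inv_pos.2 hε), ← mul_assoc, mul_inv_cancel₀ hε.ne', one_mul]
  refine ⟨hint.integral_prod_left, ?_, ?_⟩
  · have h2 := hint.integral_prod_right
    have h3 : (fun p => ∫ s : ℝ, G (w p + ε * s) p) = fun p => ε⁻¹ * ∫ c, G c p := by
      funext p
      rw [hsub, ← mul_assoc, inv_mul_cancel₀ hε.ne', one_mul]
    rw [h3]
    exact h2.const_mul _
  · rw [integral_integral_swap hint, ← integral_const_mul]
    exact integral_congr_ae (Eventually.of_forall hsub)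

/-! ### Comparison of a Kruzhkov solution with a Lipschitz solution -/

/-- Bounded measurable `v` satisfying the Kruzhkov inequalities of Burgers' equation with datum `v₀`
for all Lipschitz test functions. -/
structure IsKruzhkov (T M : ℝ) (v : ℝ × ℝ → ℝ) (v₀ : ℝ → ℝ) : Prop where
  meas : Measurable v
  bound : ∀ p, |v p| ≤ M
  meas₀ : Measurable v₀
  bound₀ : ∀ x, |v₀ x| ≤ M
  ineq : ∀ c φ, IsLipschitzTest T φ →
    0 ≤ (∫ p in Ioo 0 T ×ˢ univ, (fderiv ℝ φ p (1, 0) * |v p - c| +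
      fderiv ℝ φ p (0, 1) * (|v p - c| * (v p + c)))) + ∫ x, φ (0, x) * |v₀ x - c|

/-- Bounded Lipschitz functions that satisfy Burgers' equation wherever they are differentiable. -/
structure IsLipschitzSolution (T M : ℝ) (w : ℝ × ℝ → ℝ) : Prop where
  lip : ∃ K, LipschitzWith K w
  bound : ∀ p, |w p| ≤ M
  pde : ∀ p ∈ Ioo 0 T ×ˢ univ, DifferentiableAt ℝ w p →
    fderiv ℝ w p (1, 0) + 2 * w p * fderiv ℝ w p (0, 1) = 0

theorem fderiv_mul_bump {ψ w : ℝ × ℝ → ℝ} {b : ℝ → ℝ} (hb : ContDiff ℝ 1 b) (c ε : ℝ) {p : ℝ × ℝ}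
    (hψ : DifferentiableAt ℝ ψ p) (hw : DifferentiableAt ℝ w p) (e : ℝ × ℝ) :
    fderiv ℝ (fun q => ψ q * b ((c - w q) / ε)) p e =
      fderiv ℝ ψ p e * b ((c - w p) / ε)
        - ψ p * (deriv b ((c - w p) / ε) / ε * fderiv ℝ w p e) := by
  have h1 : HasDerivAt b (deriv b ((c - w p) / ε)) ((c - w p) / ε) :=
    ((hb.differentiable one_ne_zero) _).hasDerivAt
  have h2 : HasFDerivAt (fun q => (c - w q) / ε) (ε⁻¹ • (-fderiv ℝ w p)) p := by
    have := (hw.hasFDerivAt.const_sub c).const_mul ε⁻¹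
    simpa only [div_eq_inv_mul] using this
  have h3 := hψ.hasFDerivAt.mul (h1.comp_hasFDerivAt p h2)
  have h4 : (fun q => ψ q * b ((c - w q) / ε)) = ψ * (b ∘ fun q => (c - w q) / ε) := rfl
  rw [h4, h3.fderiv]
  simp only [add_apply, smul_apply,
    neg_apply, smul_eq_mul, Function.comp]
  ring


/-- The pointwise estimate behind the comparison with a Lipschitz solution. -/
theorem integral_bump_entropy_le {b : ℝ → ℝ} {B : ℝ} (hb : ContDiff ℝ 1 b)
    (hb1 : (∫ s in (-1 : ℝ)..1, b s) = 1) (hbe : ∀ s, b (-s) = b s) (hB : ∀ s, |b s| ≤ B)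
    (hB' : ∀ s, |deriv b s| ≤ B) {pt px z wt wx v w ε P D L M : ℝ} (hε : 0 < ε) (hε1 : ε ≤ 1)
    (hpt : |pt| ≤ P) (hpx : |px| ≤ P) (hz : |z| ≤ D) (hwx : |wx| ≤ L) (hv : |v| ≤ M) (hw : |w| ≤ M)
    (hpde : wt + 2 * w * wx = 0) :
    ∫ s in (-1 : ℝ)..1, ((pt * b s - z * (deriv b s / ε * wt)) * |v - (w + ε * s)| +
        (px * b s - z * (deriv b s / ε * wx)) * (|v - (w + ε * s)| * (v + (w + ε * s))))
      ≤ pt * |v - w| + px * (|v - w| * (v + w))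
        + (P * (2 * B) + P * (2 * (B * (4 * M + 1))) + D * L * (8 * B)) * ε := by
  have hP0 : 0 ≤ P := (abs_nonneg _).trans hpt
  have hD0 : 0 ≤ D := (abs_nonneg _).trans hz
  have hL0 : 0 ≤ L := (abs_nonneg _).trans hwx
  have hM0 : 0 ≤ M := (abs_nonneg _).trans hv
  have hB0 : 0 ≤ B := (abs_nonneg _).trans (hB 0)
  have hbc := hb.continuous
  have hbc' : Continuous (deriv b) := hb.continuous_deriv le_rfl
  set X₁ : ℝ → ℝ := fun s => |v - (w + ε * s)| with hX₁
  set X₂ : ℝ → ℝ := fun s => |v - (w + ε * s)| * (v + (w + ε * s)) with hX₂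
  have c1 : Continuous X₁ := by fun_prop
  have c2 : Continuous X₂ := by fun_prop
  have hd : ∀ s, |s| ≤ 1 → |X₁ s - X₁ 0| ≤ ε := by
    intro s hs
    have h1 : |X₁ s - X₁ 0| ≤ |(v - (w + ε * s)) - (v - (w + ε * 0))| := abs_abs_sub_abs_le _ _
    refine h1.trans ?_
    rw [show (v - (w + ε * s)) - (v - (w + ε * 0)) = -(ε * s) by ring, abs_neg, abs_mul,
      abs_of_pos hε]
    exact mul_le_of_le_one_right hε.le hs
  have hd2 : ∀ s, |s| ≤ 1 → |X₂ s - X₂ 0| ≤ (4 * M + 1) * ε := by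
    intro s hs
    have hes : |ε * s| ≤ ε := by
      rw [abs_mul, abs_of_pos hε]; exact mul_le_of_le_one_right hε.le hs
    have h1 : X₂ s - X₂ 0 = (X₁ s - X₁ 0) * (v + (w + ε * s)) + X₁ 0 * (ε * s) := by
      simp only [hX₁, hX₂]; ring
    rw [h1]
    refine (abs_add_le _ _).trans ?_
    rw [abs_mul, abs_mul]
    have h2 : |v + (w + ε * s)| ≤ 2 * M + 1 := by
      refine (abs_add_le _ _).trans ?_
      have := abs_add_le w (ε * s)
      linarith
    have h3 : |X₁ 0| ≤ 2 * M := by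
      simp only [hX₁, abs_abs]
      refine (abs_sub _ _).trans ?_
      simp only [mul_zero, add_zero]; linarith
    have h4 := mul_le_mul (hd s hs) h2 (abs_nonneg _) hε.le
    have h5 := mul_le_mul h3 hes (abs_nonneg _) (by positivity)
    linarith
  have k1 := abs_integral_bump_sub_le hbc c1 hb1 hB hd
  have k2 := abs_integral_bump_sub_le hbc c2 hb1 hB hd2
  have k3 := abs_integral_deriv_bump_le hbe hB' hε (v - w)
  -- With wt = -2w·wx, the terms containing b' combine to wx|v - c|(v + c - 2w). At c = w + εs this
  -- is wx times the moment |d - εs|(d + εs) with d = v - w.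
  have e : ∀ s, (pt * b s - z * (deriv b s / ε * wt)) * |v - (w + ε * s)| +
        (px * b s - z * (deriv b s / ε * wx)) * (|v - (w + ε * s)| * (v + (w + ε * s)))
      = pt * (b s * X₁ s) + px * (b s * X₂ s)
        - z * wx / ε * (deriv b s * (|(v - w) - ε * s| * ((v - w) + ε * s))) := by
    intro s
    have : wt = -(2 * w * wx) := by linarith
    simp only [hX₁, hX₂, this, show v - (w + ε * s) = (v - w) - ε * s by ring]
    ring
  have i1 : IntervalIntegrable (fun s => pt * (b s * X₁ s)) volume (-1) 1 :=
    (by fun_prop : Continuous fun s => pt * (b s * X₁ s)).intervalIntegrable _ _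
  have i2 : IntervalIntegrable (fun s => px * (b s * X₂ s)) volume (-1) 1 :=
    (by fun_prop : Continuous fun s => px * (b s * X₂ s)).intervalIntegrable _ _
  have i3 : IntervalIntegrable (fun s => z * wx / ε *
      (deriv b s * (|(v - w) - ε * s| * ((v - w) + ε * s)))) volume (-1) 1 :=
    (by fun_prop : Continuous fun s => z * wx / ε *
      (deriv b s * (|(v - w) - ε * s| * ((v - w) + ε * s)))).intervalIntegrable _ _
  simp only [e]
  rw [intervalIntegral.integral_sub (i1.add i2) i3, intervalIntegral.integral_add i1 i2,
    intervalIntegral.integral_const_mul, intervalIntegral.integral_const_mul,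
    intervalIntegral.integral_const_mul]
  have x10 : X₁ 0 = |v - w| := by simp [hX₁]
  have x20 : X₂ 0 = |v - w| * (v + w) := by simp [hX₂]
  rw [x10] at k1
  rw [x20] at k2
  set I₁ := ∫ s in (-1 : ℝ)..1, b s * X₁ s
  set I₂ := ∫ s in (-1 : ℝ)..1, b s * X₂ s
  set I₃ := ∫ s in (-1 : ℝ)..1, deriv b s * (|(v - w) - ε * s| * ((v - w) + ε * s))
  have m1 : pt * (I₁ - |v - w|) ≤ P * (2 * (B * ε)) := by
    refine (le_abs_self _).trans ?_
    rw [abs_mul]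
    exact mul_le_mul hpt k1 (abs_nonneg _) hP0
  have m2 : px * (I₂ - |v - w| * (v + w)) ≤ P * (2 * (B * ((4 * M + 1) * ε))) := by
    refine (le_abs_self _).trans ?_
    rw [abs_mul]
    exact mul_le_mul hpx k2 (abs_nonneg _) hP0
  -- The O(ε²) bound on the moment beats the factor 1/ε produced by differentiating the bump.
  have m3 : -(z * wx / ε * I₃) ≤ D * L * (8 * B) * ε := by
    refine (neg_le_abs _).trans ?_
    rw [abs_mul, abs_div, abs_of_pos hε, abs_mul]
    have : |z| * |wx| / ε * |I₃| ≤ D * L / ε * (8 * B * ε ^ 2) := by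
      refine mul_le_mul ?_ k3 (abs_nonneg _) (by positivity)
      exact div_le_div_of_nonneg_right (mul_le_mul hz hwx (abs_nonneg _) hD0) hε.le
    refine this.trans (le_of_eq ?_)
    field_simp
  linarith

theorem integrable_entropy {M K R : ℝ} {v w ψ : ℝ × ℝ → ℝ} (hv : Measurable v)
    (hw : Measurable w) (hvM : ∀ p, |v p| ≤ M) (hwM : ∀ p, |w p| ≤ M)
    (h1 : ∀ p, ‖fderiv ℝ ψ p‖ ≤ K) (h2 : ∀ p, R < ‖p‖ → ψ p = 0) (s : Set (ℝ × ℝ)) :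
    IntegrableOn (fun p => fderiv ℝ ψ p (1, 0) * |v p - w p| +
      fderiv ℝ ψ p (0, 1) * (|v p - w p| * (v p + w p))) s := by
  refine (integrable_indicator_closedBall R (K * (2 * M) + K * ((2 * M) * (2 * M))) s).mono' ?_ ?_
  · have m1 := measurable_fderiv_apply_const ℝ ψ (1, 0)
    have m2 := measurable_fderiv_apply_const ℝ ψ (0, 1)
    exact Measurable.aestronglyMeasurable (by fun_prop)
  · refine Eventually.of_forall fun p => ?_
    by_cases hp : ‖p‖ ≤ R
    · rw [indicator_of_mem (by simpa using hp)]
      have hK : 0 ≤ K := (norm_nonneg _).trans (h1 p)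
      have hM0 : 0 ≤ M := (abs_nonneg _).trans (hvM p)
      have e1 : |fderiv ℝ ψ p (1, 0)| ≤ K := by
        simpa using (fderiv ℝ ψ p).le_of_opNorm_le (h1 p) (1, 0)
      have e2 : |fderiv ℝ ψ p (0, 1)| ≤ K := by
        simpa using (fderiv ℝ ψ p).le_of_opNorm_le (h1 p) (0, 1)
      have e3 : |v p - w p| ≤ 2 * M := (abs_sub _ _).trans (by linarith [hvM p, hwM p])
      have e4 : |v p + w p| ≤ 2 * M := (abs_add_le _ _).trans (by linarith [hvM p, hwM p])
      refine (abs_add_le _ _).trans ?_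
      rw [abs_mul, abs_mul, abs_mul, abs_abs]
      exact add_le_add (mul_le_mul e1 e3 (abs_nonneg _) hK)
        (mul_le_mul e2 (mul_le_mul e3 e4 (abs_nonneg _) (by positivity)) (by positivity) hK)
    · rw [fderiv_eq_zero_of_norm_gt h2 (not_le.1 hp), indicator_of_notMem (by simpa using hp)]
      simp

theorem integrable_initial {M D R : ℝ} {z g : ℝ → ℝ} (hz : Measurable z) (hg : Measurable g)
    (hgM : ∀ x, |g x| ≤ M) (hzD : ∀ x, |z x| ≤ D) (hzR : ∀ x, R < |x| → z x = 0) :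
    Integrable (fun x => z x * g x) := by
  have hi : Integrable ((Icc (-R) R).indicator fun _ => D * M) := by
    rw [integrable_indicator_iff measurableSet_Icc]
    exact integrableOn_const (by simp)
  refine hi.mono' (hz.mul hg).aestronglyMeasurable (Eventually.of_forall fun x => ?_)
  by_cases hx : |x| ≤ R
  · rw [indicator_of_mem (show x ∈ Icc (-R) R from abs_le.1 hx), Real.norm_eq_abs, abs_mul]
    exact mul_le_mul (hzD x) (hgM x) (abs_nonneg _) ((abs_nonneg _).trans (hzD x))
  · rw [indicator_of_notMem (fun h : x ∈ Icc (-R) R => hx (abs_le.2 h)), hzR x (not_le.1 hx)]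
    simp

/-- Comparison of a Kruzhkov solution with a Lipschitz solution. -/
theorem IsKruzhkov.compare {T M : ℝ} {v w ψ : ℝ × ℝ → ℝ} {v₀ : ℝ → ℝ} (hv : IsKruzhkov T M v v₀)
    (hw : IsLipschitzSolution T M w) (hψ : IsLipschitzTest T ψ) :
    0 ≤ (∫ p in Ioo 0 T ×ˢ univ, (fderiv ℝ ψ p (1, 0) * |v p - w p| +
      fderiv ℝ ψ p (0, 1) * (|v p - w p| * (v p + w p))))
      + ∫ x, ψ (0, x) * |v₀ x - w (0, x)| := by
  obtain ⟨K, hK⟩ := hψ.lip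
  obtain ⟨L, hL⟩ := hw.lip
  obtain ⟨D, hD⟩ := hψ.exists_bound
  obtain ⟨R, T', hT', hs⟩ := hψ.support
  obtain ⟨b, B, hb, hb0, hb1, hbe, hbz, hbz', hB, hB'⟩ := exists_even_bump
  have hψ0 : ∀ p, R < ‖p‖ → ψ p = 0 := fun p hp => by
    by_contra hne
    exact absurd (hs p hne).1 (not_le.2 hp)
  have hD0 : 0 ≤ D := (abs_nonneg _).trans (hD 0)
  have hM0 : 0 ≤ M := (abs_nonneg _).trans (hv.bound 0)
  have hB0 : 0 ≤ B := (abs_nonneg _).trans (hB 0)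
  have hwm : Measurable w := hL.continuous.measurable
  have hψm : Measurable ψ := hK.continuous.measurable
  have hvm := hv.meas
  have hv₀m := hv.meas₀
  have hbm : Measurable b := hb.continuous.measurable
  have hbm' : Measurable (deriv b) := measurable_deriv b
  have hsupp : ∀ f : ℝ → ℝ, (∀ s, 1 ≤ |s| → f s = 0) → ∫ s, f s = ∫ s in (-1 : ℝ)..1, f s := by
    intro f hf
    rw [intervalIntegral.integral_eq_integral_of_support_subset]
    intro s hs
    have : |s| < 1 := not_le.1 fun h => hs (hf s h)
    exact ⟨(abs_lt.1 this).1, (abs_lt.1 this).2.le⟩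
  -- the measurable versions of the partial derivatives
  have mt := measurable_fderiv_apply_const ℝ ψ (1, 0)
  have mx := measurable_fderiv_apply_const ℝ ψ (0, 1)
  have mwt := measurable_fderiv_apply_const ℝ w (1, 0)
  have mwx := measurable_fderiv_apply_const ℝ w (0, 1)
  set S : Set (ℝ × ℝ) := Ioo 0 T ×ˢ univ with hS
  have hSm : MeasurableSet S := measurableSet_Ioo.prod MeasurableSet.univ
  set E : ℝ × ℝ → ℝ := fun p => fderiv ℝ ψ p (1, 0) * |v p - w p| +
      fderiv ℝ ψ p (0, 1) * (|v p - w p| * (v p + w p)) with hE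
  set E₀ : ℝ → ℝ := fun x => ψ (0, x) * |v₀ x - w (0, x)| with hE₀
  set C₁ : ℝ := K * (2 * B) + K * (2 * (B * (4 * M + 1))) + D * L * (8 * B) with hC₁
  set C₂ : ℝ := D * (2 * B) with hC₂
  have hEi : IntegrableOn E S := integrable_entropy hvm hwm hv.bound hw.bound
    (fun p => norm_fderiv_le_of_lipschitz ℝ hK) hψ0 S
  have hψ0x : ∀ x : ℝ, R < |x| → ψ (0, x) = 0 := fun x hx =>
    hψ0 _ (by rw [Prod.norm_def]; simpa using hx)
  have hE₀i : Integrable E₀ := by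
    refine integrable_initial (M := 2 * M) (by fun_prop) (by fun_prop) (fun x => ?_)
      (fun x => hD _) hψ0x
    rw [abs_abs]
    exact (abs_sub _ _).trans (by linarith [hv.bound₀ x, hw.bound (0, x)])
  have hJi : Integrable ((Metric.closedBall (0 : ℝ × ℝ) R).indicator fun _ => C₁)
    (volume.restrict S) := integrable_indicator_closedBall R C₁ S
  have hJ₀i : Integrable ((Icc (-R) R).indicator fun _ => C₂) := by
    rw [integrable_indicator_iff measurableSet_Icc]
    exact integrableOn_const (by simp)
  set J : ℝ := ∫ p in S, (Metric.closedBall (0 : ℝ × ℝ) R).indicator (fun _ => C₁) p with hJ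
  set J₀ : ℝ := ∫ x, (Icc (-R) R).indicator (fun _ => C₂) x with hJ₀
  -- the estimate for a fixed width
  have main : ∀ ε, 0 < ε → ε ≤ 1 → 0 ≤ (∫ p in S, E p) + (∫ x, E₀ x) + (J + J₀) * ε := by
    intro ε hε hε1
    -- Integrand of the inequality for the constant c and the test function ψ·b((c - w)/ε), with the
    -- product rule written out; the two agree at points where ψ and w are differentiable.
    set G : ℝ → ℝ × ℝ → ℝ := fun c p =>
      (fderiv ℝ ψ p (1, 0) * b ((c - w p) / ε)
        - ψ p * (deriv b ((c - w p) / ε) / ε * fderiv ℝ w p (1, 0))) * |v p - c|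
      + (fderiv ℝ ψ p (0, 1) * b ((c - w p) / ε)
        - ψ p * (deriv b ((c - w p) / ε) / ε * fderiv ℝ w p (0, 1))) * (|v p - c| * (v p + c))
      with hG
    set H : ℝ → ℝ → ℝ := fun c x => ψ (0, x) * b ((c - w (0, x)) / ε) * |v₀ x - c| with hH
    have hGm : Measurable (Function.uncurry G) := by
      simp only [hG, Function.uncurry_def]
      fun_prop
    have hHm : Measurable (Function.uncurry H) := by
      simp only [hH, Function.uncurry_def]
      fun_prop
    have hfar : ∀ c p, M + 1 < |c| → 1 ≤ |(c - w p) / ε| := by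
      intro c p hc
      rw [abs_div, abs_of_pos hε, le_div_iff₀ hε]
      have := abs_sub_abs_le_abs_sub c (w p)
      linarith [hw.bound p]
    have hGN : ∀ c p, M + 1 < |c| → G c p = 0 := by
      intro c p hc
      simp [hG, hbz _ (hfar c p hc), hbz' _ (hfar c p hc)]
    have hHN : ∀ c x, M + 1 < |c| → H c x = 0 := by
      intro c x hc
      simp [hH, hbz _ (hfar c (0, x) hc)]
    have hGA : ∀ c p, p ∉ Metric.closedBall (0 : ℝ × ℝ) R → G c p = 0 := by
      intro c p hp
      have hp' : R < ‖p‖ := by simpa using hp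
      simp [hG, hψ0 p hp', fderiv_eq_zero_of_norm_gt hψ0 hp']
    have hHA : ∀ c x, x ∉ Icc (-R) R → H c x = 0 := by
      intro c x hx
      simp [hH, hψ0x x (not_le.1 fun h => hx (abs_le.1 h))]
    have hvc : ∀ (a c : ℝ), |a| ≤ M → |c| ≤ M + 1 → |a - c| ≤ 2 * M + 1 ∧ |a + c| ≤ 2 * M + 1 :=
      fun a c ha hc => ⟨(abs_sub _ _).trans (by linarith), (abs_add_le _ _).trans (by linarith)⟩
    have hGC : ∀ c p, |G c p| ≤ (K * B + D * (B / ε * L)) * (2 * M + 1)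
        + (K * B + D * (B / ε * L)) * ((2 * M + 1) * (2 * M + 1)) := by
      intro c p
      by_cases hc : M + 1 < |c|
      · rw [hGN c p hc, abs_zero]; positivity
      obtain ⟨e1, e2⟩ := hvc (v p) c (hv.bound p) (not_lt.1 hc)
      have hcoef : ∀ x y : ℝ, |x| ≤ K → |y| ≤ L → |x * b ((c - w p) / ε)
          - ψ p * (deriv b ((c - w p) / ε) / ε * y)| ≤ K * B + D * (B / ε * L) := by
        intro x y hx hy
        refine (abs_sub _ _).trans ?_
        rw [abs_mul, abs_mul, abs_mul, abs_div, abs_of_pos hε]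
        have hL0 : (0 : ℝ) ≤ L := L.coe_nonneg
        gcongr
        · exact hB _
        · exact hD p
        · exact hB' _
      have t := abs_fderiv_apply_le_of_lipschitz hK p
      have t' := abs_fderiv_apply_le_of_lipschitz hL p
      refine (abs_add_le _ _).trans ?_
      rw [abs_mul, abs_mul, abs_mul (|v p - c|), abs_abs]
      have hL0 : (0 : ℝ) ≤ L := L.coe_nonneg
      exact add_le_add (mul_le_mul (hcoef _ _ t.1 t'.1) e1 (abs_nonneg _) (by positivity))
        (mul_le_mul (hcoef _ _ t.2 t'.2) (mul_le_mul e1 e2 (abs_nonneg _) (by positivity))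
          (by positivity) (by positivity))
    have hHC : ∀ c x, |H c x| ≤ D * B * (2 * M + 1) := by
      intro c x
      by_cases hc : M + 1 < |c|
      · rw [hHN c x hc, abs_zero]; positivity
      rw [abs_mul, abs_mul, abs_abs]
      exact mul_le_mul (mul_le_mul (hD _) (hB _) (abs_nonneg _) hD0)
        (hvc _ _ (hv.bound₀ x) (not_lt.1 hc)).1 (abs_nonneg _) (by positivity)
    obtain ⟨gi, gi', ge⟩ := integral_swap_rescale (μ := volume.restrict S) hGm
      (Metric.isClosed_closedBall.measurableSet)
      ((Measure.restrict_apply_le _ _).trans_lt measure_closedBall_lt_top) hGC hGA hGN w hε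
    obtain ⟨hi, hi', he⟩ := integral_swap_rescale (μ := volume) hHm (A := Icc (-R) R)
      measurableSet_Icc (by simp) hHC hHA hHN (fun x => w (0, x)) hε
    have hnn : ∀ c, 0 ≤ (∫ p in S, G c p) + ∫ x, H c x := by
      intro c
      have htest : IsLipschitzTest T (fun p => ψ p * b ((c - w p) / ε)) := by
        refine hψ.mul ?_ (fun p => hB _) (fun p => hb0 _)
        have hbl : LipschitzWith ⟨B, hB0⟩ b :=
          lipschitzWith_of_nnnorm_deriv_le (hb.differentiable one_ne_zero) fun s => hB' s
        have hl : LipschitzWith (‖ε⁻¹‖₊ * L) fun p => (c - w p) / ε := by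
          refine LipschitzWith.of_dist_le_mul fun p q => ?_
          have := hL.dist_le_mul p q
          rw [Real.dist_eq] at *
          rw [show (c - w p) / ε - (c - w q) / ε = ε⁻¹ * -(w p - w q) by field_simp; ring, abs_mul,
            abs_neg]
          change _ ≤ (|ε⁻¹| * L) * _
          rw [mul_assoc]
          exact mul_le_mul_of_nonneg_left this (abs_nonneg _)
        exact ⟨_, hbl.comp hl⟩
      refine (hv.ineq c _ htest).trans (le_of_eq ?_)
      congr 1
      refine integral_congr_ae ?_
      filter_upwards [ae_restrict_of_ae hψ.ae_differentiableAt,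
        ae_restrict_of_ae (hL.ae_differentiableAt (μ := volume))] with p h1 h2
      rw [fderiv_mul_bump hb c ε h1 h2, fderiv_mul_bump hb c ε h1 h2]
    -- After integration over c, the substitution c = w + εs brings out a factor ε in both
    -- integrals, which is divided off.
    have htot : 0 ≤ ∫ c, ((∫ p in S, G c p) + ∫ x, H c x) := integral_nonneg hnn
    rw [integral_add gi hi, ge, he, ← mul_add] at htot
    have htot' := (mul_nonneg_iff_of_pos_left hε).1 htot
    have hsc : ∀ a s : ℝ, (a + ε * s - a) / ε = s := fun a s => by field_simp; ring
    have b1 : ∫ p in S, (∫ s : ℝ, G (w p + ε * s) p) ≤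
        ∫ p in S, (E p + (Metric.closedBall (0 : ℝ × ℝ) R).indicator (fun _ => C₁) p * ε) := by
      refine integral_mono_ae gi' (hEi.add (hJi.mul_const ε)) ?_
      filter_upwards [ae_restrict_of_ae (hL.ae_differentiableAt (μ := volume)),
        ae_restrict_mem hSm] with p h2 hpS
      by_cases hp : p ∈ Metric.closedBall (0 : ℝ × ℝ) R
      · rw [indicator_of_mem hp, hsupp]
        · simp only [hG, hsc]
          exact integral_bump_entropy_le hb hb1 hbe hB hB' hε hε1
            (abs_fderiv_apply_le_of_lipschitz hK p).1 (abs_fderiv_apply_le_of_lipschitz hK p).2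
            (hD p) (abs_fderiv_apply_le_of_lipschitz hL p).2 (hv.bound p) (hw.bound p)
            (hw.pde p hpS h2)
        · intro s hs
          simp only [hG, hsc, hbz s hs, hbz' s hs]
          ring
      · have hp' : R < ‖p‖ := by simpa using hp
        rw [indicator_of_notMem hp]
        simp [hGA _ p hp, hE, fderiv_eq_zero_of_norm_gt hψ0 hp']
    have b2 : ∫ x, (∫ s : ℝ, H (w (0, x) + ε * s) x) ≤
        ∫ x, (E₀ x + (Icc (-R) R).indicator (fun _ => C₂) x * ε) := by
      refine integral_mono_ae hi' (hE₀i.add (hJ₀i.mul_const ε)) (Eventually.of_forall fun x => ?_)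
      by_cases hx : x ∈ Icc (-R) R
      · simp only
        rw [indicator_of_mem hx, hsupp]
        · simp only [hH, hsc, mul_assoc]
          rw [intervalIntegral.integral_const_mul]
          have := abs_integral_bump_sub_le hb.continuous
            (X := fun s => |v₀ x - (w (0, x) + ε * s)|) (by fun_prop) hb1 hB (L := ε) ?_
          · have h3 : ψ (0, x) * ((∫ s in (-1 : ℝ)..1, b s * |v₀ x - (w (0, x) + ε * s)|)
                - |v₀ x - (w (0, x) + ε * 0)|) ≤ D * (2 * (B * ε)) := by
              refine (le_abs_self _).trans ?_
              rw [abs_mul]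
              exact mul_le_mul (hD _) this (abs_nonneg _) hD0
            simp only [mul_zero, add_zero] at h3
            simp only [hE₀, hC₂]
            linarith
          · intro s hs
            refine (abs_abs_sub_abs_le _ _).trans ?_
            rw [show v₀ x - (w (0, x) + ε * s) - (v₀ x - (w (0, x) + ε * 0)) = -(ε * s) by ring,
              abs_neg, abs_mul, abs_of_pos hε]
            exact mul_le_of_le_one_right hε.le hs
        · intro s hs
          simp only [hH, hsc, hbz s hs]
          ring
      · simp only
        rw [indicator_of_notMem hx]
        simp [hHA _ x hx, hE₀, hψ0x x (not_le.1 fun h => hx (abs_le.1 h))]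
    rw [integral_add hEi (hJi.mul_const ε), integral_mul_const] at b1
    rw [integral_add hE₀i (hJ₀i.mul_const ε), integral_mul_const] at b2
    linarith
  refine le_of_forall_pos_le_add fun δ hδ => ?_
  -- J and J₀ do not depend on ε, so a small width makes the error at most δ; the added 1 avoids
  -- division by zero.
  have hJJ : 0 < |J + J₀| + 1 := by positivity
  have := main (min 1 (δ / (|J + J₀| + 1))) (lt_min one_pos (by positivity)) (min_le_left _ _)
  refine this.trans (add_le_add_right ?_ _)
  calc (J + J₀) * min 1 (δ / (|J + J₀| + 1))
      ≤ (|J + J₀| + 1) * (δ / (|J + J₀| + 1)) := by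
        refine mul_le_mul ?_ (min_le_right _ _) (by positivity) hJJ.le
        linarith [le_abs_self (J + J₀)]
    _ = δ := by field_simp

theorem IsLipschitzSolution.mono {T M M' : ℝ} {w : ℝ × ℝ → ℝ} (h : IsLipschitzSolution T M w)
    (hM : M ≤ M') : IsLipschitzSolution T M' w :=
  ⟨h.lip, fun p => (h.bound p).trans hM, h.pde⟩

theorem IsKruzhkov.mono {T M M' : ℝ} {v : ℝ × ℝ → ℝ} {v₀ : ℝ → ℝ} (h : IsKruzhkov T M v v₀)
    (hM : M ≤ M') : IsKruzhkov T M' v v₀ :=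
  ⟨h.meas, fun p => (h.bound p).trans hM, h.meas₀, fun x => (h.bound₀ x).trans hM, h.ineq⟩

/-! ### Kato inequality across a shock -/

/-- The function equal to `uL` to the left of the curve `x = γ(t)` and to `uR` to its right. -/
def glue (γ : ℝ → ℝ) (uL uR : ℝ × ℝ → ℝ) (p : ℝ × ℝ) : ℝ := if p.2 ≤ γ p.1 then uL p else uR p

/-- Two Lipschitz solutions `uR ≤ uL` that satisfy the Rankine-Hugoniot condition along the
Lipschitz curve `x = γ(t)`. -/
structure IsShockPair (T M : ℝ) (γ : ℝ → ℝ) (uL uR : ℝ × ℝ → ℝ) : Prop where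
  left : IsLipschitzSolution T M uL
  right : IsLipschitzSolution T M uR
  lip : ∃ K, LipschitzWith K γ
  le : ∀ p, uR p ≤ uL p
  rankine_hugoniot : ∀ t ∈ Ioo 0 T, HasDerivAt γ (uL (t, γ t) + uR (t, γ t)) t

theorem IsShockPair.mono {T M M' : ℝ} {γ : ℝ → ℝ} {uL uR : ℝ × ℝ → ℝ}
    (h : IsShockPair T M γ uL uR) (hM : M ≤ M') : IsShockPair T M' γ uL uR :=
  ⟨h.left.mono hM, h.right.mono hM, h.lip, h.le, h.rankine_hugoniot⟩

theorem IsShockPair.glue_bound {T M : ℝ} {γ : ℝ → ℝ} {uL uR : ℝ × ℝ → ℝ}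
    (h : IsShockPair T M γ uL uR) (p : ℝ × ℝ) : |glue γ uL uR p| ≤ M := by
  unfold glue
  split_ifs
  exacts [h.left.bound p, h.right.bound p]

theorem IsShockPair.glue_measurable {T M : ℝ} {γ : ℝ → ℝ} {uL uR : ℝ × ℝ → ℝ}
    (h : IsShockPair T M γ uL uR) : Measurable (glue γ uL uR) := by
  obtain ⟨K, hK⟩ := h.lip
  obtain ⟨K₁, h₁⟩ := h.left.lip
  obtain ⟨K₂, h₂⟩ := h.right.lip
  refine Measurable.ite ?_ h₁.continuous.measurable h₂.continuous.measurable
  exact (isClosed_le continuous_snd (hK.continuous.comp continuous_fst)).measurableSet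

/-- A Lipschitz transition from `0` to `1` in the layer of width `δ` to the right of the curve. -/
def layer (γ : ℝ → ℝ) (δ : ℝ) (p : ℝ × ℝ) : ℝ := max 0 (min 1 ((p.2 - γ p.1) / δ))

theorem layer_mem (γ : ℝ → ℝ) (δ : ℝ) (p : ℝ × ℝ) : 0 ≤ layer γ δ p ∧ layer γ δ p ≤ 1 :=
  ⟨le_max_left _ _, max_le zero_le_one (min_le_left _ _)⟩

theorem exists_lipschitzWith_layer {γ : ℝ → ℝ} (hγ : ∃ K, LipschitzWith K γ) (δ : ℝ) :
    ∃ K, LipschitzWith K (layer γ δ) := by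
  obtain ⟨K, hK⟩ := hγ
  have h1 : LipschitzWith (1 + K * 1) fun p : ℝ × ℝ => p.2 - γ p.1 :=
    LipschitzWith.prod_snd.sub (hK.comp LipschitzWith.prod_fst)
  have h2 : LipschitzWith (‖δ⁻¹‖₊ * (1 + K * 1)) fun p : ℝ × ℝ => (p.2 - γ p.1) / δ := by
    have := (lipschitzWith_smul (β := ℝ) δ⁻¹).comp h1
    simpa only [Function.comp_def, smul_eq_mul, inv_mul_eq_div] using this
  exact ⟨_, (h2.const_min 1).const_max 0⟩

/-- Where the layer function equals 0 or 1 it is at an extremum, so its `fderiv` vanishes,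
differentiable or not. Elsewhere it is locally (x - γ(t))/δ, whose gradient is a multiple k of (-γ',
1). In this form the layer term is the jump of the entropy flux minus γ' times the jump of the
entropy. -/
theorem fderiv_layer {γ : ℝ → ℝ} {δ a : ℝ} (hδ : 0 < δ) {p : ℝ × ℝ} (hγ : HasDerivAt γ a p.1) :
    ∃ k, 0 ≤ k ∧ k ≤ 1 / δ ∧ (k ≠ 0 → 0 < p.2 - γ p.1 ∧ p.2 - γ p.1 < δ) ∧
      fderiv ℝ (layer γ δ) p (1, 0) = -(a * k) ∧ fderiv ℝ (layer γ δ) p (0, 1) = k := by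
  by_cases h0 : layer γ δ p = 0
  · have : IsLocalMin (layer γ δ) p :=
      Eventually.of_forall fun q => by rw [h0]; exact (layer_mem γ δ q).1
    exact ⟨0, le_rfl, by positivity, fun h => (h rfl).elim, by simp [this.fderiv_eq_zero],
      by simp [this.fderiv_eq_zero]⟩
  by_cases h1 : layer γ δ p = 1
  · have : IsLocalMax (layer γ δ) p :=
      Eventually.of_forall fun q => by rw [h1]; exact (layer_mem γ δ q).2
    exact ⟨0, le_rfl, by positivity, fun h => (h rfl).elim, by simp [this.fderiv_eq_zero],
      by simp [this.fderiv_eq_zero]⟩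
  have hlt0 : 0 < (p.2 - γ p.1) / δ := by
    by_contra hcon
    exact h0 (max_eq_left ((min_le_right _ _).trans (not_lt.1 hcon)))
  have hlt1 : (p.2 - γ p.1) / δ < 1 := by
    by_contra hcon
    refine h1 ?_
    unfold layer
    rw [min_eq_left (not_lt.1 hcon)]
    exact max_eq_right zero_le_one
  have hpos : 0 < p.2 - γ p.1 := by
    have := mul_pos hlt0 hδ
    rwa [div_mul_cancel₀ _ hδ.ne'] at this
  have hltδ : p.2 - γ p.1 < δ := by rwa [div_lt_one hδ] at hlt1
  have hcont : ContinuousAt (fun q : ℝ × ℝ => (q.2 - γ q.1) / δ) p := by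
    have : ContinuousAt (fun q : ℝ × ℝ => γ q.1) p :=
      ContinuousAt.comp (f := Prod.fst) (g := γ) hγ.continuousAt continuousAt_fst
    exact (continuousAt_snd.sub this).div_const δ
  have heq : layer γ δ =ᶠ[𝓝 p] fun q => (q.2 - γ q.1) / δ := by
    filter_upwards [hcont.eventually (lt_mem_nhds hlt0), hcont.eventually (gt_mem_nhds hlt1)]
      with q hq0 hq1
    unfold layer
    rw [min_eq_right hq1.le, max_eq_right hq0.le]
  have hd : HasFDerivAt (fun q : ℝ × ℝ => (q.2 - γ q.1) / δ)
      (δ⁻¹ • (ContinuousLinearMap.snd ℝ ℝ ℝ - a • ContinuousLinearMap.fst ℝ ℝ ℝ)) p := by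
    have h2 : HasFDerivAt (fun q : ℝ × ℝ => γ q.1) (a • ContinuousLinearMap.fst ℝ ℝ ℝ) p :=
      hγ.comp_hasFDerivAt p hasFDerivAt_fst
    have := (hasFDerivAt_snd.sub h2).const_mul δ⁻¹
    simpa only [div_eq_inv_mul, Pi.sub_apply] using this
  refine ⟨1 / δ, by positivity, le_rfl, fun _ => ⟨hpos, hltδ⟩, ?_, ?_⟩
  · rw [heq.fderiv_eq, hd.fderiv]
    simp
    ring
  · rw [heq.fderiv_eq, hd.fderiv]
    simp

/-- The layer lies to the right of the curve, so on the curve itself the limit is 0, matching the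
choice of `uL` there in `glue`. -/
theorem tendsto_layer (γ : ℝ → ℝ) (p : ℝ × ℝ) :
    Tendsto (fun n : ℕ => layer γ (1 / (n + 1)) p) atTop (𝓝 (if p.2 ≤ γ p.1 then 0 else 1)) := by
  split_ifs with h
  · refine tendsto_const_nhds.congr fun n => ?_
    refine (max_eq_left ((min_le_right _ _).trans ?_)).symm
    exact div_nonpos_of_nonpos_of_nonneg (by linarith) (by positivity)
  · have hpos : 0 < p.2 - γ p.1 := by linarith [not_le.1 h]
    obtain ⟨N, hN⟩ := exists_nat_gt (1 / (p.2 - γ p.1))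
    refine tendsto_const_nhds.congr' ?_
    filter_upwards [eventually_ge_atTop N] with n hn
    unfold layer
    rw [min_eq_left, max_eq_right zero_le_one]
    rw [div_div_eq_mul_div, div_one]
    have h1 : 1 / (p.2 - γ p.1) ≤ n + 1 := by
      have : (N : ℝ) ≤ n := by exact_mod_cast hn
      linarith
    rw [div_le_iff₀ hpos] at h1
    linarith

/-- The algebraic inequality behind the `L¹` contraction across a Lax shock. -/
theorem shock_inequality {v l r : ℝ} (h : r ≤ l) :
    |v - r| * (v - l) - |v - l| * (v - r) ≤ 0 := by
  rcases le_total v r with h1 | h1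
  · rw [abs_of_nonpos (by linarith), abs_of_nonpos (by linarith)]
    linarith
  · rcases le_total v l with h2 | h2
    · rw [abs_of_nonneg (by linarith), abs_of_nonpos (by linarith)]
      nlinarith
    · rw [abs_of_nonneg (by linarith), abs_of_nonneg (by linarith)]
      linarith

/-- `L¹` contraction (Kato inequality) between a Kruzhkov solution and a shock pair. -/
theorem IsKruzhkov.compare_glue {T M : ℝ} {v ψ uL uR : ℝ × ℝ → ℝ} {v₀ γ : ℝ → ℝ}
    (hv : IsKruzhkov T M v v₀) (hu : IsShockPair T M γ uL uR) (hψ : IsLipschitzTest T ψ) :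
    0 ≤ (∫ p in Ioo 0 T ×ˢ univ, (fderiv ℝ ψ p (1, 0) * |v p - glue γ uL uR p| +
      fderiv ℝ ψ p (0, 1) * (|v p - glue γ uL uR p| * (v p + glue γ uL uR p))))
      + ∫ x, ψ (0, x) * |v₀ x - glue γ uL uR (0, x)| := by
  obtain ⟨K, hK⟩ := hψ.lip
  obtain ⟨KL, hL⟩ := hu.left.lip
  obtain ⟨KR, hR⟩ := hu.right.lip
  obtain ⟨D, hD⟩ := hψ.exists_bound
  obtain ⟨R, T', hT', hs⟩ := hψ.support
  have hψ0 : ∀ p, R < ‖p‖ → ψ p = 0 := fun p hp => by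
    by_contra hne
    exact absurd (hs p hne).1 (not_le.2 hp)
  have hψ0x : ∀ x : ℝ, R < |x| → ψ (0, x) = 0 := fun x hx =>
    hψ0 _ (by rw [Prod.norm_def]; simpa using hx)
  have hD0 : 0 ≤ D := (abs_nonneg _).trans (hD 0)
  have hM0 : 0 ≤ M := (abs_nonneg _).trans (hv.bound 0)
  have hvm := hv.meas
  have hv₀m := hv.meas₀
  have hLm : Measurable uL := hL.continuous.measurable
  have hRm : Measurable uR := hR.continuous.measurable
  have hψm : Measurable ψ := hK.continuous.measurable
  have hγm : Measurable γ := hu.lip.choose_spec.continuous.measurable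
  set S : Set (ℝ × ℝ) := Ioo 0 T ×ˢ univ with hS
  have hSm : MeasurableSet S := measurableSet_Ioo.prod MeasurableSet.univ
  set θ : ℕ → ℝ × ℝ → ℝ := fun n => layer γ (1 / (n + 1)) with hθ
  have hθlip : ∀ n, ∃ K, LipschitzWith K (θ n) := fun n => exists_lipschitzWith_layer hu.lip _
  have hθm : ∀ n, Measurable (θ n) := fun n => (hθlip n).choose_spec.continuous.measurable
  have hθ01 : ∀ n p, 0 ≤ θ n p ∧ θ n p ≤ 1 := fun n p => layer_mem _ _ _
  have hθ'lip : ∀ n, ∃ K, LipschitzWith K (fun p => 1 - θ n p) := fun n => by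
    obtain ⟨k, hk⟩ := hθlip n
    exact ⟨_, (LipschitzWith.const (1 : ℝ)).sub hk⟩
  set EL : ℝ × ℝ → ℝ := fun p => fderiv ℝ ψ p (1, 0) * |v p - uL p| +
      fderiv ℝ ψ p (0, 1) * (|v p - uL p| * (v p + uL p)) with hEL
  set ER : ℝ × ℝ → ℝ := fun p => fderiv ℝ ψ p (1, 0) * |v p - uR p| +
      fderiv ℝ ψ p (0, 1) * (|v p - uR p| * (v p + uR p)) with hER
  have hELi : IntegrableOn EL S := integrable_entropy hvm hLm hv.bound hu.left.bound
    (fun p => norm_fderiv_le_of_lipschitz ℝ hK) hψ0 S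
  have hERi : IntegrableOn ER S := integrable_entropy hvm hRm hv.bound hu.right.bound
    (fun p => norm_fderiv_le_of_lipschitz ℝ hK) hψ0 S
  have mt := measurable_fderiv_apply_const ℝ ψ (1, 0)
  have mx := measurable_fderiv_apply_const ℝ ψ (0, 1)
  have hELm : Measurable EL := by fun_prop
  have hERm : Measurable ER := by fun_prop
  -- In a layer of width δ, the sum uL + uR differs from γ' by at most (KL + KR)δ, the difference |v
  -- - uR| - |v - uL| is at most 2M, and ψ ≤ D. The slope k ≤ 1/δ cancels δ, so the error is bounded
  -- by C on a layer that shrinks to the empty set.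
  set C : ℝ := D * ((KL + KR) * (2 * M)) with hC
  have hC0 : 0 ≤ C := by positivity
  set A : ℕ → Set (ℝ × ℝ) := fun n =>
    {p | 0 < p.2 - γ p.1 ∧ p.2 - γ p.1 < 1 / ((n : ℝ) + 1)} ∩ Metric.closedBall 0 R with hA
  have hdm : Measurable fun p : ℝ × ℝ => p.2 - γ p.1 := by fun_prop
  have hAm : ∀ n, MeasurableSet (A n) := fun n => by
    refine MeasurableSet.inter (MeasurableSet.inter ?_ ?_) Metric.isClosed_closedBall.measurableSet
    · exact measurableSet_lt measurable_const hdm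
    · exact measurableSet_lt hdm measurable_const
  set F : ℕ → ℝ × ℝ → ℝ := fun n p =>
    (1 - θ n p) * EL p + θ n p * ER p + (A n).indicator (fun _ => C) p with hF
  set F₀ : ℕ → ℝ → ℝ := fun n x => (1 - θ n (0, x)) * (ψ (0, x) * |v₀ x - uL (0, x)|)
    + θ n (0, x) * (ψ (0, x) * |v₀ x - uR (0, x)|) with hF₀
  have hIL : Integrable fun x => ψ (0, x) * |v₀ x - uL (0, x)| := by
    refine integrable_initial (M := 2 * M) (by fun_prop) (by fun_prop) (fun x => ?_)
      (fun x => hD _) hψ0x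
    rw [abs_abs]
    exact (abs_sub _ _).trans (by linarith [hv.bound₀ x, hu.left.bound (0, x)])
  have hIR : Integrable fun x => ψ (0, x) * |v₀ x - uR (0, x)| := by
    refine integrable_initial (M := 2 * M) (by fun_prop) (by fun_prop) (fun x => ?_)
      (fun x => hD _) hψ0x
    rw [abs_abs]
    exact (abs_sub _ _).trans (by linarith [hv.bound₀ x, hu.right.bound (0, x)])
  have hbd : Integrable (fun p => |EL p| + |ER p| +
      (Metric.closedBall (0 : ℝ × ℝ) R).indicator (fun _ => C) p) (volume.restrict S) :=
    (hELi.abs.add hERi.abs).add (integrable_indicator_closedBall R C S)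
  have hFm : ∀ n, Measurable (F n) := fun n => by
    have := hθm n
    exact (by fun_prop : Measurable fun p => (1 - θ n p) * EL p + θ n p * ER p).add
      (measurable_const.indicator (hAm n))
  have hconv : ∀ (a b : ℝ) n p, |(1 - θ n p) * a + θ n p * b| ≤ |a| + |b| := by
    intro a b n p
    obtain ⟨h0, h1⟩ := hθ01 n p
    refine (abs_add_le _ _).trans ?_
    rw [abs_mul, abs_mul, abs_of_nonneg h0, abs_of_nonneg (by linarith : 0 ≤ 1 - θ n p)]
    exact add_le_add (mul_le_of_le_one_left (abs_nonneg _) (by linarith))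
      (mul_le_of_le_one_left (abs_nonneg _) h1)
  have hFb : ∀ n p, ‖F n p‖ ≤ |EL p| + |ER p| +
      (Metric.closedBall (0 : ℝ × ℝ) R).indicator (fun _ => C) p := by
    intro n p
    refine (abs_add_le _ _).trans (add_le_add (hconv _ _ n p) ?_)
    rw [abs_of_nonneg (indicator_nonneg (fun _ _ => hC0) p)]
    exact indicator_le_indicator_of_subset inter_subset_right (fun _ => hC0) p
  have lim : Tendsto (fun n => ∫ p in S, F n p) atTop
      (𝓝 (∫ p in S, (fderiv ℝ ψ p (1, 0) * |v p - glue γ uL uR p| +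
      fderiv ℝ ψ p (0, 1) * (|v p - glue γ uL uR p| * (v p + glue γ uL uR p))))) := by
    refine tendsto_integral_of_dominated_convergence _ (fun n => (hFm n).aestronglyMeasurable) hbd
      (fun n => Eventually.of_forall (hFb n)) (Eventually.of_forall fun p => ?_)
    have h1 := tendsto_layer γ p
    have h2 : Tendsto (fun n => (A n).indicator (fun _ => C) p) atTop (𝓝 0) := by
      refine tendsto_const_nhds.congr' ?_
      by_cases hp : 0 < p.2 - γ p.1
      · obtain ⟨N, hN⟩ := exists_nat_gt (1 / (p.2 - γ p.1))
        filter_upwards [eventually_ge_atTop N] with n hn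
        refine (indicator_of_notMem (fun hmem => ?_) _).symm
        have h3 := hmem.1.2
        have : (N : ℝ) ≤ n := by exact_mod_cast hn
        rw [lt_div_iff₀ (by positivity)] at h3
        rw [div_lt_iff₀ hp] at hN
        nlinarith
      · exact Eventually.of_forall fun n => (indicator_of_notMem (fun hmem => hp hmem.1.1) _).symm
    have h3 := (((h1.const_sub 1).mul_const (EL p)).add (h1.mul_const (ER p))).add h2
    convert h3 using 2
    unfold glue
    split_ifs <;> simp [hEL, hER]
  have lim₀ : Tendsto (fun n => ∫ x, F₀ n x) atTop
      (𝓝 (∫ x, ψ (0, x) * |v₀ x - glue γ uL uR (0, x)|)) := by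
    refine tendsto_integral_of_dominated_convergence _ (fun n => ?_) (hIL.abs.add hIR.abs)
      (fun n => Eventually.of_forall fun x => hconv _ _ n (0, x)) (Eventually.of_forall fun x => ?_)
    · have := hθm n
      exact (by fun_prop : Measurable (F₀ n)).aestronglyMeasurable
    · have h1 := tendsto_layer γ (0, x)
      have h3 := ((h1.const_sub 1).mul_const (ψ (0, x) * |v₀ x - uL (0, x)|)).add
        (h1.mul_const (ψ (0, x) * |v₀ x - uR (0, x)|))
      convert h3 using 2
      unfold glue
      split_ifs <;> simp
  -- For each n the comparison with uL is tested with ψ(1 - θ) and the one with uR with ψθ; their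
  -- sum is bounded by the integrals of F n and F₀ n.
  refine ge_of_tendsto (lim.add lim₀) (Eventually.of_forall fun n => ?_)
  have tL : IsLipschitzTest T fun p => ψ p * (1 - θ n p) :=
    hψ.mul (hθ'lip n) (C := 1) (fun p => by
      rw [abs_of_nonneg (by linarith [(hθ01 n p).2])]; linarith [(hθ01 n p).1])
      (fun p => by linarith [(hθ01 n p).2])
  have tR : IsLipschitzTest T fun p => ψ p * θ n p :=
    hψ.mul (hθlip n) (C := 1) (fun p => by
      rw [abs_of_nonneg (hθ01 n p).1]; exact (hθ01 n p).2) (fun p => (hθ01 n p).1)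
  have cL := hv.compare hu.left tL
  have cR := hv.compare hu.right tR
  have hint : ∀ {χ w : ℝ × ℝ → ℝ}, IsLipschitzTest T χ → IsLipschitzSolution T M w →
      Integrable (fun p => fderiv ℝ χ p (1, 0) * |v p - w p| +
        fderiv ℝ χ p (0, 1) * (|v p - w p| * (v p + w p))) (volume.restrict S) ∧
      Integrable fun x => χ (0, x) * |v₀ x - w (0, x)| := by
    intro χ w hχ hw
    obtain ⟨k, hk⟩ := hχ.lip
    obtain ⟨l, hl⟩ := hw.lip
    obtain ⟨R', T'', -, hs'⟩ := hχ.support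
    obtain ⟨D', hD'⟩ := hχ.exists_bound
    have hz : ∀ p, R' < ‖p‖ → χ p = 0 := fun p hp => by
      by_contra hne
      exact absurd (hs' p hne).1 (not_le.2 hp)
    have hwm := hl.continuous.measurable
    have hχm := hk.continuous.measurable
    refine ⟨integrable_entropy hvm hwm hv.bound hw.bound
      (fun p => norm_fderiv_le_of_lipschitz ℝ hk) hz S, ?_⟩
    refine integrable_initial (M := 2 * M) (R := R') (by fun_prop) (by fun_prop) (fun x => ?_)
      (fun x => hD' _) (fun x hx => hz _ (by rw [Prod.norm_def]; simpa using hx))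
    rw [abs_abs]
    exact (abs_sub _ _).trans (by linarith [hv.bound₀ x, hw.bound (0, x)])
  obtain ⟨iL, iL₀⟩ := hint tL hu.left
  obtain ⟨iR, iR₀⟩ := hint tR hu.right
  have hsum : (∫ x, F₀ n x) = (∫ x, ψ (0, x) * (1 - θ n (0, x)) * |v₀ x - uL (0, x)|)
      + ∫ x, ψ (0, x) * θ n (0, x) * |v₀ x - uR (0, x)| := by
    rw [← integral_add iL₀ iR₀]
    refine integral_congr_ae (Eventually.of_forall fun x => ?_)
    simp only [hF₀]
    ring
  have hFi : Integrable (F n) (volume.restrict S) :=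
    hbd.mono' (hFm n).aestronglyMeasurable (Eventually.of_forall (hFb n))
  have hle := integral_mono_ae (iL.add iR) hFi ?_
  · simp only [Pi.add_apply] at hle
    rw [integral_add iL iR] at hle
    rw [hsum]
    linarith
  filter_upwards [ae_restrict_of_ae hψ.ae_differentiableAt,
    ae_restrict_of_ae ((hθlip n).choose_spec.ae_differentiableAt (μ := volume)),
    ae_restrict_mem hSm] with p h1 h2 hpS
  have hδ : (0 : ℝ) < 1 / ((n : ℝ) + 1) := by positivity
  obtain ⟨k, hk0, hk1, hk2, hkt, hkx⟩ := fderiv_layer hδ (hu.rankine_hugoniot p.1 hpS.1)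
  set a := uL (p.1, γ p.1) + uR (p.1, γ p.1) with ha
  have d1 : ∀ e, fderiv ℝ (fun p => ψ p * (1 - θ n p)) p e
      = fderiv ℝ ψ p e * (1 - θ n p) - ψ p * fderiv ℝ (θ n) p e := by
    intro e
    have := h1.hasFDerivAt.mul (h2.hasFDerivAt.const_sub 1)
    have h4 : (fun p => ψ p * (1 - θ n p)) = ψ * (fun p => 1 - θ n p) := rfl
    rw [h4, this.fderiv]
    simp only [add_apply, smul_apply, neg_apply, smul_eq_mul]
    ring
  have d2 : ∀ e, fderiv ℝ (fun p => ψ p * θ n p) p e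
      = fderiv ℝ ψ p e * θ n p + ψ p * fderiv ℝ (θ n) p e := by
    intro e
    have := h1.hasFDerivAt.mul h2.hasFDerivAt
    have h4 : (fun p => ψ p * θ n p) = ψ * θ n := rfl
    rw [h4, this.fderiv]
    simp only [add_apply, smul_apply, smul_eq_mul]
    ring
  simp only [Pi.add_apply, d1, d2]
  have hkt' : fderiv ℝ (θ n) p (1, 0) = -(a * k) := hkt
  have hkx' : fderiv ℝ (θ n) p (0, 1) = k := hkx
  rw [hkt', hkx']
  -- If a were exactly uL + uR at p, the bracket would be the left side of `shock_inequality`, hence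
  -- nonpositive; only the Lipschitz error of replacing p by the point of the curve at the same time
  -- remains.
  have key : ψ p * k * ((|v p - uR p| * (v p + uR p) - a * |v p - uR p|)
      - (|v p - uL p| * (v p + uL p) - a * |v p - uL p|)) ≤ (A n).indicator (fun _ => C) p := by
    by_cases hψp : ψ p = 0
    · rw [hψp, zero_mul, zero_mul]; exact indicator_nonneg (fun _ _ => hC0) p
    by_cases hkz : k = 0
    · rw [hkz, mul_zero, zero_mul]; exact indicator_nonneg (fun _ _ => hC0) p
    obtain ⟨g0, g1⟩ := hk2 hkz
    rw [indicator_of_mem (show p ∈ A n from ⟨⟨g0, g1⟩, by simpa using (hs p hψp).1⟩)]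
    have q1 : |uL p + uR p - a| ≤ (KL + KR) * (1 / ((n : ℝ) + 1)) := by
      have e1 := hL.dist_le_mul p (p.1, γ p.1)
      have e2 := hR.dist_le_mul p (p.1, γ p.1)
      have e3 : dist p (p.1, γ p.1) ≤ 1 / ((n : ℝ) + 1) := by
        rw [Prod.dist_eq, dist_self, Real.dist_eq, abs_of_pos g0]
        exact max_le hδ.le g1.le
      rw [Real.dist_eq] at e1 e2
      have e4 : uL p + uR p - a = (uL p - uL (p.1, γ p.1)) + (uR p - uR (p.1, γ p.1)) := by
        rw [ha]; ring
      rw [e4, add_mul]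
      refine (abs_add_le _ _).trans (add_le_add ?_ ?_)
      · exact e1.trans (mul_le_mul_of_nonneg_left e3 KL.coe_nonneg)
      · exact e2.trans (mul_le_mul_of_nonneg_left e3 KR.coe_nonneg)
    have q2 : |(|v p - uR p| - |v p - uL p|)| ≤ 2 * M := by
      refine (abs_abs_sub_abs_le _ _).trans ?_
      rw [show v p - uR p - (v p - uL p) = uL p - uR p by ring]
      exact (abs_sub _ _).trans (by linarith [hu.left.bound p, hu.right.bound p])
    have q3 := shock_inequality (v := v p) (hu.le p)
    have q4 : (uL p + uR p - a) * (|v p - uR p| - |v p - uL p|)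
        ≤ (KL + KR) * (1 / ((n : ℝ) + 1)) * (2 * M) := by
      refine (le_abs_self _).trans ?_
      rw [abs_mul]
      exact mul_le_mul q1 q2 (abs_nonneg _) (by positivity)
    have q5 : (|v p - uR p| * (v p + uR p) - a * |v p - uR p|)
        - (|v p - uL p| * (v p + uL p) - a * |v p - uL p|)
        ≤ (KL + KR) * (1 / ((n : ℝ) + 1)) * (2 * M) := by linarith
    have hψle : ψ p ≤ D := (le_abs_self _).trans (hD p)
    have hk3 : k * (1 / ((n : ℝ) + 1)) ≤ 1 := by
      have := mul_le_mul_of_nonneg_right hk1 hδ.le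
      rwa [one_div_mul_cancel hδ.ne'] at this
    calc _ ≤ ψ p * k * ((KL + KR) * (1 / ((n : ℝ) + 1)) * (2 * M)) :=
          mul_le_mul_of_nonneg_left q5 (mul_nonneg (hψ.nonneg p) hk0)
      _ = ψ p * ((KL + KR) * (2 * M)) * (k * (1 / ((n : ℝ) + 1))) := by ring
      _ ≤ ψ p * ((KL + KR) * (2 * M)) * 1 := mul_le_mul_of_nonneg_left hk3
          (mul_nonneg (hψ.nonneg p) (by positivity))
      _ ≤ C := by
          rw [mul_one]; exact mul_le_mul_of_nonneg_right hψle (by positivity)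
  simp only [hF, hEL, hER]
  linarith

/-! ### Integration by parts; the glued function is an entropy solution -/

theorem IsTestFunction.integrableOn_fderiv {T : ℝ} {φ : ℝ × ℝ → ℝ} (h : IsTestFunction T φ)
    (e : ℝ × ℝ) : Integrable (fun p => fderiv ℝ φ p e) ((volume : Measure ℝ).prod volume) := by
  have hc : Continuous (fderiv ℝ φ) := h.smooth.continuous_fderiv (by simp)
  exact (hc.clm_apply continuous_const).integrable_of_hasCompactSupport
    (h.compact.fderiv_apply ℝ e)

theorem IsTestFunction.hasDerivAt_fst {T : ℝ} {φ : ℝ × ℝ → ℝ} (h : IsTestFunction T φ) (t x : ℝ) :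
    HasDerivAt (fun s => φ (s, x)) (fderiv ℝ φ (t, x) (1, 0)) t := by
  have h1 : HasFDerivAt φ (fderiv ℝ φ (t, x)) (t, x) :=
    (h.smooth.differentiable (by simp) _).hasFDerivAt
  exact h1.comp_hasDerivAt t ((hasDerivAt_id t).prodMk (hasDerivAt_const t x))

theorem IsTestFunction.hasDerivAt_snd {T : ℝ} {φ : ℝ × ℝ → ℝ} (h : IsTestFunction T φ) (t x : ℝ) :
    HasDerivAt (fun y => φ (t, y)) (fderiv ℝ φ (t, x) (0, 1)) x := by
  have h1 : HasFDerivAt φ (fderiv ℝ φ (t, x)) (t, x) :=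
    (h.smooth.differentiable (by simp) _).hasFDerivAt
  exact h1.comp_hasDerivAt x ((hasDerivAt_const x t).prodMk (hasDerivAt_id x))

theorem IsTestFunction.continuous_fderiv {T : ℝ} {φ : ℝ × ℝ → ℝ} (h : IsTestFunction T φ)
    (e : ℝ × ℝ) : Continuous fun p => fderiv ℝ φ p e :=
  (h.smooth.continuous_fderiv (by simp)).clm_apply continuous_const

/-- The support lies in t < T, so the boundary term at T vanishes and only the initial one survives.
-/
theorem IsTestFunction.integral_fderiv_time {T : ℝ} (hT : 0 ≤ T) {φ : ℝ × ℝ → ℝ}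
    (h : IsTestFunction T φ) (J : Set ℝ) :
    ∫ p in Ioo 0 T ×ˢ J, fderiv ℝ φ p (1, 0) = - ∫ x in J, φ (0, x) := by
  have hi := h.integrableOn_fderiv (1, 0)
  rw [Measure.volume_eq_prod, setIntegral_prod _ hi.integrableOn]
  rw [integral_integral_swap]
  · rw [← integral_neg]
    refine integral_congr_ae (Eventually.of_forall fun x => ?_)
    simp only
    rw [← integral_Ioc_eq_integral_Ioo, ← intervalIntegral.integral_of_le hT,
      intervalIntegral.integral_eq_sub_of_hasDerivAt (fun t _ => h.hasDerivAt_fst t x)]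
    · have : φ (T, x) = 0 := by
        by_contra hne
        exact absurd (h.support (subset_tsupport _ hne)).1 (lt_irrefl T)
      rw [this]; simp
    · exact ((h.continuous_fderiv (1, 0)).comp
        (by fun_prop : Continuous fun t : ℝ => (t, x))).intervalIntegrable _ _
  · rw [Measure.prod_restrict]
    exact hi.integrableOn

theorem IsTestFunction.hasCompactSupport_snd {T : ℝ} {φ : ℝ × ℝ → ℝ} (h : IsTestFunction T φ)
    (t : ℝ) : HasCompactSupport fun x => φ (t, x) := by
  obtain ⟨R, T', -, hs⟩ := h.isLipschitzTest.support
  refine HasCompactSupport.of_support_subset_isCompact (isCompact_closedBall (0 : ℝ) R) ?_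
  intro x hx
  have := (hs (t, x) hx).1
  rw [mem_closedBall_zero_iff]
  exact (norm_snd_le (t, x)).trans this

theorem IsTestFunction.contDiff_snd {T : ℝ} {φ : ℝ × ℝ → ℝ} (h : IsTestFunction T φ)
    (t : ℝ) : ContDiff ℝ 1 fun x => φ (t, x) :=
  (h.smooth.of_le (by simp)).comp (contDiff_const.prodMk contDiff_id)

theorem IsTestFunction.integral_fderiv_space_Iic {T : ℝ} {φ : ℝ × ℝ → ℝ}
    (h : IsTestFunction T φ) (α : ℝ) :
    ∫ p in Ioo 0 T ×ˢ Iic α, fderiv ℝ φ p (0, 1) = ∫ t in Ioo 0 T, φ (t, α) := by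
  have hi := h.integrableOn_fderiv (0, 1)
  rw [Measure.volume_eq_prod, setIntegral_prod _ hi.integrableOn]
  refine integral_congr_ae (Eventually.of_forall fun t => ?_)
  simp only
  rw [← (h.hasCompactSupport_snd t).integral_Iic_deriv_eq (h.contDiff_snd t) α]
  exact integral_congr_ae (Eventually.of_forall fun x => (h.hasDerivAt_snd t x).deriv.symm)

theorem IsTestFunction.integral_fderiv_space_Ici {T : ℝ} {φ : ℝ × ℝ → ℝ}
    (h : IsTestFunction T φ) (β : ℝ) :
    ∫ p in Ioo 0 T ×ˢ Ici β, fderiv ℝ φ p (0, 1) = - ∫ t in Ioo 0 T, φ (t, β) := by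
  have hi := h.integrableOn_fderiv (0, 1)
  rw [Measure.volume_eq_prod, setIntegral_prod _ hi.integrableOn, ← integral_neg]
  refine integral_congr_ae (Eventually.of_forall fun t => ?_)
  simp only
  rw [integral_Ici_eq_integral_Ioi, ← (h.hasCompactSupport_snd t).integral_Ioi_deriv_eq (h.contDiff_snd t) β]
  exact integral_congr_ae (Eventually.of_forall fun x => (h.hasDerivAt_snd t x).deriv.symm)

theorem IsTestFunction.integral_fderiv_space_univ {T : ℝ} {φ : ℝ × ℝ → ℝ}
    (h : IsTestFunction T φ) :
    ∫ p in Ioo 0 T ×ˢ univ, fderiv ℝ φ p (0, 1) = 0 := by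
  have hi := h.integrableOn_fderiv (0, 1)
  have hu : (Ioo (0 : ℝ) T ×ˢ (univ : Set ℝ)) = Ioo 0 T ×ˢ Iic 0 ∪ Ioo 0 T ×ˢ Ioi 0 := by
    rw [← prod_union, Iic_union_Ioi]
  rw [Measure.volume_eq_prod, setIntegral_prod _ hi.integrableOn]
  refine integral_eq_zero_of_ae (Eventually.of_forall fun t => ?_)
  have hc := h.hasCompactSupport_snd t
  have h1 := hc.integral_Iic_deriv_eq (h.contDiff_snd t) 0
  have h2 := hc.integral_Ioi_deriv_eq (h.contDiff_snd t) 0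
  have hi' : Integrable (deriv fun x => φ (t, x)) :=
    ((h.contDiff_snd t).continuous_deriv le_rfl).integrable_of_hasCompactSupport hc.deriv
  have h3 := setIntegral_union (f := deriv fun x => φ (t, x)) (μ := volume)
    (Iic_disjoint_Ioi (le_refl (0 : ℝ))) measurableSet_Ioi hi'.integrableOn hi'.integrableOn
  rw [Iic_union_Ioi, h1, h2] at h3
  have h4 : ∫ x in univ, fderiv ℝ φ (t, x) (0, 1) = ∫ x in univ, deriv (fun x => φ (t, x)) x :=
    integral_congr_ae (Eventually.of_forall fun x => (h.hasDerivAt_snd t x).deriv.symm)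
  simp only [Pi.zero_apply]
  rw [h4, h3, add_neg_cancel]

/-- Constants are Kruzhkov solutions. -/
theorem isKruzhkov_const {T M c : ℝ} (hT : 0 ≤ T) (hc : |c| ≤ M) :
    IsKruzhkov T M (fun _ => c) (fun _ => c) := by
  refine ⟨measurable_const, fun _ => hc, measurable_const, fun _ => hc, fun k φ hφ => ?_⟩
  refine kruzhkov_of_isLipschitzTest (v := fun _ => c) (v₀ := fun _ => c) measurable_const
    (fun _ => hc) measurable_const (fun _ => hc) (fun χ hχ => ?_) hφ
  unfold kruzhkovIntegral
  have i1 := (hχ.integrableOn_fderiv (1, 0)).integrableOn (s := Ioo 0 T ×ˢ univ)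
  have i2 := (hχ.integrableOn_fderiv (0, 1)).integrableOn (s := Ioo 0 T ×ˢ univ)
  rw [← Measure.volume_eq_prod] at i1 i2
  rw [integral_add (i1.mul_const _) (i2.mul_const _), integral_mul_const, integral_mul_const,
    integral_mul_const, hχ.integral_fderiv_time hT, hχ.integral_fderiv_space_univ, setIntegral_univ]
  exact le_of_eq (by ring)

/-- The glued function is an entropy admissible solution of Burgers' equation. -/
theorem IsShockPair.isEntropySolution {T M : ℝ} (hT : 0 ≤ T) {γ : ℝ → ℝ} {uL uR : ℝ × ℝ → ℝ}
    (hu : IsShockPair T M γ uL uR) :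
    IsEntropySolution burgers T (fun x => glue γ uL uR (0, x)) (glue γ uL uR) := by
  refine ⟨?_, fun c φ hφ => ?_⟩
  · exact memLp_top_of_bound hu.glue_measurable.aestronglyMeasurable M
      (Eventually.of_forall hu.glue_bound)
  -- The entropy inequality for the constant c is the Kato inequality against the constant solution
  -- c. The maximum with |c| gives both functions a common bound.
  · have h := (isKruzhkov_const hT (le_max_right M |c|)).compare_glue
      (hu.mono (le_max_left M |c|)) hφ.isLipschitzTest
    unfold kruzhkovIntegral
    simp only [kruzhkovFlux_burgers]
    simpa only [abs_sub_comm c, add_comm c] using h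

/-! ### Uniqueness by a cone test function -/

/-- The comparison argument wants a function that is Borel and bounded at every point. A measurable
representative, truncated at a large enough level, changes the solution only on a null set. -/
theorem IsEntropySolution.exists_isKruzhkov {T M₀ : ℝ} {v : ℝ × ℝ → ℝ} {v₀ : ℝ → ℝ}
    (h : IsEntropySolution burgers T v₀ v) (hm : Measurable v₀) (hb : ∀ x, |v₀ x| ≤ M₀) :
    ∃ M v', IsKruzhkov T M v' v₀ ∧ v' =ᵐ[volume.restrict (Ioo 0 T ×ˢ univ)] v := by
  set μ : Measure (ℝ × ℝ) := volume.restrict (Ioo 0 T ×ˢ univ) with hμ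
  have hmeas := h.bounded.1
  obtain ⟨B, hB⟩ : ∃ B : ℝ, ∀ᵐ p ∂μ, |v p| ≤ B := by
    have h2 := h.bounded.2
    rw [eLpNorm_exponent_top] at h2
    refine ⟨(eLpNormEssSup v μ).toReal, ?_⟩
    filter_upwards [ae_le_eLpNormEssSup (f := v) (μ := μ)] with p hp
    have := ENNReal.toReal_mono h2.ne hp
    simpa using this
  set M := max B (max M₀ 0) with hM
  have hM0 : 0 ≤ M := (le_max_right _ _).trans (le_max_right _ _)
  set v' : ℝ × ℝ → ℝ := fun p => max (-M) (min M (hmeas.mk v p)) with hv'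
  have hv'm : Measurable v' :=
    measurable_const.max (measurable_const.min hmeas.stronglyMeasurable_mk.measurable)
  have hv'b : ∀ p, |v' p| ≤ M := fun p =>
    abs_le.2 ⟨le_max_left _ _, max_le (by linarith) (min_le_left _ _)⟩
  have hae : v' =ᵐ[μ] v := by
    filter_upwards [hmeas.ae_eq_mk, hB] with p h1 h2
    have h3 := abs_le.1 (h2.trans (le_max_left B (max M₀ 0)))
    simp only [hv']
    rw [← h1, min_eq_right h3.2, max_eq_right h3.1]
  have hb' : ∀ x, |v₀ x| ≤ M := fun x =>
    (hb x).trans ((le_max_left _ _).trans (le_max_right _ _))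
  refine ⟨M, v', ⟨hv'm, hv'b, hm, hb', fun c φ hφ => ?_⟩, hae⟩
  refine kruzhkov_of_isLipschitzTest hv'm hv'b hm hb' (fun χ hχ => ?_) hφ
  refine (h.entropy c χ hχ).trans (le_of_eq ?_)
  congr 1
  refine integral_congr_ae ?_
  filter_upwards [hae] with p hp
  rw [hp]

/-- A test function that decreases along every direction `(1, σ)`, `|σ| ≤ s`, at unit rate. -/
def coneTest (T' R s : ℝ) (p : ℝ × ℝ) : ℝ :=
  max 0 (min (R - |p.2| - (s + 1) * |p.1|) (T' - |p.1|))

theorem isLipschitzTest_coneTest {T T' R s : ℝ} (hT' : T' < T) (hs : 0 ≤ s) :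
    IsLipschitzTest T (coneTest T' R s) := by
  refine ⟨?_, ⟨max R T', T', hT', fun p hp => ?_⟩, fun p => le_max_left _ _⟩
  · have h1 : LipschitzWith (1 * 1) fun p : ℝ × ℝ => |p.1| :=
      (lipschitzWith_one_norm (E := ℝ)).comp LipschitzWith.prod_fst
    have h2 : LipschitzWith (1 * 1) fun p : ℝ × ℝ => |p.2| :=
      (lipschitzWith_one_norm (E := ℝ)).comp LipschitzWith.prod_snd
    have h3 : LipschitzWith (‖s + 1‖₊ * (1 * 1)) fun p : ℝ × ℝ => (s + 1) * |p.1| :=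
      (lipschitzWith_smul (β := ℝ) (s + 1)).comp h1
    have h4 := ((LipschitzWith.const (α := ℝ × ℝ) R).sub h2).sub h3
    have h5 := (LipschitzWith.const (α := ℝ × ℝ) T').sub h1
    exact ⟨_, (h4.min h5).const_max 0⟩
  · have hpos : 0 < min (R - |p.2| - (s + 1) * |p.1|) (T' - |p.1|) := by
      by_contra hcon
      exact hp (max_eq_left (not_lt.1 hcon))
    obtain ⟨h1, h2⟩ := lt_min_iff.1 hpos
    have h3 : 0 ≤ (s + 1) * |p.1| := by positivity
    refine ⟨?_, (le_abs_self _).trans (by linarith)⟩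
    rw [Prod.norm_def]
    exact max_le (le_max_of_le_right (by rw [Real.norm_eq_abs]; linarith))
      (le_max_of_le_left (by rw [Real.norm_eq_abs]; linarith))

/-- Along (1, σ) with |σ| ≤ s, the term R - |x| - (s + 1)|t| loses at least (s + 1) - s = 1 per unit
of time, and T' - |t| loses exactly 1; both use t > 0. The one-sided difference quotients carry this
to the derivative. -/
theorem fderiv_coneTest_le {T' R s σ : ℝ} {p : ℝ × ℝ} (hp : 0 < p.1) (hσ : |σ| ≤ s)
    (hpos : 0 < coneTest T' R s p) (hd : DifferentiableAt ℝ (coneTest T' R s) p) :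
    fderiv ℝ (coneTest T' R s) p (1, 0) + fderiv ℝ (coneTest T' R s) p (0, 1) * σ ≤ -1 := by
  have h1 : fderiv ℝ (coneTest T' R s) p (1, 0) + fderiv ℝ (coneTest T' R s) p (0, 1) * σ
      = fderiv ℝ (coneTest T' R s) p (1, σ) := by
    have : ((1 : ℝ), σ) = (1, 0) + σ • ((0 : ℝ), (1 : ℝ)) := by simp
    rw [this, map_add, map_smul, smul_eq_mul, mul_comm]
  rw [h1]
  have h2 := (hd.hasFDerivAt.hasLineDerivAt (1, σ)).tendsto_slope_zero_right
  refine le_of_tendsto h2 ?_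
  have h3 : ∀ᶠ h in 𝓝[>] (0 : ℝ), h < coneTest T' R s p :=
    (gt_mem_nhds hpos).filter_mono nhdsWithin_le_nhds
  filter_upwards [h3, self_mem_nhdsWithin] with h hh hh0
  have hh0' : 0 < h := hh0
  have h4 : coneTest T' R s (p + h • (1, σ)) ≤ coneTest T' R s p - h := by
    have e1 : (p + h • ((1 : ℝ), σ)).1 = p.1 + h := by simp
    have e2 : (p + h • ((1 : ℝ), σ)).2 = p.2 + h * σ := by simp
    unfold coneTest at *
    rw [e1, e2, abs_of_pos hp, abs_of_pos (by linarith : 0 < p.1 + h)]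
    rw [abs_of_pos hp] at hh
    have hle : |p.2| ≤ |p.2 + h * σ| + h * s := by
      have a1 : |p.2| ≤ |p.2 + h * σ| + |h * σ| := by
        have := abs_sub (p.2 + h * σ) (h * σ)
        simpa using this
      rw [abs_mul, abs_of_pos hh0'] at a1
      nlinarith
    refine max_le (by linarith) ?_
    rw [sub_eq_add_neg]
    refine le_trans ?_ (add_le_add_left (le_max_right _ _) _)
    rw [← min_add_add_right]
    refine min_le_min ?_ ?_ <;> linarith
  rw [smul_eq_mul, inv_mul_le_iff₀ hh0']
  linarith

/-- Uniqueness of the entropy admissible solution. -/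
theorem IsShockPair.unique {T M : ℝ} {γ : ℝ → ℝ} {uL uR v : ℝ × ℝ → ℝ}
    (hu : IsShockPair T M γ uL uR)
    (hv : IsEntropySolution burgers T (fun x => glue γ uL uR (0, x)) v) :
    v =ᵐ[volume.restrict (Ioo 0 T ×ˢ univ)] glue γ uL uR := by
  have hgm := hu.glue_measurable
  obtain ⟨N, v', hv', hae⟩ := hv.exists_isKruzhkov
    (hgm.comp (by fun_prop : Measurable fun x : ℝ => ((0 : ℝ), x))) (fun x => hu.glue_bound (0, x))
  refine hae.symm.trans ?_
  set B := max M N with hB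
  have hv'' := hv'.mono (le_max_right M N)
  have hu' := hu.mono (le_max_left M N)
  have hB0 : 0 ≤ B := (abs_nonneg _).trans (hv''.bound 0)
  set u := glue γ uL uR with hudef
  set S : Set (ℝ × ℝ) := Ioo 0 T ×ˢ univ with hS
  have hSm : MeasurableSet S := measurableSet_Ioo.prod MeasurableSet.univ
  -- The initial term vanishes because the data coincide. The flux is |v' - u| times σ = v' + u, and
  -- |σ| ≤ 2B, so the integrand of the Kato inequality is at most -|v' - u| where the cone function
  -- is positive.
  have key : ∀ n : ℕ, ∀ᵐ p ∂(volume.restrict S),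
      0 < coneTest (T - 1 / ((n : ℝ) + 1)) n (2 * B) p → v' p = u p := by
    intro n
    set ψ := coneTest (T - 1 / ((n : ℝ) + 1)) n (2 * B) with hψdef
    have hψ : IsLipschitzTest T ψ := by
      refine isLipschitzTest_coneTest ?_ (by positivity)
      have : (0 : ℝ) < 1 / ((n : ℝ) + 1) := by positivity
      linarith
    have h := hv''.compare_glue hu' hψ
    simp only [← hudef, sub_self, abs_zero, mul_zero, integral_zero, add_zero] at h
    obtain ⟨k, hk⟩ := hψ.lip
    obtain ⟨R', T'', -, hs'⟩ := hψ.support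
    have hψm : Measurable ψ := hk.continuous.measurable
    have hPm : MeasurableSet {p | 0 < ψ p} := measurableSet_lt measurable_const hψm
    have hint : IntegrableOn (fun p => fderiv ℝ ψ p (1, 0) * |v' p - u p| +
        fderiv ℝ ψ p (0, 1) * (|v' p - u p| * (v' p + u p))) S :=
      integrable_entropy (R := R') hv''.meas hgm hv''.bound hu'.glue_bound
        (fun p => norm_fderiv_le_of_lipschitz ℝ hk) (fun p hp => by
          by_contra hne
          exact absurd (hs' p hne).1 (not_le.2 hp)) S
    have hind : Integrable ({p | 0 < ψ p}.indicator fun p => |v' p - u p|)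
        (volume.restrict S) := by
      refine (integrable_indicator_closedBall R' (2 * B) S).mono' ?_
        (Eventually.of_forall fun p => ?_)
      · exact (((hv''.meas.sub hgm).abs).indicator hPm).aestronglyMeasurable
      · by_cases hp : 0 < ψ p
        · rw [indicator_of_mem (show p ∈ {p | 0 < ψ p} from hp),
            indicator_of_mem (by simpa using (hs' p hp.ne').1), Real.norm_eq_abs, abs_abs]
          exact (abs_sub _ _).trans (by linarith [hv''.bound p, hu'.glue_bound p])
        · rw [indicator_of_notMem (show p ∉ {p | 0 < ψ p} from hp), norm_zero]
          exact indicator_nonneg (fun _ _ => by positivity) p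
    have hle : (∫ p in S, (fderiv ℝ ψ p (1, 0) * |v' p - u p| +
        fderiv ℝ ψ p (0, 1) * (|v' p - u p| * (v' p + u p))))
        ≤ ∫ p in S, -({p | 0 < ψ p}.indicator (fun p => |v' p - u p|) p) := by
      refine integral_mono_ae hint hind.neg ?_
      filter_upwards [ae_restrict_of_ae hψ.ae_differentiableAt, ae_restrict_mem hSm] with p hd hpS
      by_cases hp : 0 < ψ p
      · rw [indicator_of_mem (show p ∈ {p | 0 < ψ p} from hp)]
        have hσ : |v' p + u p| ≤ 2 * B :=
          (abs_add_le _ _).trans (by linarith [hv''.bound p, hu'.glue_bound p])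
        have h1 := fderiv_coneTest_le hpS.1.1 hσ hp hd
        have h2 := mul_le_mul_of_nonneg_right h1 (abs_nonneg (v' p - u p))
        rw [← hψdef] at h2
        linarith
      · rw [indicator_of_notMem (show p ∉ {p | 0 < ψ p} from hp)]
        have h0 : ψ p = 0 := le_antisymm (not_lt.1 hp) (hψ.nonneg p)
        have : IsLocalMin ψ p := Eventually.of_forall fun q => by rw [h0]; exact hψ.nonneg q
        simp [this.fderiv_eq_zero]
    rw [integral_neg] at hle
    have hz : (∫ p in S, {p | 0 < ψ p}.indicator (fun p => |v' p - u p|) p) = 0 :=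
      le_antisymm (by linarith)
        (integral_nonneg fun p => indicator_nonneg (fun _ _ => abs_nonneg _) p)
    rw [integral_eq_zero_iff_of_nonneg
      (fun p => indicator_nonneg (fun _ _ => abs_nonneg _) p) hind] at hz
    filter_upwards [hz] with p hp hpos
    rw [indicator_of_mem (show p ∈ {p | 0 < ψ p} from hpos)] at hp
    exact sub_eq_zero.1 (abs_eq_zero.1 hp)
  -- The sets where these cone functions are positive exhaust the strip: n₁ makes the base wide
  -- enough and n₂ brings the top close enough to T.
  filter_upwards [ae_all_iff.2 key, ae_restrict_mem hSm] with p hp hpS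
  obtain ⟨h0, hT⟩ := hpS.1
  obtain ⟨n₁, hn₁⟩ := exists_nat_gt (|p.2| + (2 * B + 1) * |p.1|)
  obtain ⟨n₂, hn₂⟩ := exists_nat_gt (1 / (T - p.1))
  have hTp : 0 < T - p.1 := by linarith
  refine hp (max n₁ n₂) ?_
  refine lt_max_of_lt_right (lt_min ?_ ?_)
  · have : (n₁ : ℝ) ≤ (max n₁ n₂ : ℕ) := by exact_mod_cast le_max_left _ _
    linarith
  · have : (n₂ : ℝ) ≤ (max n₁ n₂ : ℕ) := by exact_mod_cast le_max_right _ _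
    rw [abs_of_pos h0]
    have h1 : 1 / (((max n₁ n₂ : ℕ) : ℝ) + 1) < T - p.1 := by
      rw [div_lt_iff₀ (by positivity)]
      rw [div_lt_iff₀ hTp] at hn₂
      nlinarith
    linarith

/-! ### Solutions transported along characteristics -/

/-- The foot at time `0` of the characteristic of Burgers' equation through `(t, x)`, `t ∈ [0, 1]`. -/
def foot (w₀ : ℝ → ℝ) (p : ℝ × ℝ) : ℝ :=
  Classical.epsilon fun y => y + 2 * max 0 (min 1 p.1) * w₀ y = p.2

/-- The solution of Burgers' equation that transports `w₀` along characteristics. -/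
def evolve (w₀ : ℝ → ℝ) (p : ℝ × ℝ) : ℝ := w₀ (foot w₀ p)

/-- For t ≤ 1 and slope at most 1/8 the map y ↦ x - 2t·w₀(y) contracts with factor 1/4, and its
fixed point is the foot. The same factor gives uniqueness in `foot_unique`: characteristics do not
cross up to time 1. -/
theorem exists_foot {w₀ : ℝ → ℝ} (h : ∀ y z, |w₀ y - w₀ z| ≤ 1 / 8 * |y - z|) {t : ℝ}
    (ht : t ∈ Icc (0 : ℝ) 1) (x : ℝ) : ∃ y, y + 2 * t * w₀ y = x := by
  have hc : ContractingWith (1 / 4) fun y => x - 2 * t * w₀ y := by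
    refine ⟨by rw [← NNReal.coe_lt_coe]; norm_num, LipschitzWith.of_dist_le_mul fun y z => ?_⟩
    rw [Real.dist_eq, Real.dist_eq,
      show x - 2 * t * w₀ y - (x - 2 * t * w₀ z) = -(2 * t * (w₀ y - w₀ z)) by ring, abs_neg, abs_mul,
      abs_of_nonneg (by linarith [ht.1] : 0 ≤ 2 * t)]
    have h1 := h y z
    have h2 : 2 * t * |w₀ y - w₀ z| ≤ 2 * (1 / 8 * |y - z|) :=
      mul_le_mul (by linarith [ht.2]) h1 (abs_nonneg _) (by norm_num)
    push_cast
    linarith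
  refine ⟨hc.fixedPoint _, ?_⟩
  have := hc.fixedPoint_isFixedPt
  unfold Function.IsFixedPt at this
  linarith

theorem foot_unique {w₀ : ℝ → ℝ} (h : ∀ y z, |w₀ y - w₀ z| ≤ 1 / 8 * |y - z|) {t : ℝ}
    (ht : t ∈ Icc (0 : ℝ) 1) {y z : ℝ} (hyz : y + 2 * t * w₀ y = z + 2 * t * w₀ z) : y = z := by
  have h1 : |y - z| ≤ 1 / 4 * |y - z| := by
    have e : y - z = 2 * t * (w₀ z - w₀ y) := by linarith
    have h2 : |y - z| = 2 * t * |w₀ z - w₀ y| := by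
      conv_lhs => rw [e]
      rw [abs_mul, abs_of_nonneg (by linarith [ht.1])]
    rw [h2, abs_sub_comm (w₀ z)]
    rw [abs_sub_comm (w₀ z)] at h2
    have h3 := h y z
    have h4 : 2 * t * |w₀ y - w₀ z| ≤ 2 * |w₀ y - w₀ z| :=
      mul_le_mul_of_nonneg_right (by linarith [ht.2]) (abs_nonneg _)
    linarith
  have h2 : |y - z| = 0 := le_antisymm (by linarith [abs_nonneg (y - z)]) (abs_nonneg _)
  exact sub_eq_zero.1 (abs_eq_zero.1 h2)

theorem clamp_mem (t : ℝ) : max 0 (min 1 t) ∈ Icc (0 : ℝ) 1 :=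
  ⟨le_max_left _ _, max_le zero_le_one (min_le_left _ _)⟩

theorem clamp_eq {t : ℝ} (ht : t ∈ Icc (0 : ℝ) 1) : max 0 (min 1 t) = t := by
  rw [min_eq_right ht.2, max_eq_right ht.1]

theorem abs_clamp_sub_le (a b s t : ℝ) :
    |max a (min b s) - max a (min b t)| ≤ |s - t| := by
  have h1 := abs_max_sub_max_le_max a (min b s) a (min b t)
  have h2 := abs_min_sub_min_le_max b s b t
  have h3 : (0 : ℝ) ≤ |min b s - min b t| := abs_nonneg _
  have h4 : (0 : ℝ) ≤ |s - t| := abs_nonneg _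
  rw [sub_self, abs_zero, max_eq_right h3] at h1
  rw [sub_self, abs_zero, max_eq_right h4] at h2
  exact h1.trans h2

theorem foot_spec {w₀ : ℝ → ℝ} (h : ∀ y z, |w₀ y - w₀ z| ≤ 1 / 8 * |y - z|) (p : ℝ × ℝ) :
    foot w₀ p + 2 * max 0 (min 1 p.1) * w₀ (foot w₀ p) = p.2 :=
  Classical.epsilon_spec (exists_foot h (clamp_mem p.1) p.2)

theorem evolve_eq {w₀ : ℝ → ℝ} (h : ∀ y z, |w₀ y - w₀ z| ≤ 1 / 8 * |y - z|) {t x y : ℝ}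
    (ht : t ∈ Icc (0 : ℝ) 1) (hy : y + 2 * t * w₀ y = x) : evolve w₀ (t, x) = w₀ y := by
  have h1 := foot_spec h (t, x)
  simp only [clamp_eq ht] at h1
  unfold evolve
  rw [foot_unique h ht (h1.trans hy.symm)]

theorem evolve_zero {w₀ : ℝ → ℝ} (h : ∀ y z, |w₀ y - w₀ z| ≤ 1 / 8 * |y - z|) (x : ℝ) :
    evolve w₀ (0, x) = w₀ x :=
  evolve_eq h ⟨le_rfl, zero_le_one⟩ (by ring)

theorem isLipschitzSolution_evolve {w₀ : ℝ → ℝ} (h : ∀ y z, |w₀ y - w₀ z| ≤ 1 / 8 * |y - z|)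
    {M : ℝ} (hM : ∀ y, |w₀ y| ≤ M) : IsLipschitzSolution 1 M (evolve w₀) := by
  have hM0 : 0 ≤ M := (abs_nonneg _).trans (hM 0)
  refine ⟨⟨⟨1 + 2 * M, by positivity⟩, LipschitzWith.of_dist_le_mul fun p q => ?_⟩,
    fun p => hM _, fun p hp hd => ?_⟩
  · have e1 := foot_spec h p
    have e2 := foot_spec h q
    set y := foot w₀ p with hy
    set z := foot w₀ q with hz
    set s := max 0 (min 1 p.1) with hs
    set t := max 0 (min 1 q.1) with ht
    have hst : |s - t| ≤ |p.1 - q.1| := abs_clamp_sub_le 0 1 p.1 q.1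
    have ht01 : s ∈ Icc (0 : ℝ) 1 := clamp_mem p.1
    have e3 : y - z = (p.2 - q.2) - 2 * s * (w₀ y - w₀ z) - 2 * (s - t) * w₀ z := by
      rw [← e1, ← e2]; ring
    have h1 : |y - z| ≤ |p.2 - q.2| + 2 * |w₀ y - w₀ z| + 2 * |p.1 - q.1| * M := by
      calc |y - z| = |(p.2 - q.2) - 2 * s * (w₀ y - w₀ z) - 2 * (s - t) * w₀ z| := by rw [← e3]
        _ ≤ |(p.2 - q.2) - 2 * s * (w₀ y - w₀ z)| + |2 * (s - t) * w₀ z| := abs_sub _ _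
        _ ≤ |p.2 - q.2| + |2 * s * (w₀ y - w₀ z)| + |2 * (s - t) * w₀ z| := by
            gcongr; exact abs_sub _ _
        _ ≤ _ := by
            rw [abs_mul, abs_mul, abs_mul, abs_mul, abs_two, abs_of_nonneg ht01.1]
            gcongr
            · nlinarith [abs_nonneg (w₀ y - w₀ z), ht01.2]
            · exact hM z
    -- The term 2|w₀ y - w₀ z| in the bound for |y - z| is absorbed on the left, since the slope 1/8
    -- returns only a quarter of it. Clamping the time makes the estimate global in the plane.
    have h2 := h y z
    have h3 : |p.1 - q.1| ≤ dist p q := by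
      rw [Prod.dist_eq]; exact le_max_left _ _
    have h4 : |p.2 - q.2| ≤ dist p q := by
      rw [Prod.dist_eq]; exact le_max_right _ _
    have h5 : |p.1 - q.1| * M ≤ dist p q * M := mul_le_mul_of_nonneg_right h3 hM0
    have h6 : 0 ≤ dist p q * M := mul_nonneg dist_nonneg hM0
    have h7 : (0 : ℝ) ≤ dist p q := dist_nonneg
    change |w₀ y - w₀ z| ≤ (1 + 2 * M) * dist p q
    nlinarith
  -- This is the direction of the characteristic through p. The solution is constant along it near
  -- p, and the vanishing of that directional derivative is the equation.
  · set e : ℝ × ℝ := (1, 2 * evolve w₀ p) with he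
    have hline : HasDerivAt (fun s : ℝ => evolve w₀ (p + s • e)) (fderiv ℝ (evolve w₀) p e) 0 :=
      hd.hasFDerivAt.hasLineDerivAt e
    have hev : (fun s : ℝ => evolve w₀ (p + s • e)) =ᶠ[𝓝 0] fun _ => evolve w₀ p := by
      have hnhds : Ioo (-p.1) (1 - p.1) ∈ 𝓝 (0 : ℝ) :=
        Ioo_mem_nhds (by linarith [hp.1.1]) (by linarith [hp.1.2])
      filter_upwards [hnhds] with s hs
      have h0 := foot_spec h p
      rw [clamp_eq ⟨hp.1.1.le, hp.1.2.le⟩] at h0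
      have h1 : p + s • e = (p.1 + s, p.2 + s * (2 * evolve w₀ p)) := by
        ext <;> simp [he]
      rw [h1]
      refine evolve_eq h ⟨by linarith [hs.1], by linarith [hs.2]⟩ ?_
      rw [← h0]
      unfold evolve
      ring
    have h0 : fderiv ℝ (evolve w₀) p e = 0 :=
      hline.unique ((hasDerivAt_const (0 : ℝ) (evolve w₀ p)).congr_of_eventuallyEq hev)
    have h1 : e = (1, 0) + (2 * evolve w₀ p) • ((0 : ℝ), (1 : ℝ)) := by simp [he]
    rw [h1, map_add, map_smul, smul_eq_mul] at h0
    exact h0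

/-! ### The oscillating profile and the shock curve -/

/-- A flat oscillating profile. -/
def profile (s : ℝ) : ℝ := s ^ 4 * Real.sin (Real.pi / s) / 1000

/-- The derivative of `profile`. -/
def profileDeriv (s : ℝ) : ℝ :=
  (4 * s ^ 3 * Real.sin (Real.pi / s) - Real.pi * s ^ 2 * Real.cos (Real.pi / s)) / 1000

theorem hasDerivAt_pi_div {s : ℝ} (hs : s ≠ 0) :
    HasDerivAt (fun s => Real.pi / s) (-Real.pi / s ^ 2) s := by
  have := (hasDerivAt_inv hs).const_mul Real.pi
  simpa only [div_eq_mul_inv, mul_neg, neg_mul] using this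

theorem hasDerivAt_profile {s : ℝ} (hs : s ≠ 0) : HasDerivAt profile (profileDeriv s) s := by
  have h1 := ((hasDerivAt_pow 4 s).mul (hasDerivAt_pi_div hs).sin).div_const 1000
  refine HasDerivAt.congr_deriv (f := profile) h1 ?_
  unfold profileDeriv
  simp only [Nat.cast_ofNat, Nat.reduceSub]
  field_simp
  ring

/-- The power 4 is chosen so that this expression stays bounded near 0; with a cube the last term
would be of order 1/s. The left state 1 + γ' is then Lipschitz up to the final time. -/
theorem hasDerivAt_profileDeriv {s : ℝ} (hs : s ≠ 0) :
    HasDerivAt profileDeriv ((12 * s ^ 2 * Real.sin (Real.pi / s)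
      - 6 * Real.pi * s * Real.cos (Real.pi / s) - Real.pi ^ 2 * Real.sin (Real.pi / s)) / 1000) s := by
  have h1 := ((((hasDerivAt_pow 3 s).const_mul 4).mul (hasDerivAt_pi_div hs).sin).sub
    (((hasDerivAt_pow 2 s).const_mul Real.pi).mul (hasDerivAt_pi_div hs).cos)).div_const 1000
  refine HasDerivAt.congr_deriv (f := profileDeriv) h1 ?_
  simp only [Nat.cast_ofNat, Nat.reduceSub, pow_one]
  field_simp
  ring

theorem abs_profileDeriv_le {s : ℝ} (hs : s ∈ Icc (0 : ℝ) 1) : |profileDeriv s| ≤ s / 100 := by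
  have hpi := Real.pi_lt_d2
  have hpi0 := Real.pi_pos
  obtain ⟨h0, h1⟩ := hs
  have s2 : s ^ 2 ≤ s := by nlinarith
  have s3 : s ^ 3 ≤ s := by nlinarith
  unfold profileDeriv
  rw [abs_div, abs_of_pos (by norm_num : (0 : ℝ) < 1000)]
  have a1 : |4 * s ^ 3 * Real.sin (Real.pi / s)| ≤ 4 * s := by
    rw [abs_mul, abs_of_nonneg (by positivity)]
    have := mul_le_mul_of_nonneg_left (Real.abs_sin_le_one (Real.pi / s))
      (by positivity : 0 ≤ 4 * s ^ 3)
    linarith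
  have a2 : |Real.pi * s ^ 2 * Real.cos (Real.pi / s)| ≤ 4 * s := by
    rw [abs_mul, abs_of_nonneg (by positivity)]
    have := mul_le_mul_of_nonneg_left (Real.abs_cos_le_one (Real.pi / s))
      (by positivity : 0 ≤ Real.pi * s ^ 2)
    nlinarith
  have := (abs_sub (4 * s ^ 3 * Real.sin (Real.pi / s))
    (Real.pi * s ^ 2 * Real.cos (Real.pi / s)))
  rw [div_le_iff₀ (by norm_num)]
  linarith

theorem abs_profile_le {s : ℝ} (hs : s ∈ Icc (0 : ℝ) 1) : |profile s| ≤ s / 100 := by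
  obtain ⟨h0, h1⟩ := hs
  unfold profile
  rw [abs_div, abs_of_pos (by norm_num : (0 : ℝ) < 1000), abs_mul, abs_of_nonneg (by positivity)]
  have := mul_le_mul_of_nonneg_left (Real.abs_sin_le_one (Real.pi / s)) (by positivity : 0 ≤ s ^ 4)
  have h4 : s ^ 4 ≤ s := by nlinarith [mul_nonneg h0 h0, pow_le_one₀ (n := 3) h0 h1]
  rw [div_le_iff₀ (by norm_num)]
  linarith

/-- A function on `[0, 1]` with bounded derivative off `0` and linear growth at `0` is Lipschitz. -/
theorem abs_sub_le_of_hasDerivAt {f f' : ℝ → ℝ} {C : ℝ} (hf : ∀ s ≠ 0, HasDerivAt f (f' s) s)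
    (hf' : ∀ s ∈ Icc (0 : ℝ) 1, |f' s| ≤ C) (h0 : f 0 = 0) (hg : ∀ s ∈ Icc (0 : ℝ) 1, |f s| ≤ C * s)
    {s t : ℝ} (hs : s ∈ Icc (0 : ℝ) 1) (ht : t ∈ Icc (0 : ℝ) 1) : |f s - f t| ≤ C * |s - t| := by
  rcases hs.1.eq_or_lt with rfl | hs0
  · rw [h0, zero_sub, zero_sub, abs_neg, abs_neg, abs_of_nonneg ht.1]; exact hg t ht
  rcases ht.1.eq_or_lt with rfl | ht0
  · rw [h0, sub_zero, sub_zero, abs_of_nonneg hs.1]; exact hg s hs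
  exact (convex_Ioc (0 : ℝ) 1).norm_image_sub_le_of_norm_hasDerivWithin_le
    (fun x hx => (hf x hx.1.ne').hasDerivWithinAt) (fun x hx => hf' x ⟨hx.1.le, hx.2⟩)
    ⟨ht0, ht.2⟩ ⟨hs0, hs.2⟩

theorem abs_profile_sub_le {s t : ℝ} (hs : s ∈ Icc (0 : ℝ) 1) (ht : t ∈ Icc (0 : ℝ) 1) :
    |profile s - profile t| ≤ 1 / 100 * |s - t| :=
  abs_sub_le_of_hasDerivAt (fun _ h => hasDerivAt_profile h)
    (fun s hs => (abs_profileDeriv_le hs).trans (by linarith [hs.2])) (by simp [profile])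
    (fun s hs => (abs_profile_le hs).trans (by linarith)) hs ht

/-- The second derivative is at most (12 + 20 + 10)/1000 on (0, 1]. The constant 1/20 leaves room
below the slope 1/8 allowed for transported data. -/
theorem abs_profileDeriv_sub_le {s t : ℝ} (hs : s ∈ Icc (0 : ℝ) 1) (ht : t ∈ Icc (0 : ℝ) 1) :
    |profileDeriv s - profileDeriv t| ≤ 1 / 20 * |s - t| := by
  refine abs_sub_le_of_hasDerivAt (fun _ h => hasDerivAt_profileDeriv h) (fun s hs => ?_)
    (by simp [profileDeriv])
    (fun s hs => (abs_profileDeriv_le hs).trans (by linarith [hs.1])) hs ht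
  have hpi := Real.pi_lt_d2
  have hpi0 := Real.pi_pos
  obtain ⟨h0, h1⟩ := hs
  rw [abs_div, abs_of_pos (by norm_num : (0 : ℝ) < 1000), div_le_iff₀ (by norm_num)]
  have b1 := Real.abs_sin_le_one (Real.pi / s)
  have b2 := Real.abs_cos_le_one (Real.pi / s)
  have a1 : |12 * s ^ 2 * Real.sin (Real.pi / s)| ≤ 12 := by
    rw [abs_mul, abs_of_nonneg (by positivity)]
    have := mul_le_mul_of_nonneg_left b1 (by positivity : 0 ≤ 12 * s ^ 2)
    nlinarith
  have a2 : |6 * Real.pi * s * Real.cos (Real.pi / s)| ≤ 20 := by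
    rw [abs_mul, abs_of_nonneg (by positivity)]
    have := mul_le_mul_of_nonneg_left b2 (by positivity : 0 ≤ 6 * Real.pi * s)
    nlinarith
  have a3 : |Real.pi ^ 2 * Real.sin (Real.pi / s)| ≤ 10 := by
    rw [abs_mul, abs_of_nonneg (by positivity)]
    have := mul_le_mul_of_nonneg_left b1 (by positivity : 0 ≤ Real.pi ^ 2)
    nlinarith
  have c1 := abs_sub (12 * s ^ 2 * Real.sin (Real.pi / s)
      - 6 * Real.pi * s * Real.cos (Real.pi / s)) (Real.pi ^ 2 * Real.sin (Real.pi / s))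
  have c2 := abs_sub (12 * s ^ 2 * Real.sin (Real.pi / s))
      (6 * Real.pi * s * Real.cos (Real.pi / s))
  linarith

/-- The oscillating shock curve. -/
def oscCurve (t : ℝ) : ℝ := profile (1 - max 0 (min 1 t))

theorem exists_lipschitzWith_oscCurve : ∃ K, LipschitzWith K oscCurve := by
  refine ⟨1, LipschitzWith.of_dist_le_mul fun s t => ?_⟩
  have hm : ∀ t, 1 - max 0 (min 1 t) ∈ Icc (0 : ℝ) 1 := fun t =>
    ⟨by linarith [(clamp_mem t).2], by linarith [(clamp_mem t).1]⟩
  have h1 := abs_profile_sub_le (hm s) (hm t)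
  have h2 := abs_clamp_sub_le 0 1 t s
  rw [show 1 - max 0 (min 1 s) - (1 - max 0 (min 1 t)) = max 0 (min 1 t) - max 0 (min 1 s) by ring]
    at h1
  rw [Real.dist_eq, Real.dist_eq, NNReal.coe_one, one_mul]
  rw [abs_sub_comm t s] at h2
  unfold oscCurve
  linarith [abs_nonneg (s - t)]

theorem oscCurve_eq {t : ℝ} (ht : t ∈ Icc (0 : ℝ) 1) : oscCurve t = profile (1 - t) := by
  unfold oscCurve; rw [clamp_eq ht]

theorem hasDerivAt_oscCurve {t : ℝ} (ht : t ∈ Ioo (0 : ℝ) 1) :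
    HasDerivAt oscCurve (-profileDeriv (1 - t)) t := by
  have h1 : HasDerivAt (fun t => profile (1 - t)) (-profileDeriv (1 - t)) t := by
    have := HasDerivAt.comp (h₂ := profile) t
      (hasDerivAt_profile (by linarith [ht.2] : 1 - t ≠ 0)) ((hasDerivAt_id t).const_sub 1)
    rwa [mul_neg_one] at this
  refine h1.congr_of_eventuallyEq ?_
  filter_upwards [Ioo_mem_nhds ht.1 ht.2] with s hs
  exact oscCurve_eq ⟨hs.1.le, hs.2.le⟩

theorem abs_oscCurve_le (t : ℝ) : |oscCurve t| ≤ 1 / 100 := by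
  have h := clamp_mem t
  exact (abs_profile_le ⟨by linarith [h.2], by linarith [h.1]⟩).trans (by linarith [h.1])

theorem contDiffOn_oscCurve : ContDiffOn ℝ 1 oscCurve (Ioo 0 1) := by
  rw [contDiffOn_one_iff_derivWithin (uniqueDiffOn_Ioo 0 1)]
  refine ⟨fun t ht => (hasDerivAt_oscCurve ht).differentiableAt.differentiableWithinAt, ?_⟩
  have h : ContinuousOn (fun t => -profileDeriv (1 - t)) (Ioo 0 1) := by
    intro t ht
    have h1 : ContinuousAt profileDeriv (1 - t) :=
      (hasDerivAt_profileDeriv (by linarith [ht.2] : 1 - t ≠ 0)).continuousAt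
    exact (ContinuousAt.comp (f := fun t => 1 - t) h1
      (by fun_prop)).neg.continuousWithinAt
  refine h.congr fun t ht => ?_
  rw [derivWithin_of_isOpen isOpen_Ioo ht, (hasDerivAt_oscCurve ht).deriv]

/-! ### Data with prescribed values along the curve -/

/-- Initial data whose evolution has the value `1 + γ'(t)` along the curve `x = γ(t)`. -/
theorem exists_core_data : ∃ w : ℝ → ℝ, (∀ y z, |w y - w z| ≤ 1 / 8 * |y - z|) ∧
    (∀ y, 1 / 2 ≤ w y ∧ w y ≤ 3 / 2) ∧ (∀ y ≤ -2, w y = 1) ∧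
    ∀ t ∈ Icc (0 : ℝ) 1, ∃ y ∈ Icc (-2 : ℝ) 0,
      y + 2 * t * w y = oscCurve t ∧ w y = 1 - profileDeriv (1 - t) := by
  set A : ℝ → ℝ := fun τ => 1 - profileDeriv (1 - τ) with hA
  -- Foot of the characteristic that reaches the curve at time τ carrying the value A(τ) = 1 +
  -- γ'(τ).
  set Y : ℝ → ℝ := fun τ => profile (1 - τ) - 2 * τ * A τ with hY
  have hm : ∀ {t : ℝ}, t ∈ Icc (0 : ℝ) 1 → 1 - t ∈ Icc (0 : ℝ) 1 := fun ht =>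
    ⟨by linarith [ht.2], by linarith [ht.1]⟩
  have hAl : ∀ s ∈ Icc (0 : ℝ) 1, ∀ t ∈ Icc (0 : ℝ) 1, |A s - A t| ≤ 1 / 20 * |s - t| := by
    intro s hs t ht
    have := abs_profileDeriv_sub_le (hm ht) (hm hs)
    rw [show A s - A t = profileDeriv (1 - t) - profileDeriv (1 - s) by simp only [hA]; ring]
    rwa [show 1 - t - (1 - s) = s - t by ring] at this
  have hAb : ∀ s ∈ Icc (0 : ℝ) 1, |A s - 1| ≤ 1 / 100 := by
    intro s hs
    have := abs_profileDeriv_le (hm hs)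
    rw [show A s - 1 = -profileDeriv (1 - s) by simp only [hA]; ring, abs_neg]
    linarith [hs.1]
  -- Y falls at rate at least 2·(99/100) - 1/100 - 2/20 > 1: the main part is the transport 2τA,
  -- while γ and the variation of A contribute little.
  have hYm : ∀ s ∈ Icc (0 : ℝ) 1, ∀ t ∈ Icc (0 : ℝ) 1, s ≤ t → t - s ≤ Y s - Y t := by
    intro s hs t ht hst
    have h1 := abs_le.1 (hAl s hs t ht)
    have h2 := abs_le.1 (hAb s hs)
    have h3 := abs_le.1 (abs_profile_sub_le (hm hs) (hm ht))
    rw [show 1 - s - (1 - t) = t - s by ring, abs_of_nonneg (by linarith)] at h3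
    rw [abs_sub_comm, abs_of_nonneg (by linarith)] at h1
    have e : Y s - Y t = (profile (1 - s) - profile (1 - t)) + 2 * (t - s) * A s
        - 2 * t * (A s - A t) := by simp only [hY]; ring
    have h4 : (t - s) * (99 / 100) ≤ (t - s) * A s :=
      mul_le_mul_of_nonneg_left (by linarith) (by linarith)
    have h5 : t * (A s - A t) ≤ 1 / 20 * (t - s) := by
      have h6 : t * (A s - A t) ≤ t * (1 / 20 * (t - s)) := mul_le_mul_of_nonneg_left h1.2 ht.1
      have h7 : t * (1 / 20 * (t - s)) ≤ 1 * (1 / 20 * (t - s)) :=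
        mul_le_mul_of_nonneg_right ht.2 (by linarith)
      linarith
    rw [e]
    linarith
  have hYd : ∀ s ∈ Icc (0 : ℝ) 1, ∀ t ∈ Icc (0 : ℝ) 1, |s - t| ≤ |Y s - Y t| := by
    intro s hs t ht
    rcases le_total s t with h | h
    · have := hYm s hs t ht h
      rw [abs_sub_comm, abs_of_nonneg (by linarith)]
      exact this.trans (le_abs_self _)
    · have := hYm t ht s hs h
      rw [abs_of_nonneg (by linarith), abs_sub_comm]
      exact this.trans (le_abs_self _)
  have hinj : InjOn Y (Icc 0 1) := by
    intro s hs t ht hst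
    have := hYd s hs t ht
    rw [hst, sub_self, abs_zero] at this
    exact sub_eq_zero.1 (abs_eq_zero.1 (le_antisymm this (abs_nonneg _)))
  -- The inverse of Y is 1-Lipschitz on the set of feet, so the data inherit the constant 1/20 of A
  -- and extend to the whole line.
  have hlip : LipschitzOnWith (1 / 20) (fun z => A (Function.invFunOn Y (Icc 0 1) z))
      (Y '' Icc 0 1) := by
    refine LipschitzOnWith.of_dist_le_mul ?_
    rintro _ ⟨s, hs, rfl⟩ _ ⟨t, ht, rfl⟩
    simp only [hinj.leftInvOn_invFunOn hs, hinj.leftInvOn_invFunOn ht]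
    rw [Real.dist_eq, Real.dist_eq]
    have h1 := hAl s hs t ht
    have h2 := hYd s hs t ht
    push_cast
    linarith
  obtain ⟨F, hF, hFe⟩ := hlip.extend_real
  have hFA : ∀ t ∈ Icc (0 : ℝ) 1, F (Y t) = A t := by
    intro t ht
    rw [← hFe (mem_image_of_mem Y ht)]
    simp only [hinj.leftInvOn_invFunOn ht]
  have i0 : (0 : ℝ) ∈ Icc (0 : ℝ) 1 := ⟨le_rfl, zero_le_one⟩
  have i1 : (1 : ℝ) ∈ Icc (0 : ℝ) 1 := ⟨zero_le_one, le_rfl⟩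
  have A1 : A 1 = 1 := by simp [hA, profileDeriv]
  have Y0 : Y 0 = 0 := by simp [hY, profile]
  have Y1 : Y 1 = -2 := by simp [hY, A1, profile]
  have hYr : ∀ t ∈ Icc (0 : ℝ) 1, Y t ∈ Icc (-2 : ℝ) 0 := by
    intro t ht
    have a := hYm 0 i0 t ht ht.1
    have b := hYm t ht 1 i1 ht.2
    exact ⟨by linarith [ht.2], by linarith [ht.1]⟩
  -- The extension is frozen outside [-2, 0] and truncated to [1/2, 3/2]. On the feet this changes
  -- nothing, since they lie in [-2, 0] and |A - 1| ≤ 1/100; to the left of Y(1) = -2 it yields the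
  -- constant A(1) = 1.
  refine ⟨fun y => max (1 / 2) (min (3 / 2) (F (max (-2) (min 0 y)))), fun y z => ?_, fun y => ?_,
    fun y hy => ?_, fun t ht => ⟨Y t, hYr t ht, ?_⟩⟩
  · refine (abs_clamp_sub_le _ _ _ _).trans ?_
    have h1 := hF.dist_le_mul (max (-2) (min 0 y)) (max (-2) (min 0 z))
    have h2 := abs_clamp_sub_le (-2) 0 y z
    rw [Real.dist_eq, Real.dist_eq] at h1
    push_cast at h1
    linarith [abs_nonneg (y - z)]
  · exact ⟨le_max_left _ _, max_le (by norm_num) (min_le_left _ _)⟩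
  · simp only
    rw [min_eq_right (by linarith : y ≤ 0), max_eq_left hy, ← Y1, hFA 1 i1, A1]
    norm_num
  · have hb := abs_le.1 (hAb t ht)
    have hw : max (1 / 2) (min (3 / 2) (F (max (-2) (min 0 (Y t))))) = A t := by
      rw [min_eq_right (hYr t ht).2, max_eq_right (hYr t ht).1, hFA t ht,
        min_eq_right (by linarith), max_eq_right (by linarith)]
    simp only [hw]
    refine ⟨?_, rfl⟩
    rw [oscCurve_eq ht]
    simp only [hY]
    ring

/-! ### Bounded variation of the data -/

theorem essTotVar_le (g : ℝ → ℝ) (s : Set ℝ) : essTotVar g s ≤ eVariationOn g s :=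
  iInf₂_le (f := fun (h : ℝ → ℝ) (_ : h =ᵐ[volume.restrict s] g) => eVariationOn h s) g
    EventuallyEq.rfl

theorem memBV_const (c a b : ℝ) : MemBV (fun _ => c) (Ioo a b) := by
  refine ⟨integrableOn_const (by simp), (essTotVar_le _ _).trans_lt ?_⟩
  have : eVariationOn (fun _ : ℝ => c) (Ioo a b) = 0 :=
    eVariationOn.constant_on (by rintro _ ⟨x, -, rfl⟩ _ ⟨y, -, rfl⟩; rfl)
  rw [this]
  exact ENNReal.zero_lt_top

/-- A function with two Lipschitz pieces that is constant far away has bounded variation. -/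
theorem memBV_of_pieces {f g u : ℝ → ℝ} {L : ℝ} (hL : 0 ≤ L)
    (hf : ∀ y z, |f y - f z| ≤ 1 / 8 * |y - z|) (hg : ∀ y z, |g y - g z| ≤ 1 / 8 * |y - z|)
    (hfM : ∀ y, |f y| ≤ 2) (hgM : ∀ y, |g y| ≤ 2) (hf0 : ∀ y ≤ -L, f y = 0) (hg0 : ∀ y, L ≤ y → g y = 0)
    (hu : ∀ x, u x = if x ≤ 0 then f x else g x) (hum : Measurable u) :
    IntegrableOn u univ ∧ eVariationOn u univ < ⊤ := by
  constructor
  · have huM : ∀ x, |u x| ≤ 2 := fun x => by rw [hu]; split_ifs; exacts [hfM x, hgM x]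
    have := integrable_initial (R := L) (D := 2) (M := 1) hum (measurable_const (a := (1 : ℝ)))
      (fun _ => by simp) huM fun x hx => by
        rw [hu]
        split_ifs with h
        · rw [abs_of_nonpos h] at hx
          exact hf0 x (by linarith)
        · rw [abs_of_nonneg (by linarith)] at hx
          exact hg0 x hx.le
    rw [integrableOn_univ]
    simpa only [mul_one] using this
  -- The function factors as G ∘ m. The monotone map m clamps to [-L, L] and opens a gap of length 1
  -- at the origin, so that G may be Lipschitz off the gap in spite of the jump.
  · set m : ℝ → ℝ := fun x => if x ≤ 0 then max (-L) x else 1 + min x L with hm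
    set G : ℝ → ℝ := fun s => if s ≤ 0 then f s else g (s - 1) with hG
    have hmm : Monotone m := by
      intro x y hxy
      simp only [hm]
      split_ifs with h1 h2 h2
      · exact max_le_max le_rfl hxy
      · have : 0 ≤ min y L := le_min (by linarith) hL
        have h3 : max (-L) x ≤ 0 := max_le (by linarith) h1
        linarith
      · linarith
      · have := min_le_min hxy (le_refl L)
        linarith
    have hma : ∀ x, -L ≤ m x := by
      intro x
      simp only [hm]
      split_ifs with h1
      · exact le_max_left _ _
      · have : 0 ≤ min x L := le_min (by linarith) hL
        linarith
    have hmb : ∀ x, m x ≤ 1 + L := by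
      intro x
      simp only [hm]
      split_ifs with h1
      · exact max_le (by linarith) (by linarith)
      · linarith [min_le_right x L]
    have hGm : u = G ∘ m := by
      funext x
      rw [hu]
      simp only [hG, hm, Function.comp]
      by_cases h1 : x ≤ 0
      · simp only [if_pos h1]
        rw [if_pos (max_le (by linarith) h1)]
        rcases le_total x (-L) with h2 | h2
        · rw [max_eq_left h2, hf0 x h2, hf0 _ le_rfl]
        · rw [max_eq_right h2]
      · simp only [if_neg h1]
        have : 0 ≤ min x L := le_min (by linarith) hL
        rw [if_neg (by linarith)]
        rcases le_total x L with h2 | h2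
        · rw [min_eq_left h2]; ring_nf
        · rw [min_eq_right h2, hg0 x h2, hg0 _ (by linarith)]
    have hGl : LipschitzOnWith 4 G {s | s ≤ 0 ∨ 1 ≤ s} := by
      refine LipschitzOnWith.of_dist_le_mul ?_
      -- Values on the two sides of the gap differ by at most 4, and the arguments by at least 1.
      have cross : ∀ s t : ℝ, s ≤ 0 → 1 ≤ t → |f s - g (t - 1)| ≤ 4 * |s - t| := by
        intro s t hs ht
        have h1 := abs_sub (f s) (g (t - 1))
        rw [abs_of_nonpos (by linarith : s - t ≤ 0)]
        linarith [hfM s, hgM (t - 1)]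
      intro s hs t ht
      rw [Real.dist_eq, Real.dist_eq]
      simp only [hG]
      push_cast
      split_ifs with h1 h2 h2
      · linarith [hf s t, abs_nonneg (s - t)]
      · exact cross s t h1 (ht.resolve_left h2)
      · rw [abs_sub_comm, abs_sub_comm s]
        exact cross t s h2 (hs.resolve_left h1)
      · have := hg (s - 1) (t - 1)
        rw [show s - 1 - (t - 1) = s - t by ring] at this
        linarith [abs_nonneg (s - t)]
    have hmaps : MapsTo m univ {s | s ≤ 0 ∨ 1 ≤ s} := by
      intro x _
      simp only [hm]
      split_ifs with h1
      · exact Or.inl (max_le (by linarith) h1)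
      · have : 0 ≤ min x L := le_min (by linarith) hL
        exact Or.inr (by linarith)
    rw [hGm]
    have hb : ∀ x ∈ univ, |m x| ≤ 1 + L := fun x _ => abs_le.2 ⟨by linarith [hma x], hmb x⟩
    exact (hGl.comp_boundedVariationOn hmaps ((hmm.monotoneOn _).boundedVariationOn hb)).lt_top

/-! ### Sign changes of the curve and infinite variation on the axis -/

/-- The sign of the profile between consecutive zeros. -/
theorem profile_sign {m : ℕ} (hm : 1 ≤ m) {s : ℝ} (h1 : 1 / ((m : ℝ) + 1) < s) (h2 : s < 1 / m) :
    0 < (-1) ^ m * profile s := by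
  have hm0 : (0 : ℝ) < m := by exact_mod_cast hm
  have hs : 0 < s := lt_trans (by positivity) h1
  have hpi := Real.pi_pos
  have a1 : m * Real.pi < Real.pi / s := by
    rw [lt_div_iff₀ hs]
    rw [lt_div_iff₀ hm0] at h2
    nlinarith
  have a2 : Real.pi / s < (m + 1) * Real.pi := by
    rw [div_lt_iff₀ hs]
    rw [div_lt_iff₀ (by positivity)] at h1
    nlinarith
  -- Shifting by mπ brings the argument into (0, π) and multiplies the sine by (-1)^m.
  have h3 : 0 < Real.sin (Real.pi / s - m * Real.pi) :=
    Real.sin_pos_of_pos_of_lt_pi (by linarith) (by linarith)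
  rw [Real.sin_sub_nat_mul_pi] at h3
  unfold profile
  have : (-1 : ℝ) ^ m * (s ^ 4 * Real.sin (Real.pi / s) / 1000)
      = s ^ 4 / 1000 * ((-1) ^ m * Real.sin (Real.pi / s)) := by ring
  rw [this]
  positivity

theorem oscCurve_sign {m : ℕ} (hm : 1 ≤ m) {t : ℝ} (h1 : 1 - 1 / (m : ℝ) < t)
    (h2 : t < 1 - 1 / ((m : ℝ) + 1)) : t ∈ Ioo (0 : ℝ) 1 ∧ 0 < (-1) ^ m * oscCurve t := by
  have hm1 : (1 : ℝ) ≤ m := by exact_mod_cast hm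
  have h3 : 1 / (m : ℝ) ≤ 1 := by rw [div_le_one (by linarith)]; exact hm1
  have h4 : 0 < 1 / ((m : ℝ) + 1) := by positivity
  have ht : t ∈ Ioo (0 : ℝ) 1 := ⟨by linarith, by linarith⟩
  rw [oscCurve_eq ⟨ht.1.le, ht.2.le⟩]
  exact ⟨ht, profile_sign hm (by linarith) (by linarith)⟩

/-- The interval between zeros just before 1 - 1/(2k) has the odd index 2k - 1, where the curve is
negative; the one just after has the even index 2k, where it is positive. -/
theorem crossesZeroAt_oscCurve {k : ℕ} (hk : 1 ≤ k) :
    1 - 1 / ((2 * k : ℕ) : ℝ) ∈ Ioo (0 : ℝ) 1 ∧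
      CrossesZeroAt oscCurve (1 - 1 / ((2 * k : ℕ) : ℝ)) := by
  have hk1 : (1 : ℝ) ≤ k := by exact_mod_cast hk
  have hpos : (0 : ℝ) < ((2 * k : ℕ) : ℝ) := by push_cast; linarith
  have hlt : 1 / ((2 * k : ℕ) : ℝ) < 1 := by
    rw [div_lt_one hpos]; push_cast; linarith
  have ht : 1 - 1 / ((2 * k : ℕ) : ℝ) ∈ Ioo (0 : ℝ) 1 :=
    ⟨by linarith, by linarith [one_div_pos.2 hpos]⟩
  refine ⟨ht, ?_, Or.inl ⟨?_, ?_⟩⟩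
  · rw [oscCurve_eq ⟨ht.1.le, ht.2.le⟩]
    unfold profile
    rw [sub_sub_cancel, div_div_eq_mul_div, div_one, mul_comm Real.pi, Real.sin_nat_mul_pi]
    simp
  · have hm : 1 ≤ 2 * k - 1 := by omega
    have hc : ((2 * k - 1 : ℕ) : ℝ) + 1 = ((2 * k : ℕ) : ℝ) := by
      rw [Nat.cast_sub (by omega)]; push_cast; ring
    have hlow : 1 - 1 / ((2 * k - 1 : ℕ) : ℝ) < 1 - 1 / ((2 * k : ℕ) : ℝ) := by
      have : 1 / ((2 * k : ℕ) : ℝ) < 1 / ((2 * k - 1 : ℕ) : ℝ) := by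
        refine one_div_lt_one_div_of_lt (by exact_mod_cast hm) ?_
        linarith
      linarith
    filter_upwards [Ioo_mem_nhdsLT hlow] with t ht'
    have := (oscCurve_sign hm ht'.1 (by rw [hc]; exact ht'.2)).2
    rw [Odd.neg_one_pow ⟨k - 1, by omega⟩] at this
    linarith
  · have hm : 1 ≤ 2 * k := by omega
    have hup : 1 - 1 / ((2 * k : ℕ) : ℝ) < 1 - 1 / (((2 * k : ℕ) : ℝ) + 1) := by
      have : 1 / (((2 * k : ℕ) : ℝ) + 1) < 1 / ((2 * k : ℕ) : ℝ) :=
        one_div_lt_one_div_of_lt hpos (by linarith)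
      linarith
    filter_upwards [Ioo_mem_nhdsGT hup] with t ht'
    have := (oscCurve_sign hm ht'.1 ht'.2).2
    rw [Even.neg_one_pow ⟨k, by omega⟩] at this
    linarith

theorem infinite_crossings : {t | t ∈ Ioo (0 : ℝ) 1 ∧ CrossesZeroAt oscCurve t}.Infinite := by
  refine infinite_of_injective_forall_mem
    (f := fun n : ℕ => 1 - 1 / ((2 * (n + 1) : ℕ) : ℝ)) (fun i j hij => ?_)
    fun n => crossesZeroAt_oscCurve (by omega)
  simp only [sub_right_inj, one_div, inv_inj, Nat.cast_inj] at hij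
  omega

/-- Zeros in ]0, 1[ have the form 1 - 1/n, a countable set. For almost every t the solution is
therefore continuous in x at the axis, which makes both traces equal to u(·, 0). -/
theorem ae_oscCurve_ne_zero : ∀ᵐ t ∂(volume.restrict (Ioo (0 : ℝ) 1)), oscCurve t ≠ 0 := by
  have hc : (range fun n : ℤ => 1 - 1 / (n : ℝ)).Countable := countable_range _
  filter_upwards [ae_restrict_of_ae (hc.ae_notMem volume), ae_restrict_mem measurableSet_Ioo]
    with t ht htI h0
  rw [oscCurve_eq ⟨htI.1.le, htI.2.le⟩] at h0
  have hs : 0 < 1 - t := by linarith [htI.2]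
  unfold profile at h0
  have h1 : Real.sin (Real.pi / (1 - t)) = 0 := by
    rcases mul_eq_zero.1 ((div_eq_zero_iff.1 h0).resolve_right (by norm_num)) with h | h
    · exact absurd h (by positivity)
    · exact h
  obtain ⟨n, hn⟩ := Real.sin_eq_zero_iff.1 h1
  refine ht ⟨n, ?_⟩
  rw [eq_div_iff hs.ne'] at hn
  have hn' : (n : ℝ) * (1 - t) = 1 := by
    have := Real.pi_ne_zero
    have h2 : Real.pi * ((n : ℝ) * (1 - t) - 1) = 0 := by linarith
    linarith [(mul_eq_zero.1 h2).resolve_left this]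
  have hn0 : (n : ℝ) ≠ 0 := by
    rintro h
    rw [h, zero_mul] at hn'
    exact zero_ne_one hn'
  simp only
  field_simp
  linarith

/-- A function that stays above `1/2` or equals `-1` according to the sign of the oscillating curve
has infinite essential variation. -/
theorem essTotVar_eq_top {g : ℝ → ℝ} (hpos : ∀ t ∈ Ioo (0 : ℝ) 1, 0 < oscCurve t → 1 / 2 ≤ g t)
    (hneg : ∀ t ∈ Ioo (0 : ℝ) 1, oscCurve t < 0 → g t = -1) : essTotVar g (Ioo 0 1) = ⊤ := by
  refine iInf₂_eq_top.2 fun h hh => ?_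
  -- A representative h agrees with g only almost everywhere, so in each interval between
  -- consecutive zeros a point of agreement is selected. The signs of the curve at these points
  -- alternate, which forces a jump at every step.
  have hex : ∀ n : ℕ, ∃ t, 1 - 1 / (((n + 1 : ℕ)) : ℝ) < t ∧
      t < 1 - 1 / (((n + 1 : ℕ) : ℝ) + 1) ∧ h t = g t := by
    intro n
    set a : ℝ := 1 - 1 / (((n + 1 : ℕ)) : ℝ) with ha
    set b : ℝ := 1 - 1 / (((n + 1 : ℕ) : ℝ) + 1) with hb
    have hab : a < b := by
      have : 1 / (((n + 1 : ℕ) : ℝ) + 1) < 1 / ((n + 1 : ℕ) : ℝ) :=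
        one_div_lt_one_div_of_lt (by positivity) (by linarith)
      linarith
    have hsub : Ioo a b ⊆ Ioo 0 1 := fun t ht => (oscCurve_sign (m := n + 1) (by omega) ht.1 ht.2).1
    have h1 : ∀ᵐ t ∂(volume.restrict (Ioo a b)), h t = g t :=
      ae_restrict_of_ae_restrict_of_subset hsub hh
    have hne : (ae (volume.restrict (Ioo a b))).NeBot := by
      rw [ae_neBot, Ne, Measure.restrict_eq_zero, Real.volume_Ioo]
      simpa using hab
    obtain ⟨t, ht1, ht2⟩ := (h1.and (ae_restrict_mem measurableSet_Ioo)).exists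
    exact ⟨t, ht2.1, ht2.2, ht1⟩
  choose t ht1 ht2 ht3 using hex
  have htI : ∀ n, t n ∈ Ioo (0 : ℝ) 1 ∧ 0 < (-1) ^ (n + 1) * oscCurve (t n) := fun n =>
    oscCurve_sign (by omega) (ht1 n) (ht2 n)
  have hmono : Monotone t := by
    refine monotone_nat_of_le_succ fun n => (ht2 n).le.trans ?_
    have := (ht1 (n + 1)).le
    push_cast at this ⊢
    exact this
  have hd : ∀ n, 1 ≤ |h (t (n + 1)) - h (t n)| := by
    intro n
    rw [ht3, ht3]
    have s1 := (htI n).2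
    have s2 := (htI (n + 1)).2
    rcases Nat.even_or_odd (n + 1) with he | ho
    · rw [he.neg_one_pow] at s1
      rw [he.add_one.neg_one_pow] at s2
      have e1 := hpos _ (htI n).1 (by linarith)
      have e2 := hneg _ (htI (n + 1)).1 (by linarith)
      rw [e2, abs_of_nonpos (by linarith)]
      linarith
    · rw [ho.neg_one_pow] at s1
      rw [ho.add_one.neg_one_pow] at s2
      have e1 := hneg _ (htI n).1 (by linarith)
      have e2 := hpos _ (htI (n + 1)).1 (by linarith)
      rw [e1, abs_of_nonneg (by linarith)]
      linarith
  refine ENNReal.eq_top_of_forall_nnreal_le fun r => ?_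
  obtain ⟨N, hN⟩ := exists_nat_ge r
  have h1 := eVariationOn.sum_le (f := h) (s := Ioo 0 1) (n := N) hmono fun i => (htI i).1
  refine le_trans ?_ h1
  have h2 : ∑ i ∈ Finset.range N, (1 : ℝ≥0∞)
      ≤ ∑ i ∈ Finset.range N, edist (h (t (i + 1))) (h (t i)) := by
    refine Finset.sum_le_sum fun i _ => ?_
    rw [edist_dist, Real.dist_eq, ← ENNReal.ofReal_one]
    exact ENNReal.ofReal_le_ofReal (hd i)
  refine le_trans ?_ h2
  simp only [Finset.sum_const, Finset.card_range, nsmul_eq_mul, mul_one]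
  exact_mod_cast hN

/-! ### The initial-boundary value problem on a strip -/

/-- An entropy solution that is constant on both sides of a strip solves the initial-boundary value
problem on the strip with these constants as boundary values. -/
theorem IsEntropySolution.strip_inequality {T α β a b M : ℝ} (hT : 0 ≤ T) (hαβ : α < β)
    {u : ℝ × ℝ → ℝ} {u₀ : ℝ → ℝ} (h : IsEntropySolution burgers T u₀ u) (hu : Measurable u)
    (hM : ∀ p, |u p| ≤ M) (hu₀ : Measurable u₀) (hM₀ : ∀ x, |u₀ x| ≤ M)
    (ha : ∀ p ∈ Ioo 0 T ×ˢ Iic α, u p = a) (hb : ∀ p ∈ Ioo 0 T ×ˢ Ici β, u p = b)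
    (ha₀ : ∀ x ≤ α, u₀ x = a) (hb₀ : ∀ x, β ≤ x → u₀ x = b) (c : ℝ) {φ : ℝ × ℝ → ℝ}
    (hφ : IsTestFunction T φ) :
    0 ≤ kruzhkovIntegral burgers T (Ioo α β) u φ c + (∫ x in Ioo α β, φ (0, x) * |u₀ x - c|)
      + (∫ t in Ioo 0 T, φ (t, α) * kruzhkovFlux burgers c a)
      - ∫ t in Ioo 0 T, φ (t, β) * kruzhkovFlux burgers c b := by
  have hmain := h.entropy c φ hφ
  obtain ⟨K, hK⟩ := hφ.isLipschitzTest.lip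
  obtain ⟨R, T', -, hs⟩ := hφ.isLipschitzTest.support
  obtain ⟨D, hD⟩ := hφ.isLipschitzTest.exists_bound
  have hz : ∀ p, R < ‖p‖ → φ p = 0 := fun p hp => by
    by_contra hne
    exact absurd (hs p hne).1 (not_le.2 hp)
  have hφm : Measurable φ := hK.continuous.measurable
  have hint : ∀ s, IntegrableOn (fun p => fderiv ℝ φ p (1, 0) * |u p - c| +
      fderiv ℝ φ p (0, 1) * kruzhkovFlux burgers c (u p)) s := fun s => by
    simp only [kruzhkovFlux_burgers]
    exact integrable_entropy (w := fun _ => c) hu measurable_const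
      (fun p => (hM p).trans (le_max_left M |c|)) (fun _ => le_max_right M |c|)
      (fun p => norm_fderiv_le_of_lipschitz ℝ hK) hz s
  have hint₀ : Integrable fun x => φ (0, x) * |u₀ x - c| := by
    refine integrable_initial (M := M + |c|) (R := R) (by fun_prop) (by fun_prop) (fun x => ?_)
      (fun x => hD _) (fun x hx => hz _ (by rw [Prod.norm_def]; simpa using hx))
    rw [abs_abs]
    exact (abs_sub _ _).trans (by linarith [hM₀ x])
  have hun : (univ : Set ℝ) = Iic α ∪ (Ioo α β ∪ Ici β) := by
    rw [Ioo_union_Ici_eq_Ioi hαβ, Iic_union_Ioi]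
  have hd1 : Disjoint (Iic α) (Ioo α β ∪ Ici β) := by
    rw [Ioo_union_Ici_eq_Ioi hαβ]; exact Iic_disjoint_Ioi le_rfl
  have hd2 : Disjoint (Ioo α β) (Ici β) :=
    disjoint_left.2 fun x hx hx' => absurd hx.2 (not_lt.2 hx')
  have split : ∀ J : Set ℝ, kruzhkovIntegral burgers T J u φ c =
      ∫ p in Ioo 0 T ×ˢ J, (fderiv ℝ φ p (1, 0) * |u p - c| +
        fderiv ℝ φ p (0, 1) * kruzhkovFlux burgers c (u p)) := fun _ => rfl
  have e1 : kruzhkovIntegral burgers T univ u φ c = kruzhkovIntegral burgers T (Iic α) u φ c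
      + (kruzhkovIntegral burgers T (Ioo α β) u φ c + kruzhkovIntegral burgers T (Ici β) u φ c) := by
    simp only [split]
    rw [hun, prod_union, setIntegral_union (hd1.set_prod_right _ _)
      (measurableSet_Ioo.prod (measurableSet_Ioo.union measurableSet_Ici)) (hint _) (hint _),
      prod_union, setIntegral_union (hd2.set_prod_right _ _)
      (measurableSet_Ioo.prod measurableSet_Ici) (hint _) (hint _)]
  have e2 : ∫ x, φ (0, x) * |u₀ x - c| = (∫ x in Iic α, φ (0, x) * |u₀ x - c|)
      + ((∫ x in Ioo α β, φ (0, x) * |u₀ x - c|) + ∫ x in Ici β, φ (0, x) * |u₀ x - c|) := by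
    rw [← setIntegral_univ, hun, setIntegral_union hd1 (measurableSet_Ioo.union measurableSet_Ici)
      hint₀.integrableOn hint₀.integrableOn, setIntegral_union hd2 measurableSet_Ici
      hint₀.integrableOn hint₀.integrableOn]
  -- Where the solution is a constant, the time term cancels the initial term, and only the entropy
  -- flux through the boundary line of the region is left.
  have side : ∀ (J : Set ℝ) (k : ℝ), MeasurableSet J → (∀ p ∈ Ioo 0 T ×ˢ J, u p = k) →
      (∀ x ∈ J, u₀ x = k) → kruzhkovIntegral burgers T J u φ c + ∫ x in J, φ (0, x) * |u₀ x - c|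
        = (∫ p in Ioo 0 T ×ˢ J, fderiv ℝ φ p (0, 1)) * kruzhkovFlux burgers c k := by
    intro J k hJ h1 h2
    have i1 := (hφ.integrableOn_fderiv (1, 0)).integrableOn (s := Ioo 0 T ×ˢ J)
    have i2 := (hφ.integrableOn_fderiv (0, 1)).integrableOn (s := Ioo 0 T ×ˢ J)
    rw [← Measure.volume_eq_prod] at i1 i2
    have h3 : kruzhkovIntegral burgers T J u φ c = ∫ p in Ioo 0 T ×ˢ J,
        (fderiv ℝ φ p (1, 0) * |k - c| + fderiv ℝ φ p (0, 1) * kruzhkovFlux burgers c k) := by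
      rw [split]
      refine setIntegral_congr_fun (measurableSet_Ioo.prod hJ) fun p hp => ?_
      simp only [h1 p hp]
    have h4 : ∫ x in J, φ (0, x) * |u₀ x - c| = ∫ x in J, φ (0, x) * |k - c| := by
      refine setIntegral_congr_fun hJ fun x hx => ?_
      simp only [h2 x hx]
    rw [h3, h4, integral_add (i1.mul_const _) (i2.mul_const _), integral_mul_const,
      integral_mul_const, integral_mul_const, hφ.integral_fderiv_time hT]
    ring
  have s1 := side (Iic α) a measurableSet_Iic ha ha₀
  have s2 := side (Ici β) b measurableSet_Ici hb hb₀
  rw [hφ.integral_fderiv_space_Iic] at s1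
  rw [hφ.integral_fderiv_space_Ici] at s2
  rw [integral_mul_const, integral_mul_const]
  rw [e1, e2] at hmain
  linarith

/-! ### Traces and shock conditions of the glued function -/

theorem essTendstoL1_of_eventually_const {w : ℝ × ℝ → ℝ} {T k : ℝ} {l : Filter ℝ}
    (h : ∀ᶠ y in l, ∀ t ∈ Ioo 0 T, w (t, y) = k) : EssTendstoL1 w T l (fun _ => k) := by
  refine Tendsto.mono_left ?_ inf_le_left
  refine tendsto_const_nhds.congr' ?_
  filter_upwards [h] with y hy
  rw [setLIntegral_congr_fun (g := fun _ => 0) measurableSet_Ioo (fun t ht => by simp [hy t ht])]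
  simp

/-- Traces along a line that meets the shock curve in a null set. -/
theorem IsShockPair.essTendstoL1 {T M : ℝ} {γ : ℝ → ℝ} {uL uR : ℝ × ℝ → ℝ}
    (hu : IsShockPair T M γ uL uR) {x : ℝ}
    (hγ : ∀ᵐ t ∂(volume.restrict (Ioo 0 T)), γ t ≠ x) {l : Filter ℝ} (hl : l ≤ 𝓝 x) :
    EssTendstoL1 (glue γ uL uR) T l (fun t => glue γ uL uR (t, x)) := by
  refine Tendsto.mono_left ?_ (inf_le_left.trans hl)
  have hgm := hu.glue_measurable
  obtain ⟨K₁, h₁⟩ := hu.left.lip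
  obtain ⟨K₂, h₂⟩ := hu.right.lip
  have h := tendsto_lintegral_filter_of_dominated_convergence (μ := volume.restrict (Ioo 0 T))
    (l := 𝓝 x) (F := fun y t => ‖glue γ uL uR (t, y) - glue γ uL uR (t, x)‖ₑ) (f := fun _ => 0)
    (fun _ => ENNReal.ofReal (2 * M)) ?_ ?_ ?_ ?_
  · simpa using h
  · refine Eventually.of_forall fun y => ?_
    have m1 : Measurable fun t : ℝ => glue γ uL uR (t, y) := hgm.comp (by fun_prop)
    have m2 : Measurable fun t : ℝ => glue γ uL uR (t, x) := hgm.comp (by fun_prop)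
    exact (m1.sub m2).enorm
  · refine Eventually.of_forall fun y => Eventually.of_forall fun t => ?_
    rw [Real.enorm_eq_ofReal_abs]
    refine ENNReal.ofReal_le_ofReal ((abs_sub _ _).trans ?_)
    linarith [hu.glue_bound (t, y), hu.glue_bound (t, x)]
  · rw [lintegral_const, Measure.restrict_apply_univ, Real.volume_Ioo]
    exact (ENNReal.mul_lt_top ENNReal.ofReal_lt_top ENNReal.ofReal_lt_top).ne
  · filter_upwards [hγ] with t ht
    -- If the curve is off x at time t, only one Lipschitz piece is seen near (t, x); dominated
    -- convergence with the bound 2M then gives the L¹ limit.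
    have hc : ContinuousAt (fun y => glue γ uL uR (t, y)) x := by
      rcases lt_or_gt_of_ne ht with h | h
      · have : (fun y => glue γ uL uR (t, y)) =ᶠ[𝓝 x] fun y => uR (t, y) := by
          filter_upwards [lt_mem_nhds h] with y hy
          exact if_neg (not_le.2 hy)
        exact (h₂.continuous.comp (by fun_prop : Continuous fun y : ℝ => (t, y))).continuousAt.congr
          this.symm
      · have : (fun y => glue γ uL uR (t, y)) =ᶠ[𝓝 x] fun y => uL (t, y) := by
          filter_upwards [gt_mem_nhds h] with y hy
          exact if_pos hy.le
        exact (h₁.continuous.comp (by fun_prop : Continuous fun y : ℝ => (t, y))).continuousAt.congr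
          this.symm
    have h3 := (hc.tendsto.sub_const (glue γ uL uR (t, x))).enorm
    simpa using h3

/-- The glued function has the shock curve `γ` if the two pieces differ along it. -/
theorem IsShockPair.isShockCurve {T M : ℝ} {γ : ℝ → ℝ} {uL uR : ℝ × ℝ → ℝ}
    (hu : IsShockPair T M γ uL uR) (hγ : ContDiffOn ℝ 1 γ (Ioo 0 T))
    (hlt : ∀ t ∈ Ioo 0 T, uR (t, γ t) < uL (t, γ t)) :
    IsShockCurve burgers T (glue γ uL uR) γ (fun t => uL (t, γ t)) (fun t => uR (t, γ t)) := by
  obtain ⟨K₁, h₁⟩ := hu.left.lip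
  obtain ⟨K₂, h₂⟩ := hu.right.lip
  have hb : ∀ v, deriv burgers v = 2 * v := fun v => by
    have : HasDerivAt burgers (2 * v) v := by
      exact HasDerivAt.congr_deriv (f := burgers) (hasDerivAt_pow 2 v) (by norm_num)
    exact this.deriv
  refine ⟨hγ, fun t ht => ?_, fun t ht => ?_, fun t ht => ?_, fun t ht => ?_⟩
  · refine (h₁.continuous.continuousAt.tendsto.mono_left nhdsWithin_le_nhds).congr' ?_
    filter_upwards [self_mem_nhdsWithin] with p hp
    exact (if_pos hp.2.le).symm
  · refine (h₂.continuous.continuousAt.tendsto.mono_left nhdsWithin_le_nhds).congr' ?_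
    filter_upwards [self_mem_nhdsWithin] with p hp
    exact (if_neg (not_le.2 hp.2)).symm
  · rw [(hu.rankine_hugoniot t ht).deriv]
    unfold burgers
    ring
  · rw [(hu.rankine_hugoniot t ht).deriv, hb, hb]
    have := hlt t ht
    constructor <;> linarith

/-! ### The counterexample -/

theorem contDiff_burgers : ContDiff ℝ 2 burgers := contDiff_id.pow 2

theorem convexOn_burgers : ConvexOn ℝ univ burgers := Even.convexOn_pow even_two

/-- To be integrable the data are cut off by ramps of slope 1/8, the steepest allowed for `evolve`,
placed so far out that by finite speed they do not influence -4 ≤ x ≤ 10 up to time 1. The cut-off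
keeps wR ≤ 0 ≤ wL, which orders the two pieces everywhere. -/
theorem exists_unbounded_trace :
    ∃ (T : ℝ) (u₀ : ℝ → ℝ) (u : ℝ × ℝ → ℝ) (γ um up : ℝ → ℝ),
      0 < T ∧ MemBV u₀ univ ∧
      IsEntropySolution burgers T u₀ u ∧
      (∀ v, IsEntropySolution burgers T u₀ v →
        v =ᵐ[volume.restrict (Ioo 0 T ×ˢ univ)] u) ∧
      IsShockCurve burgers T u γ um up ∧
      {t | t ∈ Ioo 0 T ∧ CrossesZeroAt γ t}.Infinite ∧
      IsLeftTrace u T 0 (fun t => u (t, 0)) ∧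
      IsRightTrace u T 0 (fun t => u (t, 0)) ∧
      essTotVar (fun t => u (t, 0)) (Ioo 0 T) = ⊤ ∧
      ∃ (α β : ℝ) (ul ur : ℝ → ℝ),
        α < 0 ∧ 0 < β ∧ (∀ t ∈ Ioo 0 T, γ t ∈ Ioo α β) ∧
        MemBV u₀ (Ioo α β) ∧ MemBV ul (Ioo 0 T) ∧ MemBV ur (Ioo 0 T) ∧
        IsEntropySolutionIBVP burgers T α β u₀ ul ur u := by
  obtain ⟨w, hwl, hwb, hw1, hwγ⟩ := exists_core_data
  have hwM : ∀ y, |w y| ≤ 3 / 2 := fun y => abs_le.2 ⟨by linarith [(hwb y).1], (hwb y).2⟩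
  -- the initial data to the left and to the right of the shock
  set wL : ℝ → ℝ := fun y => min (w y) (max 0 ((y + 20) / 8)) with hwL
  set wR : ℝ → ℝ := fun y => -max 0 (min 1 ((20 - y) / 8)) with hwR
  have hwLl : ∀ y z, |wL y - wL z| ≤ 1 / 8 * |y - z| := by
    intro y z
    refine (abs_min_sub_min_le_max _ _ _ _).trans (max_le (hwl y z) ?_)
    have h1 := abs_max_sub_max_le_max 0 ((y + 20) / 8) 0 ((z + 20) / 8)
    refine h1.trans (max_le (by rw [sub_zero, abs_zero]; positivity) ?_)
    rw [show (y + 20) / 8 - (z + 20) / 8 = 1 / 8 * (y - z) by ring, abs_mul,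
      abs_of_pos (by norm_num : (0 : ℝ) < 1 / 8)]
  have hwRl : ∀ y z, |wR y - wR z| ≤ 1 / 8 * |y - z| := by
    intro y z
    have h1 := abs_clamp_sub_le 0 1 ((20 - z) / 8) ((20 - y) / 8)
    rw [show (20 - z) / 8 - (20 - y) / 8 = 1 / 8 * (y - z) by ring, abs_mul,
      abs_of_pos (by norm_num : (0 : ℝ) < 1 / 8)] at h1
    rw [show wR y - wR z = max 0 (min 1 ((20 - z) / 8)) - max 0 (min 1 ((20 - y) / 8)) by
      simp only [hwR]; ring]
    exact h1
  have hwLb : ∀ y, 0 ≤ wL y ∧ wL y ≤ 3 / 2 := fun y =>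
    ⟨le_min (by linarith [(hwb y).1]) (le_max_left _ _), (min_le_left _ _).trans (hwb y).2⟩
  have hwRb : ∀ y, -1 ≤ wR y ∧ wR y ≤ 0 := fun y =>
    ⟨by have := (clamp_mem ((20 - y) / 8)).2; simp only [hwR]; linarith,
      by have := (clamp_mem ((20 - y) / 8)).1; simp only [hwR]; linarith⟩
  have hwLM : ∀ y, |wL y| ≤ 3 / 2 := fun y => abs_le.2 ⟨by linarith [(hwLb y).1], (hwLb y).2⟩
  have hwRM : ∀ y, |wR y| ≤ 3 / 2 := fun y =>
    abs_le.2 ⟨by linarith [(hwRb y).1], by linarith [(hwRb y).2]⟩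
  -- From -8 on, the ramp (y + 20)/8 is at least 3/2 and hence above w.
  have hwLw : ∀ y, -8 ≤ y → wL y = w y := fun y hy =>
    min_eq_left ((hwb y).2.trans (le_max_of_le_right (by linarith)))
  have hwL0 : ∀ y ≤ -20, wL y = 0 := by
    intro y hy
    simp only [hwL]
    rw [max_eq_left (by linarith)]
    exact min_eq_right (by linarith [(hwb y).1])
  have hwR1 : ∀ y ≤ 12, wR y = -1 := by
    intro y hy
    simp only [hwR]
    rw [min_eq_left (by linarith), max_eq_right zero_le_one]
  have hwR0 : ∀ y, 20 ≤ y → wR y = 0 := by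
    intro y hy
    simp only [hwR]
    rw [max_eq_left ((min_le_right _ _).trans (by linarith)), neg_zero]
  -- values of the evolved data
  have hLw : ∀ t ∈ Icc (0 : ℝ) 1, ∀ x, -4 ≤ x → evolve wL (t, x) = evolve w (t, x) := by
    intro t ht x hx
    obtain ⟨y, hy⟩ := exists_foot hwl ht x
    -- The speed 2w is at most 3, so characteristics reaching x ≥ -4 by time 1 start at or to the
    -- right of -7.
    have hy8 : -8 ≤ y := by
      have : t * w y ≤ 1 * (3 / 2) :=
        mul_le_mul ht.2 (hwb y).2 (by linarith [(hwb y).1]) zero_le_one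
      linarith
    rw [evolve_eq hwl ht hy, evolve_eq hwLl ht (by rw [hwLw y hy8]; exact hy), hwLw y hy8]
  have hw2 : ∀ t ∈ Icc (0 : ℝ) 1, ∀ x ≤ -2, evolve w (t, x) = 1 := by
    intro t ht x hx
    have h1 : w (x - 2 * t) = 1 := hw1 _ (by linarith [ht.1])
    rw [evolve_eq hwl ht (y := x - 2 * t) (by rw [h1]; ring), h1]
  have hR1 : ∀ t ∈ Icc (0 : ℝ) 1, ∀ x ≤ 10, evolve wR (t, x) = -1 := by
    intro t ht x hx
    have h1 : wR (x + 2 * t) = -1 := hwR1 _ (by linarith [ht.2])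
    rw [evolve_eq hwRl ht (y := x + 2 * t) (by rw [h1]; ring), h1]
  have hγb := fun t => abs_le.1 (abs_oscCurve_le t)
  have hwγ' : ∀ t ∈ Icc (0 : ℝ) 1, evolve w (t, oscCurve t) = 1 - profileDeriv (1 - t) := by
    intro t ht
    obtain ⟨y, -, h1, h2⟩ := hwγ t ht
    rw [evolve_eq hwl ht h1, h2]
  have hLγ : ∀ t ∈ Icc (0 : ℝ) 1, evolve wL (t, oscCurve t) = 1 - profileDeriv (1 - t) :=
    fun t ht => by rw [hLw t ht _ (by linarith [(hγb t).1]), hwγ' t ht]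
  have hRγ : ∀ t ∈ Icc (0 : ℝ) 1, evolve wR (t, oscCurve t) = -1 :=
    fun t ht => hR1 t ht _ (by linarith [(hγb t).2])
  -- the two shock pairs
  have hwe : ∀ p, 1 / 2 ≤ evolve w p := fun p => (hwb _).1
  have pair : IsShockPair 1 (3 / 2) oscCurve (evolve wL) (evolve wR) := by
    refine ⟨isLipschitzSolution_evolve hwLl hwLM, isLipschitzSolution_evolve hwRl hwRM,
      exists_lipschitzWith_oscCurve, fun p => (hwRb _).2.trans (hwLb _).1, fun t ht => ?_⟩
    have ht' : t ∈ Icc (0 : ℝ) 1 := ⟨ht.1.le, ht.2.le⟩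
    rw [hLγ t ht', hRγ t ht']
    exact (hasDerivAt_oscCurve ht).congr_deriv (by ring)
  -- The same shock without the cut-off. Its data are not integrable, but the solution is 1 for x ≤
  -- -2 and -1 for x ≥ 1, as the strip inequality requires, and it agrees with the integrable one on
  -- a neighbourhood of the strip.
  have pair' : IsShockPair 1 (3 / 2) oscCurve (evolve w) (fun _ => -1) := by
    refine ⟨isLipschitzSolution_evolve hwl hwM,
      ⟨⟨0, LipschitzWith.const _⟩, fun _ => by norm_num, fun p _ _ => by simp⟩,
      exists_lipschitzWith_oscCurve, fun p => by linarith [hwe p], fun t ht => ?_⟩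
    rw [hwγ' t ⟨ht.1.le, ht.2.le⟩]
    exact (hasDerivAt_oscCurve ht).congr_deriv (by ring)
  set u := glue oscCurve (evolve wL) (evolve wR) with hu
  set v := glue oscCurve (evolve w) (fun _ => -1) with hv
  have huv : ∀ t ∈ Icc (0 : ℝ) 1, ∀ x, -4 ≤ x → x ≤ 10 → u (t, x) = v (t, x) := by
    intro t ht x h1 h2
    simp only [hu, hv, glue]
    split_ifs
    · exact hLw t ht x h1
    · exact hR1 t ht x h2
  have hv1 : ∀ t ∈ Icc (0 : ℝ) 1, ∀ x ≤ -2, v (t, x) = 1 := by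
    intro t ht x hx
    simp only [hv, glue]
    rw [if_pos (by linarith [(hγb t).1]), hw2 t ht x hx]
  have hv2 : ∀ t, ∀ x, 1 ≤ x → v (t, x) = -1 := by
    intro t x hx
    simp only [hv, glue]
    rw [if_neg (by linarith [(hγb t).2])]
  have i0 : (0 : ℝ) ∈ Icc (0 : ℝ) 1 := ⟨le_rfl, zero_le_one⟩
  have hum : Measurable u := pair.glue_measurable
  have hvm : Measurable v := pair'.glue_measurable
  have hγ0 : oscCurve 0 = 0 := by
    rw [oscCurve_eq i0]
    simp [profile]
  have hu₀m : Measurable fun x => u (0, x) := hum.comp (by fun_prop)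
  have hv₀m : Measurable fun x => v (0, x) := hvm.comp (by fun_prop)
  obtain ⟨hi, hvar⟩ := memBV_of_pieces (u := fun x => u (0, x)) (L := 20) (by norm_num) hwLl hwRl
    (fun y => (hwLM y).trans (by norm_num)) (fun y => (hwRM y).trans (by norm_num)) hwL0 hwR0
    (fun x => by
      simp only [hu, glue, hγ0, evolve_zero hwLl, evolve_zero hwRl]) hu₀m
  have htr : IntegrableOn (fun t => u (t, 0)) (Ioo 0 1) :=
    Measure.integrableOn_of_bounded (M := 3 / 2) (by simp)
      (hum.comp (by fun_prop : Measurable fun t : ℝ => (t, (0 : ℝ)))).aestronglyMeasurable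
      (Eventually.of_forall fun t => pair.glue_bound (t, 0))
  have hα : ∀ᶠ y in 𝓝[>] (-3 : ℝ), ∀ t ∈ Ioo (0 : ℝ) 1, u (t, y) = 1 := by
    filter_upwards [Ioo_mem_nhdsGT (by norm_num : (-3 : ℝ) < -2)] with y hy t ht
    have ht' : t ∈ Icc (0 : ℝ) 1 := ⟨ht.1.le, ht.2.le⟩
    rw [huv t ht' y (by linarith [hy.1]) (by linarith [hy.2]), hv1 t ht' y hy.2.le]
  have hβ : ∀ᶠ y in 𝓝[<] (3 : ℝ), ∀ t ∈ Ioo (0 : ℝ) 1, u (t, y) = -1 := by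
    filter_upwards [Ioo_mem_nhdsLT (by norm_num : (1 : ℝ) < 3)] with y hy t ht
    have ht' : t ∈ Icc (0 : ℝ) 1 := ⟨ht.1.le, ht.2.le⟩
    rw [huv t ht' y (by linarith [hy.1]) (by linarith [hy.2]), hv2 t y hy.1.le]
  refine ⟨1, fun x => u (0, x), u, oscCurve, fun t => evolve wL (t, oscCurve t),
    fun t => evolve wR (t, oscCurve t), one_pos, ⟨hi, (essTotVar_le _ _).trans_lt hvar⟩,
    pair.isEntropySolution zero_le_one, fun _ h => pair.unique h,
    pair.isShockCurve contDiffOn_oscCurve fun t ht => ?_, infinite_crossings,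
    ⟨htr, pair.essTendstoL1 ae_oscCurve_ne_zero nhdsWithin_le_nhds⟩,
    ⟨htr, pair.essTendstoL1 ae_oscCurve_ne_zero nhdsWithin_le_nhds⟩,
    essTotVar_eq_top (fun t ht hpos => ?_) (fun t ht hneg => ?_),
    -3, 3, fun _ => 1, fun _ => -1, by norm_num, by norm_num,
    fun t _ => ⟨by linarith [(hγb t).1], by linarith [(hγb t).2]⟩,
    ⟨hi.mono_set (subset_univ _), ?_⟩, memBV_const _ _ _, memBV_const _ _ _, ?_, ?_⟩
  · have ht' : t ∈ Icc (0 : ℝ) 1 := ⟨ht.1.le, ht.2.le⟩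
    rw [hRγ t ht', hLw t ht' _ (by linarith [(hγb t).1])]
    linarith [hwe (t, oscCurve t)]
  · have ht' : t ∈ Icc (0 : ℝ) 1 := ⟨ht.1.le, ht.2.le⟩
    rw [huv t ht' 0 (by norm_num) (by norm_num)]
    simp only [hv, glue]
    rw [if_pos hpos.le]
    exact (hwb _).1
  · have ht' : t ∈ Icc (0 : ℝ) 1 := ⟨ht.1.le, ht.2.le⟩
    rw [huv t ht' 0 (by norm_num) (by norm_num)]
    simp only [hv, glue]
    rw [if_neg (not_le.2 hneg)]
  · exact ((essTotVar_le _ _).trans (eVariationOn.mono _ (subset_univ _))).trans_lt hvar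
  · exact (pair.isEntropySolution zero_le_one).bounded.mono_measure
      (Measure.restrict_mono (prod_mono le_rfl (subset_univ _)) le_rfl)
  · refine ⟨fun _ => 1, fun _ => -1, memLp_top_const _, memLp_top_const _,
      essTendstoL1_of_eventually_const (k := burgers 1) ?_,
      essTendstoL1_of_eventually_const (k := burgers (-1)) ?_,
      fun c => essTendstoL1_of_eventually_const (k := kruzhkovFlux burgers c 1) ?_,
      fun c => essTendstoL1_of_eventually_const (k := kruzhkovFlux burgers c (-1)) ?_,
      fun c φ hφ => ?_⟩
    · filter_upwards [hα] with y hy t ht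
      rw [hy t ht]
    · filter_upwards [hβ] with y hy t ht
      rw [hy t ht]
    · filter_upwards [hα] with y hy t ht
      rw [hy t ht]
    · filter_upwards [hβ] with y hy t ht
      rw [hy t ht]
    -- The boundary data equal the traces 1 and -1, so the Bardos–Le Roux–Nédélec boundary terms are
    -- exactly the Kruzhkov fluxes of these constants.
    · have h := (pair'.isEntropySolution zero_le_one).strip_inequality (α := -3) (β := 3) (a := 1)
        (b := -1) zero_le_one (by norm_num) hvm pair'.glue_bound hv₀m
        (fun x => pair'.glue_bound (0, x))
        (fun p hp => hv1 p.1 ⟨hp.1.1.le, hp.1.2.le⟩ p.2 (by linarith [mem_Iic.1 hp.2]))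
        (fun p hp => hv2 p.1 p.2 (by linarith [mem_Ici.1 hp.2]))
        (fun x hx => hv1 0 i0 x (by linarith)) (fun x hx => hv2 0 x (by linarith)) c hφ
      have e1 : kruzhkovIntegral burgers 1 (Ioo (-3) 3) u φ c
          = kruzhkovIntegral burgers 1 (Ioo (-3) 3) v φ c := by
        refine setIntegral_congr_fun (measurableSet_Ioo.prod measurableSet_Ioo) fun p hp => ?_
        have : u p = v p := huv p.1 ⟨hp.1.1.le, hp.1.2.le⟩ p.2 (by linarith [hp.2.1])
          (by linarith [hp.2.2])
        simp only [this]
      have e2 : ∫ x in Ioo (-3 : ℝ) 3, φ (0, x) * |u (0, x) - c|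
          = ∫ x in Ioo (-3 : ℝ) 3, φ (0, x) * |v (0, x) - c| := by
        refine setIntegral_congr_fun measurableSet_Ioo fun x hx => ?_
        simp only [huv 0 i0 x (by linarith [hx.1]) (by linarith [hx.2])]
      rw [e1, e2]
      exact h

/-! ### Failure of the variation bounds -/

/-- Whatever the value of C, the claimed bound is `ENNReal.ofReal` of a real number and so finite,
whereas the trace at 0 has infinite variation. -/
theorem not_traceVariationControlled {IsTrace : (ℝ × ℝ → ℝ) → ℝ → ℝ → (ℝ → ℝ) → Prop} {T : ℝ}
    {u₀ g : ℝ → ℝ} {u : ℝ × ℝ → ℝ} (hT : 0 < T) (h₀ : MemBV u₀ univ)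
    (hu : IsEntropySolution burgers T u₀ u) (hg : IsTrace u T 0 g)
    (htop : essTotVar g (Ioo 0 T) = ⊤) : ¬ TraceVariationControlled IsTrace := by
  rintro ⟨C, hC⟩
  have := hC burgers contDiff_burgers (Or.inl convexOn_burgers) u₀ h₀ T hT u hu 0 g hg
  rw [htop, top_le_iff] at this
  exact ENNReal.ofReal_ne_top this

theorem not_traceVariationLeInitial {IsTrace : (ℝ × ℝ → ℝ) → ℝ → ℝ → (ℝ → ℝ) → Prop} {T : ℝ}
    {u₀ g : ℝ → ℝ} {u : ℝ × ℝ → ℝ} (hT : 0 < T) (h₀ : MemBV u₀ univ)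
    (hu : IsEntropySolution burgers T u₀ u) (hg : IsTrace u T 0 g)
    (htop : essTotVar g (Ioo 0 T) = ⊤) : ¬ TraceVariationLeInitial IsTrace := by
  intro hC
  have := hC burgers contDiff_burgers convexOn_burgers u₀ h₀ T hT u hu 0 g hg
  rw [htop, top_le_iff] at this
  exact h₀.2.ne this

end

theorem mainTheorem7 :
    (∃ (T : ℝ) (u₀ : ℝ → ℝ) (u : ℝ × ℝ → ℝ) (γ um up : ℝ → ℝ),
      0 < T ∧ MemBV u₀ univ ∧
      -- `u` is the entropy admissible solution of the Cauchy problem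
      IsEntropySolution burgers T u₀ u ∧
      (∀ v, IsEntropySolution burgers T u₀ v →
        v =ᵐ[volume.restrict (Ioo 0 T ×ˢ univ)] u) ∧
      -- `u` has a shock curve that crosses the axis infinitely often
      IsShockCurve burgers T u γ um up ∧
      {t | t ∈ Ioo 0 T ∧ CrossesZeroAt γ t}.Infinite ∧
      -- `u(·, 0)` coincides with both traces and has infinite total variation
      IsLeftTrace u T 0 (fun t => u (t, 0)) ∧
      IsRightTrace u T 0 (fun t => u (t, 0)) ∧
      essTotVar (fun t => u (t, 0)) (Ioo 0 T) = ⊤ ∧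
      -- on a strip around the curve, `u` solves an initial-boundary value problem with `BV` data
      ∃ (α β : ℝ) (ul ur : ℝ → ℝ),
        α < 0 ∧ 0 < β ∧ (∀ t ∈ Ioo 0 T, γ t ∈ Ioo α β) ∧
        MemBV u₀ (Ioo α β) ∧ MemBV ul (Ioo 0 T) ∧ MemBV ur (Ioo 0 T) ∧
        IsEntropySolutionIBVP burgers T α β u₀ ul ur u) ∧
    -- control by a constant depending on `TotVar u₀` and `‖f'‖_∞` fails for the traces of `u`
    ¬ TraceVariationControlled IsLeftTrace ∧
    ¬ TraceVariationControlled IsRightTrace ∧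
    -- control by `TotVar u₀` fails without monotonicity of the flux
    ¬ TraceVariationLeInitial IsLeftTrace ∧
    ¬ TraceVariationLeInitial IsRightTrace := by
  obtain ⟨T, u₀, u, γ, um, up, hT, h₀, hu, huniq, hshock, hcross, hl, hr, htop, hibvp⟩ :=
    exists_unbounded_trace
  exact ⟨⟨T, u₀, u, γ, um, up, hT, h₀, hu, huniq, hshock, hcross, hl, hr, htop, hibvp⟩,
    not_traceVariationControlled hT h₀ hu hl htop, not_traceVariationControlled hT h₀ hu hr htop,
    not_traceVariationLeInitial hT h₀ hu hl htop, not_traceVariationLeInitial hT h₀ hu hr htop⟩
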